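/- Let $p\in(0,1]$ and let $v$ be a non-negative random variable. For all pairs of integers $i<j$ let $v_{i,j}$ be a random variable with the distribution of $v$, and let the directed edge $(i,j)$ be present with probability $p$; all the weights $v_{i,j}$ and all the edge presences are independent. For $i\le j$ let $w_{i,j}$ be the maximum of $\sum_{k=1}^{m}v_{i_{k-1},i_k}$ over all paths $i=i_0<i_1<\dots<i_m=j$, $m\ge 0$, all of whose edges are present ($w_{i,j}=-\infty$ if there is no such path). Call $x\in\mathbb Z$ strongly connected if there is a path of present edges from $x$ to every $y>x$ and from every $y<x$ to $x$. Let $\gamma$ be the density of strongly connected points, $\gamma=\mathbb P(0\text{ is strongly connected})$, let $\tau_0$ be the smallest non-negative strongly connected point, and $\tau_1$ the smallest strongly connected point greater than $\tau_0$ (both exist almost surely). Fix a real number $c$. Call $x\in\mathbb Z$ a renewal point if $w_{x,x+l}\ge cl$ and $w_{x-l,x}\ge cl$ for all integers $l\ge1$, and $v_{x-j,x+l}<c(l+j)$ for all integers $j,l\ge1$ such that the edge $(x-j,x+l)$ is present. Let $\Gamma_0$ be the smallest non-negative renewal point, and $\Gamma_1$ the smallest renewal point greater than $\Gamma_0$.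 Suppose that $\mathbb E[v^3]<\infty$ and $$\gamma\,\operatorname{ess\,inf}[v]<c<\gamma\,\mathbb E\Bigl[\min_{\tau_0\le i<j\le\tau_1}v_{i,j}\Bigr],$$ where the minimum is over all pairs of integers $i<j$ in $[\tau_0,\tau_1]$, whether or not the edge $(i,j)$ is present. Then $\Gamma_0$ and $\Gamma_1$ exist almost surely, $\mathbb E[\Gamma_0]<\infty$, and consequently the typical renewal interval has finite second moment: $\mathbb E[(\Gamma_1-\Gamma_0)^2]<\infty$. -/

import Mathlib

open MeasureTheory ProbabilityTheory
open scoped ENNReal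

/-- Increasing paths from `i` to `j` in the directed graph on `ℤ` whose edges are the pairs
`(i, j)` with `i < j` and `E i j`. -/
inductive IncPath (E : ℤ → ℤ → Prop) : ℤ → ℤ → Type
  | nil (i : ℤ) : IncPath E i i
  | cons {i j k : ℤ} (hij : i < j) (he : E i j) (π : IncPath E j k) : IncPath E i k

/-- The weight of a path: the sum of the weights of its edges. -/
def IncPath.weight {E : ℤ → ℤ → Prop} (v : ℤ → ℤ → ℝ) : {i j : ℤ} → IncPath E i j → ℝ
  | _, _, .nil _ => 0
  | _, _, .cons (i := i) (j := j) _ _ π => v i j + π.weight v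

/-- The maximal weight `w_{i,j}` of a path from `i` to `j`; it is `-∞` if there is no path. -/
noncomputable def lastPassage (E : ℤ → ℤ → Prop) (v : ℤ → ℤ → ℝ) (i j : ℤ) : EReal :=
  ⨆ π : IncPath E i j, ((π.weight v : ℝ) : EReal)

/-- The strongly connected points: those joined by a path to every other point. -/
def stronglyConnectedPoints (E : ℤ → ℤ → Prop) : Set ℤ :=
  {x | (∀ y, x < y → Nonempty (IncPath E x y)) ∧ (∀ y, y < x → Nonempty (IncPath E y x))}

/-- `A_x^{++}`: for every `l ≥ 1`, `w_{x,x+l} ≥ c l`. -/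
def EventPP (c : ℝ) (E : ℤ → ℤ → Prop) (v : ℤ → ℤ → ℝ) (x : ℤ) : Prop :=
  ∀ l : ℕ, 1 ≤ l → ((c * l : ℝ) : EReal) ≤ lastPassage E v x (x + l)

/-- `A_x^{-+}`: every edge of the graph with `x` strictly between its endpoints has weight less
than `c` times its length. -/
def EventMP (c : ℝ) (E : ℤ → ℤ → Prop) (v : ℤ → ℤ → ℝ) (x : ℤ) : Prop :=
  ∀ j l : ℕ, 1 ≤ j → 1 ≤ l → E (x - j) (x + l) → v (x - j) (x + l) < c * (l + j)

/-- `A_x^{--}`: for every `l ≥ 1`, `w_{x-l,x} ≥ c l`. -/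
def EventMM (c : ℝ) (E : ℤ → ℤ → Prop) (v : ℤ → ℤ → ℝ) (x : ℤ) : Prop :=
  ∀ l : ℕ, 1 ≤ l → ((c * l : ℝ) : EReal) ≤ lastPassage E v (x - l) x

/-- The set of renewal points (for the constant `c`). -/
def renewalPoints (c : ℝ) (E : ℤ → ℤ → Prop) (v : ℤ → ℤ → ℝ) : Set ℤ :=
  {x | EventPP c E v x ∧ EventMP c E v x ∧ EventMM c E v x}

/-- The point with index `0` of `S ⊆ ℤ`: its smallest non-negative element
(`⊤` if there is none). -/
noncomputable def pointZero (S : Set ℤ) : ℕ∞ :=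
  ⨅ n : ℕ, ⨅ _ : (n : ℤ) ∈ S, (n : ℕ∞)

/-- The point with index `1` of `S ⊆ ℤ`: its smallest element larger than the point with index `0`
(`⊤` if there is none). -/
noncomputable def pointOne (S : Set ℤ) : ℕ∞ :=
  ⨅ n : ℕ, ⨅ _ : (n : ℤ) ∈ S ∧ pointZero S < n, (n : ℕ∞)

/-- `min_{a ≤ i < j ≤ b} v_{i,j}` over all pairs of integers, joined by an edge or not. -/
noncomputable def minWeight (v : ℤ → ℤ → ℝ) (a b : ℕ∞) : ℝ :=
  sInf {x : ℝ | ∃ i j : ℕ, a ≤ i ∧ i < j ∧ (j : ℕ∞) ≤ b ∧ x = v i j}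

/-- The random graph model: for each pair `i < j` a weight `v i j` with law `ν` and an indicator
`α i j` telling whether the edge `(i, j)` is present, which happens with probability `p`; all the
weights and all the indicators are independent. (Values at pairs with `j ≤ i` play no role.) -/
structure IsWeightedRandomGraph {Ω : Type*} [MeasurableSpace Ω] (P : Measure Ω) (p : ℝ)
    (ν : Measure ℝ) (v : ℤ → ℤ → Ω → ℝ) (α : ℤ → ℤ → Ω → Bool) : Prop where
  measurable_weight : ∀ i j, i < j → Measurable (v i j)
  measurable_edge : ∀ i j, i < j → Measurable (α i j)
  law_weight : ∀ i j, i < j → P.map (v i j) = ν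
  prob_edge : ∀ i j, i < j → P {ω | α i j ω = true} = ENNReal.ofReal p
  indep_weight_edge : ∀ i j, i < j → IndepFun (v i j) (α i j) P
  indep_pairs : iIndepFun
    (fun (e : {e : ℤ × ℤ // e.1 < e.2}) ω => (v e.1.1 e.1.2 ω, α e.1.1 e.1.2 ω)) P

/-- The edge relation of the realisation `ω`. -/
def edgeRel {Ω : Type*} (α : ℤ → ℤ → Ω → Bool) (ω : Ω) : ℤ → ℤ → Prop :=
  fun i j => α i j ω = true

/-- The weights of the realisation `ω`. -/
def weightAt {Ω : Type*} (v : ℤ → ℤ → Ω → ℝ) (ω : Ω) : ℤ → ℤ → ℝ :=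
  fun i j => v i j ω

/-- The density `γ` of the stationary set of strongly connected points: the probability that `0` is
strongly connected. -/
noncomputable def stronglyConnectedDensity {Ω : Type*} [MeasurableSpace Ω] (P : Measure Ω)
    (α : ℤ → ℤ → Ω → Bool) : ℝ :=
  P.real {ω | (0 : ℤ) ∈ stronglyConnectedPoints (edgeRel α ω)}

/-- `min_{τ₀ ≤ i < j ≤ τ₁} v_{i,j}`, where `τ₀ < τ₁` are the first two non-negative strongly
connected points. -/
noncomputable def typicalMin {Ω : Type*} (v : ℤ → ℤ → Ω → ℝ) (α : ℤ → ℤ → Ω → Bool) (ω : Ω) : ℝ :=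
  minWeight (weightAt v ω) (pointZero (stronglyConnectedPoints (edgeRel α ω)))
    (pointOne (stronglyConnectedPoints (edgeRel α ω)))

/-- `Γ₀`, the smallest non-negative renewal point. -/
noncomputable def gammaZero {Ω : Type*} (c : ℝ) (v : ℤ → ℤ → Ω → ℝ) (α : ℤ → ℤ → Ω → Bool)
    (ω : Ω) : ℕ∞ :=
  pointZero (renewalPoints c (edgeRel α ω) (weightAt v ω))

/-- `Γ₁`, the renewal point following `Γ₀`. -/
noncomputable def gammaOne {Ω : Type*} (c : ℝ) (v : ℤ → ℤ → Ω → ℝ) (α : ℤ → ℤ → Ω → Bool)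
    (ω : Ω) : ℕ∞ :=
  pointOne (renewalPoints c (edgeRel α ω) (weightAt v ω))

/-! Whether `x` is a renewal point is decided by three disjoint families of edges: those to its
left, those passing over it and those to its right. Given that `n` is a renewal point, whether a
later (earlier) integer is one depends only on the edges to the right (left) of `n`, because long
paths can be cut at `n` and edges over `n` are harmless. So a renewal point separates past from
future. The same is true of strongly connected points, and `RegenKernel` treats both at once.
Combined with stationarity this gives two comparisons: the second moment of the typical interval is
at most about twice the mean of the first non-negative point (`tsum_sq_measure_isNext_le`), and
integrals over the interval after the first point are, up to the density, at most those over the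
typical interval (`tsum_first_next_le`). Everything thus reduces to `E[Γ₀] < ∞`.

Two moments feed that estimate. `slowMoment` controls `w_{0,l} < c l`: concatenating paths between
consecutive strongly connected points earns at least the minimal weight of each interval, at a mean
rate exceeding `c` by the upper hypothesis. Truncating and localising these gains makes them bounded
with finite range, so Hoeffding's inequality on residue classes gives a tail exponentially small in
`√l` (`exists_measureReal_not_fast_le`). `heavyMoment` is the second moment of the lengths of edges
of weight at least `c` times their length, finite because `E[v³] < ∞` (`heavyMoment_ne_top`). With
both finite, `0` is a renewal point with positive probability (`law_zero_mem_rnPts_pos`); the lower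
hypothesis on `c` excludes that every edge is heavy.

For the mean of `Γ₀`, place in `[0, 6N⁵]` two groups of `N` blocks of radius `N⁴`, separated by a
gap of length `2N⁵`. Local renewal at the block centres is independent, so each group contains a
local renewal point except with exponentially small probability. If both fail to be genuine, then a
long passage is slow, or two different long heavy edges occur (a squared, hence small, probability),
or one heavy edge spans the gap. Only the last case uses the full strength of the third moment:
summed over `N` against the increments of `6N⁵` it costs a constant times `heavyMoment`
(`tsum_incr_mul_hitMean_le`).

The work is done on a product space of marks; `map_config_eq` transfers it to the given model. -/

namespace OrderedGraph

open scoped NNReal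
open Set

/-! ### Independence of functions of disjoint families of coordinates -/

section Product

variable {ι X β γ κ : Type*} [MeasurableSpace X] [MeasurableSpace β] [MeasurableSpace γ]

/-- Filling the coordinates outside `A` with those of a fixed point does not change `f`, so no
measurable selection is needed. -/
theorem exists_measurable_comp_domRestrict {f : (ι → X) → β} (hf : Measurable f)
    {A : Set ι} (hA : DependsOn f A) (z : ι → X) :
    ∃ g : (A → X) → β, Measurable g ∧ ∀ x, f x = g (fun a => x a) := by
  classical
  refine ⟨fun y => f (fun i => if h : i ∈ A then y ⟨i, h⟩ else z i), hf.comp ?_, fun x => ?_⟩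
  · refine measurable_pi_iff.2 fun i => ?_
    by_cases h : i ∈ A
    · simp only [h, dite_true]; exact measurable_pi_apply _
    · simp only [h, dite_false]; exact measurable_const
  · exact hA fun i hi => by simp [hi]

variable (ρ : Measure X) [IsProbabilityMeasure ρ]

/-- Disjointness makes the map from the disjoint union of the `A k` to `ι` injective. The joint
restriction therefore has a product law, and currying it yields independence of the restrictions,
through which the `f k` factor. -/
theorem iIndepFun_of_dependsOn {f : κ → (ι → X) → β} (hf : ∀ k, Measurable (f k))
    {A : κ → Set ι} (hA : ∀ k, DependsOn (f k) (A k)) (hd : Pairwise (Function.onFun Disjoint A)) :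
    iIndepFun f (Measure.infinitePi fun _ : ι => ρ) := by
  have : Nonempty X := nonempty_of_isProbabilityMeasure ρ
  choose g hg hfg using fun k =>
    exists_measurable_comp_domRestrict (hf k) (hA k) (fun _ => Classical.arbitrary X)
  let σ : (Σ k, A k) → ι := fun p => p.2.1
  have hσ : Function.Injective σ := by
    rintro ⟨k, a, ha⟩ ⟨l, b, hb⟩ h
    have hab : a = b := h
    subst hab
    have : k = l := by
      by_contra hkl
      exact Set.disjoint_left.1 (hd hkl) ha hb
    subst this
    rfl
  have h1 : (Measure.infinitePi fun _ : ι => ρ).map (fun x (p : Σ k, A k) => x (σ p))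
      = Measure.infinitePi fun _ : (Σ k, A k) => ρ :=
    Measure.map_infinitePi_infinitePi_of_inj hσ
  have h2 : (Measure.infinitePi fun _ : ι => ρ).map (fun x k (a : A k) => x a)
      = Measure.infinitePi fun k => Measure.infinitePi fun _ : A k => ρ := by
    rw [← Measure.infinitePi_map_piCurry (fun k (_ : A k) => ρ), ← h1, Measure.map_map]
    · rfl
    · fun_prop
    · fun_prop
  have h3 : iIndepFun (fun k (x : ι → X) (a : A k) => x a) (Measure.infinitePi fun _ : ι => ρ) := by
    rw [iIndepFun_iff_map_fun_eq_infinitePi_map (fun k => by fun_prop), h2]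
    congr 1
    funext k
    exact (Measure.map_infinitePi_infinitePi_of_inj (P := fun _ : ι => ρ)
      (f := fun a : A k => (a : ι)) Subtype.val_injective).symm
  have h4 := h3.comp g hg
  convert h4 using 1
  funext k x
  exact hfg k x

theorem indepFun_of_dependsOn {f : (ι → X) → β} {g : (ι → X) → γ} (hf : Measurable f)
    (hg : Measurable g) {A B : Set ι} (hA : DependsOn f A) (hB : DependsOn g B)
    (hd : Disjoint A B) : IndepFun f g (Measure.infinitePi fun _ : ι => ρ) := by
  have : Nonempty X := nonempty_of_isProbabilityMeasure ρ
  obtain ⟨f', hf', hff⟩ := exists_measurable_comp_domRestrict hf hA (fun _ => Classical.arbitrary X)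
  obtain ⟨g', hg', hgg⟩ := exists_measurable_comp_domRestrict hg hB (fun _ => Classical.arbitrary X)
  classical
  let σ : (Σ k : Bool, (if k then A else B : Set ι)) → ι := fun p => p.2.1
  -- The codomains of `f` and `g` may differ, so independence is obtained for two maps with the same
  -- codomain: each keeps the coordinates of one set and freezes the others.
  let F : Bool → (ι → X) → (ι → X) := fun k x i =>
    if i ∈ (if k then A else B : Set ι) then x i else Classical.arbitrary X
  have hF : ∀ k, Measurable (F k) := fun k => by
    refine measurable_pi_iff.2 fun i => ?_
    by_cases h : i ∈ (if k then A else B : Set ι)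
    · simp only [F, h, if_true]; exact measurable_pi_apply _
    · simp only [F, h, if_false]; exact measurable_const
  have hI := iIndepFun_of_dependsOn ρ (f := F) hF (A := fun k => if k then A else B)
    (fun k x y h => by
      funext i
      simp only [F]
      by_cases hi : i ∈ (if k then A else B : Set ι)
      · rw [if_pos hi, if_pos hi, h i hi]
      · rw [if_neg hi, if_neg hi])
    (by
      intro k l hkl
      rcases k <;> rcases l <;> simp_all [Function.onFun, disjoint_comm])
  have h4 := (hI.indepFun (i := true) (j := false) (by simp)).comp hf hg
  convert h4 using 1
  · funext x
    exact hA fun i hi => by simp [F, hi]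
  · funext x
    exact hB fun i hi => by simp [F, hi]

theorem lintegral_mul_of_dependsOn {f g : (ι → X) → ℝ≥0∞} (hf : Measurable f)
    (hg : Measurable g) {A B : Set ι} (hA : DependsOn f A) (hB : DependsOn g B)
    (hd : Disjoint A B) :
    ∫⁻ x, f x * g x ∂(Measure.infinitePi fun _ : ι => ρ) =
      (∫⁻ x, f x ∂(Measure.infinitePi fun _ : ι => ρ)) *
        ∫⁻ x, g x ∂(Measure.infinitePi fun _ : ι => ρ) :=
  lintegral_mul_eq_lintegral_mul_lintegral_of_indepFun hf hg
    (indepFun_of_dependsOn ρ hf hg hA hB hd)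

theorem measure_inter_of_dependsOn {s t : Set (ι → X)} (hs : MeasurableSet s)
    (ht : MeasurableSet t) {A B : Set ι} (hA : DependsOn (· ∈ s) A) (hB : DependsOn (· ∈ t) B)
    (hd : Disjoint A B) :
    (Measure.infinitePi fun _ : ι => ρ) (s ∩ t) =
      (Measure.infinitePi fun _ : ι => ρ) s * (Measure.infinitePi fun _ : ι => ρ) t := by
  have := (indepFun_of_dependsOn ρ (f := (· ∈ s)) (g := (· ∈ t)) (measurable_mem.2 hs)
    (measurable_mem.2 ht) hA hB hd).measure_inter_preimage_eq_mul {True} {True}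
      (measurableSet_singleton _) (measurableSet_singleton _)
  simpa [Set.preimage] using this

end Product

/-! ### Last passage weights -/

section LastPassage

variable {E E' : ℤ → ℤ → Prop} {v v' : ℤ → ℤ → ℝ}

theorem incPath_le {i j : ℤ} (π : IncPath E i j) : i ≤ j := by
  induction π with
  | nil => exact le_rfl
  | cons h _ _ ih => omega

theorem weight_le_lastPassage {i j : ℤ} (π : IncPath E i j) :
    ((π.weight v : ℝ) : EReal) ≤ lastPassage E v i j :=
  le_iSup (fun π : IncPath E i j => ((π.weight v : ℝ) : EReal)) π

/-- Concatenation of paths. -/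
def appendPath {i j k : ℤ} : IncPath E i j → IncPath E j k → IncPath E i k
  | .nil _, σ => σ
  | .cons h e π, σ => .cons h e (appendPath π σ)

theorem weight_appendPath {i j k : ℤ} (π : IncPath E i j) (σ : IncPath E j k) :
    (appendPath π σ).weight v = π.weight v + σ.weight v := by
  induction π with
  | nil => simp [appendPath, IncPath.weight]
  | cons h e π ih => simp [appendPath, IncPath.weight, ih, add_assoc]

theorem lastPassage_add_le (i j k : ℤ) :
    lastPassage E v i j + lastPassage E v j k ≤ lastPassage E v i k := by
  refine EReal.add_le_of_forall_lt fun a ha b hb => ?_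
  obtain ⟨π, hπ⟩ := lt_iSup_iff.1 ha
  obtain ⟨σ, hσ⟩ := lt_iSup_iff.1 hb
  refine (add_le_add hπ.le hσ.le).trans ?_
  rw [← EReal.coe_add, ← weight_appendPath]
  exact weight_le_lastPassage _

/-- Serves both locality (`t = 0`) and translation invariance: a path stays in `[i, j]`, so only
edges there have to be compared. -/
theorem lastPassage_mono_shift (t : ℤ) {i j : ℤ}
    (h : ∀ a b, i ≤ a → a < b → b ≤ j → E a b → E' (a + t) (b + t) ∧ v a b = v' (a + t) (b + t)) :
    lastPassage E v i j ≤ lastPassage E' v' (i + t) (j + t) := by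
  have H (π : IncPath E i j) : ∃ σ : IncPath E' (i + t) (j + t), σ.weight v' = π.weight v := by
    induction π with
    | nil i => exact ⟨.nil _, rfl⟩
    | @cons i k j hij he π ih =>
      obtain ⟨σ, hσ⟩ := ih (fun a b ha => h a b (by omega))
      obtain ⟨h1, h2⟩ := h i k le_rfl hij (incPath_le π) he
      exact ⟨.cons (by omega) h1 σ, by simp [IncPath.weight, hσ, h2]⟩
  refine iSup_le fun π => ?_
  obtain ⟨σ, hσ⟩ := H π
  rw [← hσ]
  exact weight_le_lastPassage σ

theorem lastPassage_congr {i j : ℤ}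
    (h : ∀ a b, i ≤ a → a < b → b ≤ j → (E a b ↔ E' a b) ∧ v a b = v' a b) :
    lastPassage E v i j = lastPassage E' v' i j := by
  apply le_antisymm
  · have := lastPassage_mono_shift (E := E) (E' := E') (v := v) (v' := v') 0 (i := i) (j := j)
      (fun a b h1 h2 h3 h4 => by simpa using ⟨(h a b h1 h2 h3).1.1 h4, (h a b h1 h2 h3).2⟩)
    simpa using this
  · have := lastPassage_mono_shift (E := E') (E' := E) (v := v') (v' := v) 0 (i := i) (j := j)
      (fun a b h1 h2 h3 h4 => by simpa using ⟨(h a b h1 h2 h3).1.2 h4, (h a b h1 h2 h3).2.symm⟩)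
    simpa using this

theorem lastPassage_shift (t i j : ℤ) :
    lastPassage (fun a b => E (a + t) (b + t)) (fun a b => v (a + t) (b + t)) i j =
      lastPassage E v (i + t) (j + t) := by
  apply le_antisymm
  · exact lastPassage_mono_shift t fun a b _ _ _ h => ⟨h, rfl⟩
  · have := lastPassage_mono_shift (E := E) (E' := fun a b => E (a + t) (b + t)) (v := v)
      (v' := fun a b => v (a + t) (b + t)) (-t) (i := i + t) (j := j + t)
      (fun a b _ _ _ h => by simpa using h)
    simpa using this

theorem lastPassage_self (i : ℤ) : lastPassage E v i i = 0 := by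
  apply le_antisymm
  · refine iSup_le fun π => ?_
    cases π with
    | nil => simp [IncPath.weight]
    | cons h _ π => have := incPath_le π; omega
  · have := weight_le_lastPassage (E := E) (v := v) (.nil i)
    simpa [IncPath.weight] using this

theorem lastPassage_of_lt {i j : ℤ} (hij : j < i) : lastPassage E v i j = ⊥ := by
  refine eq_bot_iff.2 (iSup_le fun π => ?_)
  have := incPath_le π
  omega

-- Splitting a path at its first edge replaces the supremum over paths, whose type varies with the
-- graph, by a supremum over integers.
open Classical in
theorem lastPassage_rec {i j : ℤ} (hij : i < j) :
    lastPassage E v i j =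
      ⨆ k : ℤ, if i < k ∧ k ≤ j ∧ E i k then (v i k : EReal) + lastPassage E v k j else ⊥ := by
  apply le_antisymm
  · refine iSup_le fun π => ?_
    cases π with
    | nil => omega
    | @cons _ k _ h e π =>
      refine le_trans ?_ (le_iSup _ k)
      rw [if_pos ⟨h, incPath_le π, e⟩, IncPath.weight, EReal.coe_add]
      gcongr
      exact weight_le_lastPassage π
  · refine iSup_le fun k => ?_
    split_ifs with h
    · refine EReal.add_le_of_forall_lt fun a ha b hb => ?_
      obtain ⟨π, hπ⟩ := lt_iSup_iff.1 hb
      refine (add_le_add ha.le hπ.le).trans ?_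
      rw [← EReal.coe_add]
      exact weight_le_lastPassage (v := v) (.cons h.1 h.2.2 π)
    · exact bot_le

end LastPassage

end OrderedGraph

namespace OrderedGraph

open scoped NNReal
open Set

/-! ### The canonical space of weighted graphs -/

/-- The pairs `i < j` of integers. -/
abbrev Edge := {e : ℤ × ℤ // e.1 < e.2}

/-- A configuration: a weight and an indicator of presence for every pair. -/
abbrev Config := Edge → ℝ≥0 × Bool

/-- The weight of a pair. -/
def wt (x : Config) (i j : ℤ) : ℝ≥0 := if h : i < j then (x ⟨(i, j), h⟩).1 else 0

/-- Presence of an edge. -/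
def ed (x : Config) (i j : ℤ) : Prop := ∃ h : i < j, (x ⟨(i, j), h⟩).2 = true

/-- The last passage weight of a configuration. -/
noncomputable def lp (x : Config) (i j : ℤ) : EReal :=
  lastPassage (ed x) (fun a b => (wt x a b : ℝ)) i j

/-- The last passage weight grows at rate at least `c` between `i` and `j`. -/
def Fast (c : ℝ) (x : Config) (i j : ℤ) : Prop := ((c * (j - i) : ℝ) : EReal) ≤ lp x i j

/-- A present edge of weight at least `c` times its length. -/
def Heavy (c : ℝ) (x : Config) (i j : ℤ) : Prop := ed x i j ∧ c * (j - i) ≤ wt x i j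

/-- Translation of edges. -/
def shiftEdge (t : ℤ) (e : Edge) : Edge := ⟨(e.1.1 + t, e.1.2 + t), by have := e.2; omega⟩

/-- Translation of configurations. -/
def shift (t : ℤ) (x : Config) : Config := fun e => x (shiftEdge t e)

/-- The pairs contained in `[i, j]`. -/
def within (i j : ℤ) : Set Edge := {e | i ≤ e.1.1 ∧ e.1.2 ≤ j}

/-- The pairs to the right of `i`. -/
def rightOf (i : ℤ) : Set Edge := {e | i ≤ e.1.1}

/-- The pairs to the left of `i`. -/
def leftOf (i : ℤ) : Set Edge := {e | e.1.2 ≤ i}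

/-- The pairs with `i` strictly between their endpoints. -/
def crossing (i : ℤ) : Set Edge := {e | e.1.1 < i ∧ i < e.1.2}

theorem wt_shift (t : ℤ) (x : Config) (i j : ℤ) : wt (shift t x) i j = wt x (i + t) (j + t) := by
  by_cases h : i < j
  · simp [wt, shift, shiftEdge, h]
  · simp [wt, h]

theorem ed_shift (t : ℤ) (x : Config) (i j : ℤ) : ed (shift t x) i j ↔ ed x (i + t) (j + t) := by
  simp [ed, shift, shiftEdge]

theorem lp_shift (t : ℤ) (x : Config) (i j : ℤ) : lp (shift t x) i j = lp x (i + t) (j + t) := by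
  unfold lp
  rw [← lastPassage_shift]
  refine lastPassage_congr fun a b _ _ _ => ⟨ed_shift t x a b, ?_⟩
  rw [wt_shift]

theorem fast_shift (c : ℝ) (t : ℤ) (x : Config) (i j : ℤ) :
    Fast c (shift t x) i j ↔ Fast c x (i + t) (j + t) := by
  simp [Fast, lp_shift]

theorem heavy_shift (c : ℝ) (t : ℤ) (x : Config) (i j : ℤ) :
    Heavy c (shift t x) i j ↔ Heavy c x (i + t) (j + t) := by
  simp [Heavy, ed_shift, wt_shift]

theorem dependsOn_wt (i j : ℤ) : DependsOn (wt · i j) {e : Edge | e.1 = (i, j)} := by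
  intro x y h
  by_cases hij : i < j
  · simp [wt, hij, h ⟨(i, j), hij⟩ rfl]
  · simp [wt, hij]

theorem dependsOn_ed (i j : ℤ) : DependsOn (ed · i j) {e : Edge | e.1 = (i, j)} := by
  intro x y h
  refine propext (exists_congr fun hij => ?_)
  rw [h ⟨(i, j), hij⟩ rfl]

theorem dependsOn_lp (i j : ℤ) : DependsOn (lp · i j) (within i j) := by
  intro x y h
  refine lastPassage_congr fun a b ha hab hb => ?_
  have h' : ∀ e ∈ {e : Edge | e.1 = (a, b)}, x e = y e := by
    rintro ⟨_, _⟩ rfl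
    exact h _ ⟨ha, hb⟩
  refine ⟨iff_of_eq (dependsOn_ed a b h'), ?_⟩
  have := dependsOn_wt a b h'
  simp only at this
  rw [this]

theorem dependsOn_fast (c : ℝ) (i j : ℤ) : DependsOn (Fast c · i j) (within i j) := by
  intro x y h
  have := dependsOn_lp i j h
  simp only at this
  simp only [Fast, this]

theorem dependsOn_heavy (c : ℝ) (i j : ℤ) : DependsOn (Heavy c · i j) {e : Edge | e.1 = (i, j)} := by
  intro x y h
  have h1 := dependsOn_wt i j h
  have h2 := dependsOn_ed i j h
  simp only at h1 h2
  simp only [Heavy, h1, h2]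

@[fun_prop]
theorem measurable_wt (i j : ℤ) : Measurable (wt · i j) := by
  by_cases h : i < j
  · simp only [wt, h, dite_true]; fun_prop
  · simp only [wt, h, dite_false]; fun_prop

@[fun_prop]
theorem measurable_ed (i j : ℤ) : Measurable (ed · i j) := by
  by_cases h : i < j
  · simp only [ed, h, exists_true_left]
    exact measurableSet_setOfPred.1 ((measurable_snd.comp (measurable_pi_apply _))
      (measurableSet_singleton true))
  · simp only [ed, h, IsEmpty.exists_iff]; fun_prop

-- The first-edge recursion expresses the value as a countable supremum of measurable functions of
-- shorter intervals, which permits induction on the length.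
@[fun_prop]
theorem measurable_lp (i j : ℤ) : Measurable (lp · i j) := by
  classical
  obtain hij | hij := le_or_gt i j
  · obtain ⟨n, hn⟩ : ∃ n : ℕ, (n : ℤ) = j - i := ⟨(j - i).toNat, by omega⟩
    induction n using Nat.strong_induction_on generalizing i with
    | _ n ih =>
      rcases hij.eq_or_lt with rfl | hlt
      · simp only [lp, lastPassage_self]; fun_prop
      · simp only [lp, lastPassage_rec hlt]
        refine Measurable.iSup fun k => ?_
        by_cases hk : i < k ∧ k ≤ j
        · simp only [hk.1, hk.2, true_and]
          refine Measurable.ite (measurableSet_setOfPred.2 (measurable_ed i k)) (Measurable.add (f := fun x : Config => ((wt x i k : ℝ) : EReal))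
              (g := fun x => lp x k j) ?_ ?_) measurable_const
          · fun_prop
          · exact ih (j - k).toNat (by omega) k hk.2 (by omega)
        · have : ∀ x : Config, ¬ (i < k ∧ k ≤ j ∧ ed x i k) := fun x h => hk ⟨h.1, h.2.1⟩
          simp only [this, if_false]; fun_prop
  · simp only [lp, lastPassage_of_lt hij]; fun_prop

@[fun_prop]
theorem measurable_fast (c : ℝ) (i j : ℤ) : Measurable (Fast c · i j) :=
  measurableSet_setOfPred.1 (measurableSet_le measurable_const (measurable_lp i j))

@[fun_prop]
theorem measurable_heavy (c : ℝ) (i j : ℤ) : Measurable (Heavy c · i j) :=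
  (measurable_ed i j).and (measurableSet_setOfPred.1 (measurableSet_le measurable_const
    ((measurable_wt i j).coe_nnreal_real)))

/-- Superadditivity of last passage weights. This transitivity is what makes renewal points separate
past from future. -/
theorem fast_trans {c : ℝ} {x : Config} {i j k : ℤ} (h1 : Fast c x i j) (h2 : Fast c x j k) :
    Fast c x i k := by
  refine le_trans ?_ (lastPassage_add_le i j k)
  refine le_trans (le_of_eq ?_) (add_le_add h1 h2)
  rw [← EReal.coe_add]
  congr 1
  ring

@[fun_prop]
theorem measurable_shift (t : ℤ) : Measurable (shift t) := by
  unfold shift; fun_prop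

/-- The law of the configuration. -/
noncomputable abbrev law (ρ : Measure (ℝ≥0 × Bool)) : Measure Config :=
  Measure.infinitePi fun _ : Edge => ρ

theorem measurePreserving_shift (ρ : Measure (ℝ≥0 × Bool)) [IsProbabilityMeasure ρ] (t : ℤ) :
    MeasurePreserving (shift t) (law ρ) (law ρ) := by
  refine ⟨measurable_shift t, ?_⟩
  refine Measure.map_infinitePi_infinitePi_of_inj (P := fun _ : Edge => ρ) (f := shiftEdge t) ?_
  rintro ⟨⟨a, b⟩, h⟩ ⟨⟨a', b'⟩, h'⟩ hab
  simp [shiftEdge] at hab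
  simp [hab]

theorem DependsOn.shift {β : Type*} {f : Config → β} {A A' : Set Edge} (h : DependsOn f A) (t : ℤ)
    (hA : ∀ e ∈ A, shiftEdge t e ∈ A') : DependsOn (fun x => f (shift t x)) A' :=
  fun _ _ hxy => h fun e he => hxy _ (hA e he)

theorem disjoint_left_right (i : ℤ) : Disjoint (leftOf i) (rightOf i) :=
  Set.disjoint_left.2 fun e (h1 : e.1.2 ≤ i) (h2 : i ≤ e.1.1) => by have := e.2; omega

theorem disjoint_crossing_right (i : ℤ) : Disjoint (crossing i) (rightOf i) :=
  Set.disjoint_left.2 fun e (h1 : e.1.1 < i ∧ i < e.1.2) (h2 : i ≤ e.1.1) => by omega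

theorem disjoint_left_crossing (i : ℤ) : Disjoint (leftOf i) (crossing i) :=
  Set.disjoint_left.2 fun e (h2 : e.1.2 ≤ i) (h1 : e.1.1 < i ∧ i < e.1.2) => by omega

/-! ### Closure properties of dependence on a set of edges. -/

section Combinators

variable {ι : Type*} {A : Set Edge} {p q : Config → Prop} {P : ι → Config → Prop}

theorem dependsOn_forall (h : ∀ i, DependsOn (P i) A) : DependsOn (fun x => ∀ i, P i x) A :=
  fun _ _ hxy => propext (forall_congr' fun i => by rw [h i hxy])

theorem dependsOn_and (hp : DependsOn p A) (hq : DependsOn q A) :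
    DependsOn (fun x => p x ∧ q x) A :=
  fun _ _ hxy => congrArg₂ And (hp hxy) (hq hxy)

theorem dependsOn_not (hp : DependsOn p A) : DependsOn (fun x => ¬ p x) A :=
  fun _ _ hxy => congrArg Not (hp hxy)

theorem dependsOn_imp {a : Prop} (hp : a → DependsOn p A) : DependsOn (fun x => a → p x) A :=
  fun _ _ hxy => propext (forall_congr' fun ha => by rw [hp ha hxy])

theorem dependsOn_indicator {s : Set Config} {f : Config → ℝ≥0∞} (hs : DependsOn (· ∈ s) A)
    (hf : DependsOn f A) : DependsOn (s.indicator f) A := by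
  classical
  intro x y hxy
  have h1 := hs hxy
  simp only [eq_iff_iff] at h1
  simp only [indicator, h1, hf hxy]

end Combinators

end OrderedGraph

namespace OrderedGraph

open scoped NNReal
open Set

/-! ### Index-zero and index-one points of a set of integers -/

section PointZero

variable {S : Set ℤ}

/-- `n` is the smallest non-negative element of `S`. -/
def IsFirst (S : Set ℤ) (n : ℤ) : Prop := n ∈ S ∧ ∀ m, 0 ≤ m → m < n → m ∉ S

/-- `n` and `m` are consecutive elements of `S`. -/
def IsNext (S : Set ℤ) (n m : ℤ) : Prop := n ∈ S ∧ m ∈ S ∧ ∀ z, n < z → z < m → z ∉ S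

theorem pointZero_le {n : ℕ} (h : (n : ℤ) ∈ S) : pointZero S ≤ n :=
  iInf₂_le n h

theorem pointZero_eq_of_isFirst {n : ℕ} (h : IsFirst S n) : pointZero S = n := by
  refine le_antisymm (pointZero_le h.1) (le_iInf₂ fun m hm => ?_)
  by_contra hlt
  rw [not_le] at hlt
  exact h.2 m (by omega) (by exact_mod_cast hlt) hm

theorem pointZero_cases (S : Set ℤ) :
    (pointZero S = ⊤ ∧ ∀ n : ℕ, (n : ℤ) ∉ S) ∨ ∃ n : ℕ, pointZero S = n ∧ IsFirst S n := by
  classical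
  by_cases h : ∃ n : ℕ, (n : ℤ) ∈ S
  · right
    have hf : IsFirst S (Nat.find h) := ⟨Nat.find_spec h, fun m hm hlt hmS => by
      lift m to ℕ using hm
      exact Nat.find_min h (by exact_mod_cast hlt) hmS⟩
    exact ⟨_, pointZero_eq_of_isFirst hf, hf⟩
  · push Not at h
    left
    refine ⟨?_, h⟩
    simp [pointZero, h]

theorem pointOne_eq_of_isNext {n m : ℕ} (hn : IsFirst S n) (hnm : n < m) (h : IsNext S n m) :
    pointOne S = m := by
  have h0 := pointZero_eq_of_isFirst hn
  refine le_antisymm (iInf₂_le m ⟨h.2.1, by rw [h0]; exact_mod_cast hnm⟩)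
    (le_iInf₂ fun z hz => ?_)
  by_contra hlt
  rw [not_le] at hlt
  have h1 : n < z := by have := hz.2; rw [h0] at this; exact_mod_cast this
  exact h.2.2 z (by omega) (by exact_mod_cast hlt) hz.1

theorem pointOne_cases {n : ℕ} (hn : IsFirst S n) :
    (pointOne S = ⊤ ∧ ∀ z, (n : ℤ) < z → z ∉ S) ∨
      ∃ k : ℕ, pointOne S = (n + k + 1 : ℕ) ∧ IsNext S n (n + k + 1 : ℕ) := by
  classical
  by_cases h : ∃ k : ℕ, ((n + k + 1 : ℕ) : ℤ) ∈ S
  · right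
    have hf : IsNext S n (n + Nat.find h + 1 : ℕ) := by
      refine ⟨hn.1, Nat.find_spec h, fun z hz hlt hzS => ?_⟩
      obtain ⟨j, rfl⟩ : ∃ j : ℕ, z = (n + j + 1 : ℕ) := ⟨(z - n - 1).toNat, by omega⟩
      exact Nat.find_min h (m := j) (by omega) hzS
    exact ⟨_, pointOne_eq_of_isNext hn (by omega) hf, hf⟩
  · push Not at h
    left
    have h' : ∀ z, (n : ℤ) < z → z ∉ S := fun z hz hzS => by
      refine h (z - n - 1).toNat ?_
      rwa [show (((n + (z - n - 1).toNat + 1 : ℕ)) : ℤ) = z by omega]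
    refine ⟨?_, h'⟩
    have h0 := pointZero_eq_of_isFirst hn
    refine iInf₂_eq_top.2 fun z hz => ?_
    refine absurd hz.1 (h' z ?_)
    have := hz.2
    rw [h0] at this
    exact_mod_cast this

end PointZero

/-! ### Regenerative sets of points -/

/-- The points `z` joined by `J` to all other points and not passed over by a pair in `B`. -/
def pts (J B : Config → ℤ → ℤ → Prop) (x : Config) : Set ℤ :=
  {z | (∀ y, y < z → J x y z) ∧ (∀ i j, i < z → z < j → ¬ B x i j) ∧ ∀ y, z < y → J x z y}

/-- The properties of the relations `J`, `B` that make `pts J B` a stationary regenerative set. -/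
structure RegenKernel (J B : Config → ℤ → ℤ → Prop) : Prop where
  measurable_J : ∀ i j, Measurable (J · i j)
  measurable_B : ∀ i j, Measurable (B · i j)
  dependsOn_J : ∀ i j, DependsOn (J · i j) (within i j)
  dependsOn_B : ∀ i j, DependsOn (B · i j) {e : Edge | e.1 = (i, j)}
  shift_J : ∀ t x i j, J (shift t x) i j ↔ J x (i + t) (j + t)
  shift_B : ∀ t x i j, B (shift t x) i j ↔ B x (i + t) (j + t)
  trans_J : ∀ {x i j k}, J x i j → J x j k → J x i k

variable {J B : Config → ℤ → ℤ → Prop}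

/-- The part of the event that `y` is a point that lies to the right of a point `n < y`. -/
def RightPart (J B : Config → ℤ → ℤ → Prop) (n y : ℤ) (x : Config) : Prop :=
  (∀ z, n ≤ z → z < y → J x z y) ∧ (∀ i j, n ≤ i → i < y → y < j → ¬ B x i j) ∧
    ∀ z, y < z → J x y z

/-- The part of the event that `y` is a point that lies to the left of a point `n > y`. -/
def LeftPart (J B : Config → ℤ → ℤ → Prop) (n y : ℤ) (x : Config) : Prop :=
  (∀ z, z < y → J x z y) ∧ (∀ i j, i < y → y < j → j ≤ n → ¬ B x i j) ∧
    ∀ z, y < z → z ≤ n → J x y z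

namespace RegenKernel

variable (h : RegenKernel J B)
include h

/-- Relations from the left of `n` to `y` follow by passing through `n`, and a pair starting left of
`n` and passing over `y` also passes over `n`. Hence only pairs to the right of `n` remain to be
inspected. -/
theorem mem_pts_iff_right {x : Config} {n y : ℤ} (hn : n ∈ pts J B x) (hny : n < y) :
    y ∈ pts J B x ↔ RightPart J B n y x := by
  constructor
  · rintro ⟨h1, h2, h3⟩
    exact ⟨fun z _ hz => h1 z hz, fun i j _ => h2 i j, h3⟩
  · rintro ⟨h1, h2, h3⟩
    refine ⟨fun z hz => ?_, fun i j hi hj => ?_, h3⟩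
    · rcases le_or_gt n z with hz' | hz'
      · exact h1 z hz' hz
      · exact h.trans_J (hn.1 z hz') (hn.2.2 y hny)
    · rcases le_or_gt n i with hi' | hi'
      · exact h2 i j hi' hi hj
      · exact hn.2.1 i j hi' (hny.trans hj)

theorem mem_pts_iff_left {x : Config} {n y : ℤ} (hn : n ∈ pts J B x) (hny : y < n) :
    y ∈ pts J B x ↔ LeftPart J B n y x := by
  constructor
  · rintro ⟨h1, h2, h3⟩
    exact ⟨h1, fun i j h4 h5 _ => h2 i j h4 h5, fun z hz _ => h3 z hz⟩
  · rintro ⟨h1, h2, h3⟩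
    refine ⟨h1, fun i j hi hj => ?_, fun z hz => ?_⟩
    · rcases le_or_gt j n with hj' | hj'
      · exact h2 i j hi hj hj'
      · exact hn.2.1 i j (hi.trans hny) hj'
    · rcases le_or_gt z n with hz' | hz'
      · exact h3 z hz hz'
      · exact h.trans_J (hn.1 y hny) (hn.2.2 z hz')

theorem pts_shift (t : ℤ) (x : Config) (z : ℤ) : z ∈ pts J B (shift t x) ↔ z + t ∈ pts J B x := by
  simp only [pts, mem_ofPred_eq, h.shift_J, h.shift_B]
  refine and_congr ⟨fun H y hy => ?_, fun H y hy => H _ (by omega)⟩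
    (and_congr ⟨fun H i j hi hj => ?_, fun H i j hi hj => H _ _ (by omega) (by omega)⟩
      ⟨fun H y hy => ?_, fun H y hy => H _ (by omega)⟩)
  · simpa using H (y - t) (by omega)
  · simpa using H (i - t) (j - t) (by omega) (by omega)
  · simpa using H (y - t) (by omega)

theorem isNext_shift (t : ℤ) (x : Config) (n m : ℤ) :
    IsNext (pts J B (shift t x)) n m ↔ IsNext (pts J B x) (n + t) (m + t) := by
  simp only [IsNext, h.pts_shift]
  refine and_congr Iff.rfl (and_congr Iff.rfl
    ⟨fun H z h1 h2 => ?_, fun H z h1 h2 => H _ (by omega) (by omega)⟩)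
  simpa using H (z - t) (by omega) (by omega)

theorem measurable_left (n : ℤ) : Measurable fun x => ∀ y, y < n → J x y n := by
  have := h.measurable_J; fun_prop

theorem measurable_cross (n : ℤ) : Measurable fun x => ∀ i j, i < n → n < j → ¬ B x i j := by
  have := h.measurable_B; fun_prop

theorem measurable_right (n : ℤ) : Measurable fun x => ∀ y, n < y → J x n y := by
  have := h.measurable_J; fun_prop

theorem measurable_mem_pts (n : ℤ) : Measurable fun x => n ∈ pts J B x :=
  (h.measurable_left n).and ((h.measurable_cross n).and (h.measurable_right n))

theorem measurable_isFirst (n : ℤ) : Measurable fun x => IsFirst (pts J B x) n := by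
  have := h.measurable_mem_pts; unfold IsFirst; fun_prop

theorem measurable_isNext (n m : ℤ) : Measurable fun x => IsNext (pts J B x) n m := by
  have := h.measurable_mem_pts; unfold IsNext; fun_prop

theorem measurable_rightPart (n y : ℤ) : Measurable (RightPart J B n y) := by
  have := h.measurable_J; have := h.measurable_B; unfold RightPart; fun_prop

theorem measurable_leftPart (n y : ℤ) : Measurable (LeftPart J B n y) := by
  have := h.measurable_J; have := h.measurable_B; unfold LeftPart; fun_prop

theorem dependsOn_left (n : ℤ) : DependsOn (fun x => ∀ y, y < n → J x y n) (leftOf n) :=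
  dependsOn_forall fun y => dependsOn_imp fun _ => (h.dependsOn_J y n).mono fun _ he => he.2

theorem dependsOn_right (n : ℤ) : DependsOn (fun x => ∀ y, n < y → J x n y) (rightOf n) :=
  dependsOn_forall fun y => dependsOn_imp fun _ => (h.dependsOn_J n y).mono fun _ he => he.1

theorem dependsOn_cross (n : ℤ) :
    DependsOn (fun x => ∀ i j, i < n → n < j → ¬ B x i j) (crossing n) :=
  dependsOn_forall fun i => dependsOn_forall fun j => dependsOn_imp fun hi => dependsOn_imp
    fun hj => dependsOn_not ((h.dependsOn_B i j).mono fun e (he : e.1 = (i, j)) => by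
      simp only [crossing, mem_ofPred_eq, he]; exact ⟨hi, hj⟩)

theorem dependsOn_rightPart (n y : ℤ) (hny : n ≤ y) :
    DependsOn (RightPart J B n y) (rightOf n) := by
  refine dependsOn_and ?_ (dependsOn_and ?_ ?_)
  · exact dependsOn_forall fun z => dependsOn_imp fun h1 => dependsOn_imp fun h2 =>
      (h.dependsOn_J z y).mono fun e he => h1.trans he.1
  · exact dependsOn_forall fun i => dependsOn_forall fun j => dependsOn_imp fun hi => dependsOn_imp
      fun _ => dependsOn_imp fun _ => dependsOn_not ((h.dependsOn_B i j).mono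
        fun e (he : e.1 = (i, j)) => by simp only [rightOf, mem_ofPred_eq, he]; exact hi)
  · exact dependsOn_forall fun z => dependsOn_imp fun h1 =>
      (h.dependsOn_J y z).mono fun e he => hny.trans he.1

theorem dependsOn_leftPart (n y : ℤ) (hny : y ≤ n) :
    DependsOn (LeftPart J B n y) (leftOf n) := by
  refine dependsOn_and ?_ (dependsOn_and ?_ ?_)
  · exact dependsOn_forall fun z => dependsOn_imp fun h1 =>
      (h.dependsOn_J z y).mono fun e he => he.2.trans hny
  · exact dependsOn_forall fun i => dependsOn_forall fun j => dependsOn_imp fun _ => dependsOn_imp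
      fun _ => dependsOn_imp fun hj => dependsOn_not ((h.dependsOn_B i j).mono
        fun e (he : e.1 = (i, j)) => by simp only [leftOf, mem_ofPred_eq, he]; exact hj)
  · exact dependsOn_forall fun z => dependsOn_imp fun h1 => dependsOn_imp fun h2 =>
      (h.dependsOn_J y z).mono fun e he => he.2.trans h2

variable (ρ : Measure (ℝ≥0 × Bool)) [IsProbabilityMeasure ρ]

/-- Past and future of a regeneration point are conditionally independent. -/
theorem lintegral_first_next {n m : ℤ} (hnm : n < m) {Φ : Config → ℝ≥0∞} (hΦ : Measurable Φ)
    (hΦd : DependsOn Φ (rightOf n)) :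
    law ρ {x | n ∈ pts J B x} *
        ∫⁻ x, {x | IsFirst (pts J B x) n ∧ IsNext (pts J B x) n m}.indicator Φ x ∂law ρ =
      law ρ {x | IsFirst (pts J B x) n} *
        ∫⁻ x, {x | IsNext (pts J B x) n m}.indicator Φ x ∂law ρ := by
  -- `L`, `C`, `U` are the left, crossing and right conditions for `n` to be a point. Given these,
  -- `L'` says that no integer in `[0, n)` is a point and `U'` that `m` is the next one. Edges
  -- starting at or after `n` determine `U`, `U'` and `Φ`; the remaining edges determine `L`, `C`
  -- and `L'`.
  set L : Set Config := {x | ∀ y, y < n → J x y n}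
  set C : Set Config := {x | ∀ i j, i < n → n < j → ¬ B x i j}
  set U : Set Config := {x | ∀ y, n < y → J x n y}
  set L' : Set Config := {x | ∀ z, 0 ≤ z → z < n → ¬ LeftPart J B n z x}
  set U' : Set Config := {x | RightPart J B n m x ∧ ∀ z, n < z → z < m → ¬ RightPart J B n z x}
  have hL : MeasurableSet L := measurableSet_setOfPred.2 (h.measurable_left n)
  have hC : MeasurableSet C := measurableSet_setOfPred.2 (h.measurable_cross n)
  have hU : MeasurableSet U := measurableSet_setOfPred.2 (h.measurable_right n)
  have hL' : MeasurableSet L' := measurableSet_setOfPred.2 (by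
    have := h.measurable_leftPart; fun_prop)
  have hU' : MeasurableSet U' := measurableSet_setOfPred.2 (by
    have := h.measurable_rightPart; fun_prop)
  have dL : DependsOn (· ∈ L) (rightOf n)ᶜ := (h.dependsOn_left n).mono
    (disjoint_left_right n).subset_compl_right
  have dC : DependsOn (· ∈ C) (rightOf n)ᶜ := (h.dependsOn_cross n).mono
    (disjoint_crossing_right n).subset_compl_right
  have dU : DependsOn (· ∈ U) (rightOf n) := h.dependsOn_right n
  have dL' : DependsOn (· ∈ L') (rightOf n)ᶜ :=
    (dependsOn_forall fun z => dependsOn_imp fun _ => dependsOn_imp fun hz => dependsOn_not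
      (h.dependsOn_leftPart n z hz.le)).mono (disjoint_left_right n).subset_compl_right
  have dU' : DependsOn (· ∈ U') (rightOf n) :=
    dependsOn_and (h.dependsOn_rightPart n m hnm.le) (dependsOn_forall fun z => dependsOn_imp
      fun hz => dependsOn_imp fun _ => dependsOn_not (h.dependsOn_rightPart n z hz.le))
  have hd : Disjoint (rightOf n)ᶜ (rightOf n) := disjoint_compl_left
  have e1 : {x | n ∈ pts J B x} = (L ∩ C) ∩ U := by
    ext x; exact and_assoc.symm
  have e2 : {x | IsFirst (pts J B x) n} = (L ∩ C ∩ L') ∩ U := by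
    ext x
    constructor
    · rintro ⟨h1, h2⟩
      exact ⟨⟨⟨h1.1, h1.2.1⟩, fun z hz hzn => by
        rw [← h.mem_pts_iff_left h1 hzn]; exact h2 z hz hzn⟩, h1.2.2⟩
    · rintro ⟨⟨⟨h1, h2⟩, h3⟩, h4⟩
      have hn : n ∈ pts J B x := ⟨h1, h2, h4⟩
      exact ⟨hn, fun z hz hzn => by rw [h.mem_pts_iff_left hn hzn]; exact h3 z hz hzn⟩
  have e3 : {x | IsNext (pts J B x) n m} = (L ∩ C) ∩ (U ∩ U') := by
    ext x
    constructor
    · rintro ⟨h1, h2, h3⟩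
      exact ⟨⟨h1.1, h1.2.1⟩, h1.2.2, (h.mem_pts_iff_right h1 hnm).1 h2, fun z hz hzn => by
        rw [← h.mem_pts_iff_right h1 hz]; exact h3 z hz hzn⟩
    · rintro ⟨⟨h1, h2⟩, h3, h4, h5⟩
      have hn : n ∈ pts J B x := ⟨h1, h2, h3⟩
      exact ⟨hn, (h.mem_pts_iff_right hn hnm).2 h4, fun z hz hzn => by
        rw [h.mem_pts_iff_right hn hz]; exact h5 z hz hzn⟩
  have e4 : {x | IsFirst (pts J B x) n ∧ IsNext (pts J B x) n m} =
      (L ∩ C ∩ L') ∩ (U ∩ U') := by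
    have : {x | IsFirst (pts J B x) n ∧ IsNext (pts J B x) n m} =
      {x | IsFirst (pts J B x) n} ∩ {x | IsNext (pts J B x) n m} := rfl
    rw [this, e2, e3]
    ext x
    simp only [mem_inter_iff]
    tauto
  -- After factorisation both sides are the product of the probabilities of `L ∩ C`, `L ∩ C ∩ L'`
  -- and `U` with the integral of `Φ` over `U ∩ U'`.
  have key : ∀ V : Set Config, MeasurableSet V → DependsOn (· ∈ V) (rightOf n)ᶜ →
      ∫⁻ x, (V ∩ (U ∩ U')).indicator Φ x ∂law ρ =
        law ρ V * ∫⁻ x, (U ∩ U').indicator Φ x ∂law ρ := by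
    intro V hV dV
    have : (V ∩ (U ∩ U')).indicator Φ = fun x => V.indicator 1 x * (U ∩ U').indicator Φ x := by
      funext x
      by_cases h1 : x ∈ V <;> by_cases h2 : x ∈ U ∩ U' <;> simp [h1, h2]
    rw [this, lintegral_mul_of_dependsOn ρ (measurable_one.indicator hV)
      (hΦ.indicator (hU.inter hU')) (dependsOn_indicator dV (fun _ _ _ => rfl))
      (dependsOn_indicator (dependsOn_and dU dU') hΦd) hd, lintegral_indicator_one hV]
  rw [e1, e2, e3, e4, key _ ((hL.inter hC).inter hL') (dependsOn_and (dependsOn_and dL dC) dL'),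
    key _ (hL.inter hC) (dependsOn_and dL dC),
    measure_inter_of_dependsOn ρ (hL.inter hC) hU (dependsOn_and dL dC) dU hd,
    measure_inter_of_dependsOn ρ ((hL.inter hC).inter hL') hU
      (dependsOn_and (dependsOn_and dL dC) dL') dU hd]
  ring

theorem measure_mem_pts (n : ℤ) : law ρ {x | n ∈ pts J B x} = law ρ {x | 0 ∈ pts J B x} := by
  have := (measurePreserving_shift ρ n).measure_preimage
    (measurableSet_setOfPred.2 (h.measurable_mem_pts 0)).nullMeasurableSet
  rw [← this]
  congr 1
  ext x
  simp [h.pts_shift]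

theorem lintegral_next_shift (n m : ℤ) {Φ : Config → ℝ≥0∞} (hΦ : Measurable Φ) :
    ∫⁻ x, {x | IsNext (pts J B x) n (n + m)}.indicator (fun x => Φ (shift n x)) x ∂law ρ =
      ∫⁻ x, {x | IsNext (pts J B x) 0 m}.indicator Φ x ∂law ρ := by
  rw [← (measurePreserving_shift ρ n).lintegral_comp
    (hΦ.indicator (measurableSet_setOfPred.2 (h.measurable_isNext 0 m)))]
  refine lintegral_congr fun x => ?_
  have hx := h.isNext_shift n x 0 m
  rw [zero_add, add_comm m n] at hx
  by_cases hN : IsNext (pts J B x) n (n + m)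
  · simp [indicator, hN, hx.2 hN]
  · simp [indicator, hN, mt hx.1 hN]

theorem measure_next_shift (n m : ℤ) :
    law ρ {x | IsNext (pts J B x) n (n + m)} = law ρ {x | IsNext (pts J B x) 0 m} := by
  have := h.lintegral_next_shift ρ n m (Φ := 1) measurable_one
  simpa [Pi.one_def, ← Pi.one_def, lintegral_indicator_one
    (measurableSet_setOfPred.2 (h.measurable_isNext _ _))] using this

/-- Almost surely there is no last point. -/
theorem ae_not_last : ∀ᵐ x ∂law ρ, ∀ n : ℤ, n ∈ pts J B x → ∃ m, n < m ∧ m ∈ pts J B x := by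
  rw [ae_all_iff]
  let A : ℤ → Set Config := fun n => {x | n ∈ pts J B x ∧ ∀ m, n < m → m ∉ pts J B x}
  have hA : ∀ n, MeasurableSet (A n) := fun n => measurableSet_setOfPred.2 (by
    have := h.measurable_mem_pts; fun_prop)
  have hAs : ∀ n, law ρ (A n) = law ρ (A 0) := fun n => by
    rw [← (measurePreserving_shift ρ n).measure_preimage (hA 0).nullMeasurableSet]
    congr 1
    ext x
    simp only [A, mem_ofPred_eq, mem_preimage, h.pts_shift, zero_add]
    refine and_congr Iff.rfl ⟨fun H z hz => H _ (by omega), fun H z hz => ?_⟩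
    simpa using H (z - n) (by omega)
  have hdis : Pairwise (Function.onFun Disjoint A) := by
    intro n m hnm
    refine Set.disjoint_left.2 fun x h1 h2 => ?_
    rcases lt_or_gt_of_ne hnm with hlt | hlt
    · exact h1.2 m hlt h2.1
    · exact h2.2 n hlt h1.1
  -- The events of having the last point at `n` are disjoint and equally likely for all integers
  -- `n`, so they are null.
  have h0 : law ρ (A 0) = 0 := by
    by_contra hne
    have := measure_iUnion hdis hA (μ := law ρ)
    simp_rw [hAs] at this
    rw [ENNReal.tsum_const_eq_top_of_ne_zero hne] at this
    exact measure_ne_top _ _ this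
  intro n
  have : law ρ (A n) = 0 := by rw [hAs, h0]
  filter_upwards [measure_eq_zero_iff_ae_notMem.1 this] with x hx hn
  by_contra hcon
  push Not at hcon
  exact hx ⟨hn, hcon⟩

theorem tsum_measure_isFirst_le :
    ∑' n : ℕ, law ρ {x | IsFirst (pts J B x) n} ≤ 1 := by
  rw [← measure_iUnion]
  · exact prob_le_one
  · intro n m hnm
    refine Set.disjoint_left.2 fun x (h1 : IsFirst _ _) (h2 : IsFirst _ _) => ?_
    rcases lt_or_gt_of_ne hnm with hlt | hlt
    · exact h2.2 n (by omega) (by omega) h1.1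
    · exact h1.2 m (by omega) (by omega) h2.1
  · exact fun n => measurableSet_setOfPred.2 (h.measurable_isFirst n)

/-- Comparison of the interval after the first non-negative point with the typical interval. -/
theorem tsum_first_next_le {Φ : ℕ → Config → ℝ≥0∞} (hΦ : ∀ k, Measurable (Φ k))
    (hΦd : ∀ k, DependsOn (Φ k) (rightOf 0)) :
    law ρ {x | 0 ∈ pts J B x} * ∑' (n : ℕ) (k : ℕ), ∫⁻ x,
      {x | IsFirst (pts J B x) n ∧ IsNext (pts J B x) n (n + k + 1 : ℕ)}.indicator
        (fun x => Φ k (shift n x)) x ∂law ρ ≤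
      ∑' k : ℕ, ∫⁻ x, {x | IsNext (pts J B x) 0 (k + 1 : ℕ)}.indicator (Φ k) x ∂law ρ := by
  have key : ∀ n k : ℕ, law ρ {x | 0 ∈ pts J B x} * ∫⁻ x,
      {x | IsFirst (pts J B x) n ∧ IsNext (pts J B x) n (n + k + 1 : ℕ)}.indicator
        (fun x => Φ k (shift n x)) x ∂law ρ = law ρ {x | IsFirst (pts J B x) n} *
        ∫⁻ x, {x | IsNext (pts J B x) 0 (k + 1 : ℕ)}.indicator (Φ k) x ∂law ρ := by
    intro n k
    rw [← h.lintegral_next_shift ρ n _ (hΦ k), ← h.measure_mem_pts ρ n]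
    have := h.lintegral_first_next ρ (n := n) (m := (n + k + 1 : ℕ)) (by omega)
      (Φ := fun x => Φ k (shift n x)) ((hΦ k).comp (measurable_shift _))
      (DependsOn.shift (hΦd k) n fun e (he : 0 ≤ e.1.1) => by
        simp only [rightOf, shiftEdge, mem_ofPred_eq]; omega)
    rw [this]
    push_cast
    simp only [add_assoc]
  simp_rw [← ENNReal.tsum_mul_left, key, ENNReal.tsum_mul_left, ENNReal.tsum_mul_right]
  -- Only an upper bound by one is used for the total mass of first points, so the existence of a
  -- first point need not be known here.
  exact (mul_le_mul_left (h.tsum_measure_isFirst_le ρ) _).trans (one_mul _).le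

/-- By stationarity the interval of length `k + 1` may be moved so as to end at `n`. For `k ≥ n` it
then starts below `0`, which makes `n` the first non-negative point, and different `k` give disjoint
events. -/
theorem tsum_measure_isNext_le (n : ℕ) :
    ∑' k : ℕ, (if n ≤ k then law ρ {x | IsNext (pts J B x) 0 (k + 1 : ℕ)} else 0) ≤
      law ρ {x | IsFirst (pts J B x) n} := by
  let A : ℕ → Set Config := fun k => {x | n ≤ k ∧ IsNext (pts J B x) (n - (k + 1 : ℕ)) n}
  have hA : ∀ k, MeasurableSet (A k) := fun k => measurableSet_setOfPred.2 (by
    have := h.measurable_isNext; fun_prop)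
  have hA' : ∀ k : ℕ, (if n ≤ k then law ρ {x | IsNext (pts J B x) 0 (k + 1 : ℕ)} else 0) =
      law ρ (A k) := by
    intro k
    split_ifs with hk
    · rw [← h.measure_next_shift ρ (n - (k + 1 : ℕ))]
      simp [A, hk]
    · simp [A, hk]
  simp_rw [hA']
  rw [← measure_iUnion _ hA]
  · refine measure_mono (iUnion_subset fun k x hx => ⟨hx.2.2.1, fun m h0 hm => ?_⟩)
    have := hx.1
    exact hx.2.2.2 m (by omega) hm
  · intro k l hkl
    refine Set.disjoint_left.2 fun x h1 h2 => ?_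
    have := h1.1
    have := h2.1
    rcases lt_or_gt_of_ne hkl with hlt | hlt
    · exact h2.2.2.2 (n - (k + 1 : ℕ)) (by omega) (by omega) h1.2.1
    · exact h1.2.2.2 (n - (l + 1 : ℕ)) (by omega) (by omega) h2.2.1

/-- The second moment of the typical interval is bounded by the first moment of the first point. -/
theorem tsum_sq_measure_isNext_le :
    ∑' k : ℕ, ((k : ℝ≥0∞) + 1) ^ 2 * law ρ {x | IsNext (pts J B x) 0 (k + 1 : ℕ)} ≤
      ∑' n : ℕ, (2 * (n : ℝ≥0∞) + 1) * law ρ {x | IsFirst (pts J B x) n} := by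
  -- A square is a sum of consecutive odd numbers; exchanging the sums leaves, for each `n`, the
  -- probability of an interval longer than `n`.
  have hsq : ∀ k : ℕ, ((k : ℝ≥0∞) + 1) ^ 2 = ∑' n : ℕ, if n ≤ k then (2 * (n : ℝ≥0∞) + 1) else 0 := by
    intro k
    rw [tsum_eq_sum (s := Finset.range (k + 1)) (fun n hn => by
      rw [if_neg]; simpa using hn)]
    rw [Finset.sum_congr rfl (fun n hn => if_pos (Nat.lt_succ_iff.1 (Finset.mem_range.1 hn)))]
    induction k with
    | zero => simp
    | succ k ih => rw [Finset.sum_range_succ, ← ih]; push_cast; ring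
  simp_rw [hsq, ← ENNReal.tsum_mul_right]
  rw [ENNReal.tsum_comm]
  refine ENNReal.tsum_le_tsum fun n => ?_
  refine le_trans (le_of_eq ?_) (mul_le_mul_right (h.tsum_measure_isNext_le ρ n) _)
  rw [← ENNReal.tsum_mul_left]
  congr 1
  funext k
  split_ifs <;> simp

end RegenKernel

end OrderedGraph

namespace OrderedGraph

open scoped NNReal
open Set Filter Topology

/-! ### Strongly connected points and renewal points of a configuration -/

/-- The strongly connected points of a configuration. -/
abbrev scPts (x : Config) : Set ℤ := pts (Fast 0) (fun _ _ _ => False) x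

/-- The renewal points of a configuration. -/
abbrev rnPts (c : ℝ) (x : Config) : Set ℤ := pts (Fast c) (Heavy c) x

theorem regenKernel_sc : RegenKernel (Fast 0) (fun _ _ _ => False) where
  measurable_J := measurable_fast 0
  measurable_B _ _ := measurable_const
  dependsOn_J := dependsOn_fast 0
  dependsOn_B _ _ _ _ _ := rfl
  shift_J := fast_shift 0
  shift_B _ _ _ _ := Iff.rfl
  trans_J := fast_trans

theorem regenKernel_rn (c : ℝ) : RegenKernel (Fast c) (Heavy c) where
  measurable_J := measurable_fast c
  measurable_B := measurable_heavy c
  dependsOn_J := dependsOn_fast c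
  dependsOn_B := dependsOn_heavy c
  shift_J := fast_shift c
  shift_B := heavy_shift c
  trans_J := fast_trans

theorem weight_nonneg {x : Config} {i j : ℤ} (π : IncPath (ed x) i j) :
    0 ≤ π.weight (fun a b => (wt x a b : ℝ)) := by
  induction π with
  | nil => exact le_rfl
  | cons h e π ih => exact add_nonneg (NNReal.coe_nonneg _) ih

/-- Weights in a configuration are non-negative, and the supremum over no paths is `⊥`. Strong
connectedness is therefore the case of rate `0`. -/
theorem fast_zero_iff {x : Config} {i j : ℤ} : Fast 0 x i j ↔ Nonempty (IncPath (ed x) i j) := by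
  constructor
  · intro h
    by_contra hne
    rw [not_nonempty_iff] at hne
    simp [Fast, lp, lastPassage] at h
  · rintro ⟨π⟩
    refine le_trans ?_ (weight_le_lastPassage π)
    simpa using weight_nonneg π

theorem fast_zero_lp {x : Config} {i j : ℤ} : Fast 0 x i j ↔ 0 ≤ lp x i j := by
  simp [Fast]

theorem fast_self (c : ℝ) (x : Config) (i : ℤ) : Fast c x i i := by
  simp [Fast, lp, lastPassage_self]

theorem fast_zero_of_ed {x : Config} {i j : ℤ} (h : ed x i j) : Fast 0 x i j :=
  fast_zero_iff.2 ⟨.cons h.1 h (.nil j)⟩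

theorem wt_le_lp {x : Config} {i j : ℤ} (h : ed x i j) : ((wt x i j : ℝ) : EReal) ≤ lp x i j := by
  have := weight_le_lastPassage (v := fun a b => (wt x a b : ℝ)) (.cons h.1 h (.nil j))
  simpa [IncPath.weight, lp] using this

/-! ### The minimal weight in an interval -/

/-- The minimal weight of the pairs in `[a, b]`, whether present or not. -/
noncomputable def minW (x : Config) (a b : ℤ) : ℝ≥0∞ :=
  ⨅ (i : ℤ) (j : ℤ) (_ : a ≤ i ∧ i < j ∧ j ≤ b), (wt x i j : ℝ≥0∞)

theorem minW_le {x : Config} {a b i j : ℤ} (h : a ≤ i ∧ i < j ∧ j ≤ b) : minW x a b ≤ wt x i j :=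
  (iInf_le _ i).trans ((iInf_le _ j).trans (iInf_le _ h))

theorem minW_ne_top {x : Config} {a b : ℤ} (h : a < b) : minW x a b ≠ ∞ :=
  ((minW_le ⟨le_rfl, h, le_rfl⟩).trans_lt ENNReal.coe_lt_top).ne

@[fun_prop]
theorem measurable_minW (a b : ℤ) : Measurable (minW · a b) := by
  unfold minW; fun_prop

theorem dependsOn_minW (a b : ℤ) : DependsOn (minW · a b) (within a b) := by
  intro x y h
  refine iInf_congr fun i => iInf_congr fun j => iInf_congr fun hij => ?_
  have := dependsOn_wt i j (x := x) (y := y) (fun e (he : e.1 = (i, j)) =>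
    h e (by simp only [within, mem_ofPred_eq, he]; exact ⟨hij.1, hij.2.2⟩))
  simp only at this
  rw [this]

theorem minW_shift (t : ℤ) (x : Config) (a b : ℤ) :
    minW (shift t x) a b = minW x (a + t) (b + t) := by
  apply le_antisymm
  · refine le_iInf fun i => le_iInf fun j => le_iInf fun h => ?_
    have := minW_le (x := shift t x) (a := a) (b := b) (i := i - t) (j := j - t)
      ⟨by omega, by omega, by omega⟩
    simpa [wt_shift] using this
  · refine le_iInf fun i => le_iInf fun j => le_iInf fun h => ?_
    rw [wt_shift]
    exact minW_le ⟨by omega, by omega, by omega⟩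

/-- The first edge of any path already weighs at least the minimum, and the rest of the path is
non-negative. -/
theorem minW_le_lp {x : Config} {a b : ℤ} (hab : a < b) (h : Fast 0 x a b) :
    (((minW x a b).toReal : ℝ) : EReal) ≤ lp x a b := by
  obtain ⟨π⟩ := fast_zero_iff.1 h
  refine le_trans ?_ (weight_le_lastPassage π)
  cases π with
  | nil => omega
  | @cons _ k _ hk e π =>
    rw [EReal.coe_le_coe_iff, IncPath.weight]
    have h1 := weight_nonneg π
    have h2 : (minW x a b).toReal ≤ wt x a k :=
      ENNReal.toReal_mono ENNReal.coe_ne_top (minW_le ⟨le_rfl, hk, incPath_le π⟩)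
    linarith

/-! ### Gains along a set of junctions -/

open Classical in
/-- The truncated minimal weight between `z` and the next element of `S`. -/
noncomputable def gain (K : ℕ) (S : Set ℤ) (x : Config) (z : ℤ) : ℝ≥0∞ :=
  ∑ k ∈ Finset.range K,
    if IsNext S z (z + (k + 1)) then min (K : ℝ≥0∞) (minW x z (z + (k + 1))) else 0

theorem gain_le (K : ℕ) (S : Set ℤ) (x : Config) (z : ℤ) : gain K S x z ≤ K * K := by
  classical
  refine (Finset.sum_le_card_nsmul _ _ (K : ℝ≥0∞) fun k _ => ?_).trans (by simp)
  split_ifs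
  · exact min_le_left _ _
  · exact zero_le

theorem gain_ne_top (K : ℕ) (S : Set ℤ) (x : Config) (z : ℤ) : gain K S x z ≠ ∞ :=
  ((gain_le K S x z).trans_lt (ENNReal.mul_lt_top (by simp) (by simp))).ne

theorem toReal_gain_le (K : ℕ) (S : Set ℤ) (x : Config) (z : ℤ) :
    (gain K S x z).toReal ≤ K * K := by
  have := ENNReal.toReal_mono (by finiteness) (gain_le K S x z)
  simpa using this

theorem gain_eq_zero {K : ℕ} {S : Set ℤ} {x : Config} {z : ℤ} (h : z ∉ S) : gain K S x z = 0 := by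
  classical
  exact Finset.sum_eq_zero fun k _ => if_neg fun H => h H.1

theorem gain_le_minW {K : ℕ} {S : Set ℤ} {x : Config} {z y : ℤ} (h : IsNext S z y) (hzy : z < y) :
    gain K S x z ≤ minW x z y := by
  classical
  have huniq : ∀ k : ℕ, IsNext S z (z + (k + 1)) → z + (k + 1) = y := by
    intro k hk
    by_contra hne
    rcases lt_or_gt_of_ne hne with hlt | hlt
    · exact h.2.2 _ (by omega) hlt hk.2.1
    · exact hk.2.2 _ hzy hlt h.2.1
  calc gain K S x z ≤ ∑ k ∈ Finset.range K, if k = (y - z - 1).toNat then minW x z y else 0 := by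
        refine Finset.sum_le_sum fun k _ => ?_
        split_ifs with h1 h2 h2
        · rw [huniq k h1]; exact min_le_right _ _
        · exact absurd (huniq k h1) (by omega)
        · exact zero_le
        · exact le_rfl
    _ ≤ minW x z y := by
        rw [Finset.sum_ite_eq']
        split_ifs
        · exact le_rfl
        · exact zero_le

/-- Cutting off intervals longer than `K` makes the gain at `z` read `S` only on `[z, z + K]`; this
permits replacing strong connectedness by a local notion. -/
theorem gain_congr {K : ℕ} {S T : Set ℤ} {x : Config} {z : ℤ}
    (h : ∀ y, z ≤ y → y ≤ z + K → (y ∈ S ↔ y ∈ T)) : gain K S x z = gain K T x z := by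
  classical
  refine Finset.sum_congr rfl fun k hk => ?_
  have hk' := Finset.mem_range.1 hk
  have : IsNext S z (z + (k + 1)) ↔ IsNext T z (z + (k + 1)) := by
    unfold IsNext
    rw [h z le_rfl (by omega), h (z + (k + 1)) (by omega) (by omega)]
    refine and_congr Iff.rfl (and_congr Iff.rfl (forall_congr' fun y => ?_))
    refine forall_congr' fun h1 => forall_congr' fun h2 => ?_
    rw [h y (by omega) (by omega)]
  simp only [this]

/-- Induction along consecutive strongly connected points: the last interval contributes its gain
and superadditivity adds it to the earlier ones. The stretch before the first of them contributes at
least `0`. -/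
theorem sum_gain_le_lp_of_mem {K : ℕ} {x : Config} {y : ℤ} (hy : 0 ≤ y) (hyS : y ∈ scPts x) :
    ((∑ z ∈ Finset.Ico 0 y, (gain K (scPts x) x z).toReal : ℝ) : EReal) ≤ lp x 0 y := by
  obtain ⟨n, rfl⟩ : ∃ n : ℕ, y = n := ⟨y.toNat, by omega⟩
  clear hy
  induction n using Nat.strong_induction_on with
  | _ n ih =>
  by_cases hex : ∃ z, z ∈ scPts x ∧ 0 ≤ z ∧ z < n
  · obtain ⟨z, ⟨hzS, hz0, hzn⟩, hmax⟩ := Int.exists_greatest_of_bdd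
      (P := fun z => z ∈ scPts x ∧ 0 ≤ z ∧ z < n) ⟨n, fun z hz => hz.2.2.le⟩ hex
    obtain ⟨m, rfl⟩ : ∃ m : ℕ, z = m := ⟨z.toNat, by omega⟩
    have hnext : IsNext (scPts x) m n := ⟨hzS, hyS, fun w h1 h2 hw => by
      have := hmax w ⟨hw, by omega, h2⟩; omega⟩
    have h1 := ih m (by omega) hzS
    have h2 : (((gain K (scPts x) x m).toReal : ℝ) : EReal) ≤ lp x m n :=
      le_trans (EReal.coe_le_coe_iff.2 (ENNReal.toReal_mono (minW_ne_top hzn)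
        (gain_le_minW hnext hzn))) (minW_le_lp hzn (hzS.2.2 n hzn))
    have h3 : ∑ z ∈ Finset.Ico (0 : ℤ) n, (gain K (scPts x) x z).toReal =
        ∑ z ∈ Finset.Ico (0 : ℤ) m, (gain K (scPts x) x z).toReal +
          (gain K (scPts x) x m).toReal := by
      rw [← Finset.sum_sdiff (Finset.Ico_subset_Ico_right hzn.le), add_comm]
      congr 1
      refine Finset.sum_eq_single _ (fun w hw hne => ?_) (fun hm => ?_)
      · simp only [Finset.mem_sdiff, Finset.mem_Ico] at hw
        rw [gain_eq_zero (hnext.2.2 w (by omega) (by omega)), ENNReal.toReal_zero]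
      · simp at hm; omega
    rw [h3, EReal.coe_add]
    exact (add_le_add h1 h2).trans (lastPassage_add_le _ _ _)
  · push Not at hex
    rw [Finset.sum_eq_zero fun z hz => ?_]
    · rcases Nat.eq_zero_or_pos n with rfl | hn
      · simp [lp, lastPassage_self]
      · exact fast_zero_lp.1 (hyS.1 0 (by omega))
    · rw [Finset.mem_Ico] at hz
      rw [gain_eq_zero fun h => absurd (hex z h hz.1) (by omega), ENNReal.toReal_zero]

/-- The path goes through the last strongly connected point `z` before `l` and then reaches `l` with
non-negative weight. Only the gain at `z`, at most `K * K`, is lost. Such a `z` exists because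
otherwise all gains would vanish. -/
theorem fast_of_sum_gain {K : ℕ} {x : Config} {c : ℝ} {l : ℕ} (hc : 0 < c * l)
    (h : c * l + K * K ≤ ∑ z ∈ Finset.Ico (0 : ℤ) l, (gain K (scPts x) x z).toReal) :
    Fast c x 0 l := by
  have hex : ∃ z, z ∈ scPts x ∧ 0 ≤ z ∧ z < l := by
    by_contra hex
    push Not at hex
    rw [Finset.sum_eq_zero fun z hz => ?_] at h
    · nlinarith
    · rw [Finset.mem_Ico] at hz
      rw [gain_eq_zero fun h => absurd (hex z h hz.1) (by omega), ENNReal.toReal_zero]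
  obtain ⟨z, ⟨hzS, hz0, hzn⟩, hmax⟩ := Int.exists_greatest_of_bdd
      (P := fun z => z ∈ scPts x ∧ 0 ≤ z ∧ z < l) ⟨l, fun z hz => hz.2.2.le⟩ hex
  have h1 := sum_gain_le_lp_of_mem (K := K) hz0 hzS
  have h3 : ∑ z ∈ Finset.Ico (0 : ℤ) l, (gain K (scPts x) x z).toReal =
      ∑ z ∈ Finset.Ico (0 : ℤ) z, (gain K (scPts x) x z).toReal +
        (gain K (scPts x) x z).toReal := by
    rw [← Finset.sum_sdiff (Finset.Ico_subset_Ico_right hzn.le), add_comm]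
    congr 1
    refine Finset.sum_eq_single _ (fun w hw hne => ?_) (fun hm => ?_)
    · simp only [Finset.mem_sdiff, Finset.mem_Ico] at hw
      rw [gain_eq_zero fun hwS => absurd (hmax w ⟨hwS, by omega, by omega⟩) (by omega),
        ENNReal.toReal_zero]
    · simp at hm; omega
  have h4 := toReal_gain_le K (scPts x) x z
  have h5 : (0 : EReal) ≤ lp x z l := fast_zero_lp.1 (hzS.2.2 l hzn)
  refine le_trans ?_ (lastPassage_add_le 0 z l)
  refine le_trans ?_ (add_le_add h1 h5)
  rw [add_zero, EReal.coe_le_coe_iff]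
  push_cast
  linarith

/-! ### Locally strongly connected points -/

/-- The points joined to all points at distance at most `s`. -/
def locPts (s : ℕ) (x : Config) : Set ℤ :=
  {z | (∀ y, z < y → y ≤ z + s → Fast 0 x z y) ∧ ∀ y, z - s ≤ y → y < z → Fast 0 x y z}

theorem locPts_shift (s : ℕ) (t : ℤ) (x : Config) (z : ℤ) :
    z ∈ locPts s (shift t x) ↔ z + t ∈ locPts s x := by
  simp only [locPts, mem_ofPred_eq, fast_shift]
  refine and_congr ⟨fun H y h1 h2 => ?_, fun H y h1 h2 => H _ (by omega) (by omega)⟩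
    ⟨fun H y h1 h2 => ?_, fun H y h1 h2 => H _ (by omega) (by omega)⟩
  · simpa using H (y - t) (by omega) (by omega)
  · simpa using H (y - t) (by omega) (by omega)

theorem scPts_subset_locPts (s : ℕ) (x : Config) : scPts x ⊆ locPts s x :=
  fun _ h => ⟨fun y h1 _ => h.2.2 y h1, fun y _ h1 => h.1 y h1⟩

theorem eventually_mem_locPts_iff (x : Config) (z : ℤ) :
    ∀ᶠ s : ℕ in atTop, (z ∈ locPts s x ↔ z ∈ scPts x) := by
  by_cases hz : z ∈ scPts x
  · exact Eventually.of_forall fun s => ⟨fun _ => hz, fun h => scPts_subset_locPts s x h⟩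
  · obtain ⟨s₀, hs₀⟩ : ∃ s₀ : ℕ, z ∉ locPts s₀ x := by
      by_contra hcon
      push Not at hcon
      refine hz ⟨fun y hy => (hcon (z - y).toNat).2 y (by omega) hy, fun _ _ _ _ h => h,
        fun y hy => (hcon (y - z).toNat).1 y hy (by omega)⟩
    filter_upwards [eventually_ge_atTop s₀] with s hs
    refine ⟨fun h => absurd ?_ hs₀, fun h => absurd h hz⟩
    exact ⟨fun y h1 h2 => h.1 y h1 (by omega), fun y h1 h2 => h.2 y (by omega) h2⟩

theorem measurable_mem_locPts (s : ℕ) (z : ℤ) : Measurable fun x => z ∈ locPts s x := by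
  simp only [locPts, mem_ofPred_eq]; fun_prop

theorem dependsOn_mem_locPts (s : ℕ) (z : ℤ) :
    DependsOn (fun x => z ∈ locPts s x) (within (z - s) (z + s)) := by
  refine dependsOn_and ?_ ?_
  · exact dependsOn_forall fun y => dependsOn_imp fun h1 => dependsOn_imp fun h2 =>
      (dependsOn_fast 0 z y).mono fun e he => ⟨by have := he.1; omega, he.2.trans h2⟩
  · exact dependsOn_forall fun y => dependsOn_imp fun h1 => dependsOn_imp fun h2 =>
      (dependsOn_fast 0 y z).mono fun e he => ⟨h1.trans he.1, by have := he.2; omega⟩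

theorem measurable_gain {S : Config → Set ℤ} (hS : ∀ z, Measurable fun x => z ∈ S x) (K : ℕ)
    (z : ℤ) : Measurable fun x => gain K (S x) x z := by
  classical
  unfold gain
  refine Finset.measurable_fun_sum _ fun k _ => Measurable.ite (measurableSet_setOfPred.2 ?_) ?_ ?_
  · unfold IsNext; fun_prop
  · fun_prop
  · fun_prop

theorem gain_shift {S : Config → Set ℤ} (hS : ∀ t x z, z ∈ S (shift t x) ↔ z + t ∈ S x) (K : ℕ)
    (t : ℤ) (x : Config) (z : ℤ) :
    gain K (S (shift t x)) (shift t x) z = gain K (S x) x (z + t) := by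
  classical
  refine Finset.sum_congr rfl fun k _ => ?_
  have : IsNext (S (shift t x)) z (z + (k + 1)) ↔ IsNext (S x) (z + t) (z + t + (k + 1)) := by
    unfold IsNext
    rw [hS, hS, show z + (k + 1) + t = z + t + (k + 1) by ring]
    refine and_congr Iff.rfl (and_congr Iff.rfl ⟨fun H y h1 h2 => ?_, fun H y h1 h2 => ?_⟩)
    · have := H (y - t) (by omega) (by omega)
      rw [hS] at this
      simpa using this
    · rw [hS]; exact H _ (by omega) (by omega)
  simp only [this, minW_shift, show z + (k + 1) + t = z + t + ((k : ℤ) + 1) by ring]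

theorem dependsOn_gain_locPts (K s : ℕ) (z : ℤ) :
    DependsOn (fun x => gain K (locPts s x) x z) (within (z - s) (z + K + s)) := by
  intro x y h
  classical
  refine Finset.sum_congr rfl fun k hk => ?_
  have hk' := Finset.mem_range.1 hk
  have hmem : ∀ w, z ≤ w → w ≤ z + K → (w ∈ locPts s x ↔ w ∈ locPts s y) := fun w h1 h2 =>
    iff_of_eq (dependsOn_mem_locPts s w fun e he =>
      h e ⟨by have := he.1; omega, by have := he.2; omega⟩)
  have hW : minW x z (z + (k + 1)) = minW y z (z + (k + 1)) :=
    dependsOn_minW z _ fun e he => h e ⟨by have := he.1; omega, by have := he.2; omega⟩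
  have : IsNext (locPts s x) z (z + (k + 1)) ↔ IsNext (locPts s y) z (z + (k + 1)) := by
    unfold IsNext
    rw [hmem z le_rfl (by omega), hmem (z + (k + 1)) (by omega) (by omega)]
    refine and_congr Iff.rfl (and_congr Iff.rfl (forall_congr' fun y => ?_))
    refine forall_congr' fun h1 => forall_congr' fun h2 => ?_
    rw [hmem y (by omega) (by omega)]
  simp only [this, hW]

/-! ### Mean gains under truncation and localisation. -/

section Mean

variable (ρ : Measure (ℝ≥0 × Bool))

/-- Two monotone limits: finitely many interval lengths (`K₀`) approximate the sum, then capping the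
minimum at `T` approximates its integral. -/
theorem exists_lt_lintegral_gain {a : ℝ≥0∞}
    (h : a < ∑' k : ℕ, ∫⁻ x, {x | IsNext (scPts x) 0 (k + 1 : ℕ)}.indicator
      (fun x => minW x 0 (k + 1 : ℕ)) x ∂law ρ) :
    ∃ K : ℕ, a < ∫⁻ x, gain K (scPts x) x 0 ∂law ρ := by
  classical
  have hm : ∀ k : ℕ, MeasurableSet {x | IsNext (scPts x) 0 (k + 1 : ℕ)} := fun k =>
    measurableSet_setOfPred.2 (regenKernel_sc.measurable_isNext _ _)
  rw [ENNReal.tsum_eq_iSup_nat] at h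
  obtain ⟨K₀, hK₀⟩ := lt_iSup_iff.1 h
  let F : ℕ → Config → ℝ≥0∞ := fun T x => ∑ k ∈ Finset.range K₀,
    {x | IsNext (scPts x) 0 (k + 1 : ℕ)}.indicator (fun x => min (T : ℝ≥0∞) (minW x 0 (k + 1 : ℕ))) x
  have hF : ∀ T, Measurable (F T) := fun T => Finset.measurable_fun_sum _ fun k _ =>
    Measurable.indicator (by fun_prop) (hm k)
  have hFmono' : ∀ k x, Monotone fun T : ℕ => {x | IsNext (scPts x) 0 (k + 1 : ℕ)}.indicator
      (fun x => min (T : ℝ≥0∞) (minW x 0 (k + 1 : ℕ))) x := fun k x T T' hT =>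
    indicator_le_indicator (min_le_min_right _ (by exact_mod_cast hT))
  have hFmono : Monotone F := fun T T' hT x => Finset.sum_le_sum fun k _ => hFmono' k x hT
  have hsup : ∀ x, ⨆ T, F T x = ∑ k ∈ Finset.range K₀,
      {x | IsNext (scPts x) 0 (k + 1 : ℕ)}.indicator (fun x => minW x 0 (k + 1 : ℕ)) x := by
    intro x
    simp only [F]
    rw [← ENNReal.finsetSum_iSup_of_monotone fun k => hFmono' k x]
    refine Finset.sum_congr rfl fun k _ => ?_
    by_cases hx : x ∈ {x | IsNext (scPts x) 0 (k + 1 : ℕ)}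
    · simp only [indicator_of_mem hx]
      obtain ⟨T, hT⟩ := exists_nat_gt (minW x 0 (k + 1 : ℕ)).toReal
      have hne : minW x 0 (k + 1 : ℕ) ≠ ∞ := minW_ne_top (by omega)
      refine le_antisymm (iSup_le fun T => min_le_right _ _) (le_iSup_of_le T ?_)
      refine le_min ?_ le_rfl
      rw [← ENNReal.ofReal_toReal hne, ← ENNReal.ofReal_natCast]
      exact ENNReal.ofReal_le_ofReal hT.le
    · simp only [indicator_of_notMem hx, iSup_const]
  rw [← lintegral_finsetSum _ (fun k _ => (measurable_minW _ _).indicator (hm k))] at hK₀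
  simp_rw [← hsup] at hK₀
  rw [lintegral_iSup hF hFmono] at hK₀
  obtain ⟨T, hT⟩ := lt_iSup_iff.1 hK₀
  -- One parameter plays both roles, and the gain only grows if either cutoff is raised.
  refine ⟨max K₀ T, hT.trans_le (lintegral_mono fun x => ?_)⟩
  refine le_trans ?_ (Finset.sum_le_sum_of_subset (Finset.range_mono (le_max_left K₀ T)))
  refine Finset.sum_le_sum fun k _ => ?_
  simp only [indicator, mem_ofPred_eq, zero_add, Nat.cast_add, Nat.cast_one]
  split_ifs
  · exact min_le_min_right _ (by exact_mod_cast le_max_right K₀ T)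
  · exact le_rfl

/-- The gain at `0` depends on membership of finitely many integers, each of which stabilises as `s`
grows; the constant `K * K` dominates. -/
theorem tendsto_lintegral_gain [IsProbabilityMeasure ρ] (K : ℕ) :
    Tendsto (fun s : ℕ => ∫⁻ x, gain K (locPts s x) x 0 ∂law ρ) atTop
      (𝓝 (∫⁻ x, gain K (scPts x) x 0 ∂law ρ)) := by
  refine tendsto_lintegral_of_dominated_convergence (fun _ => (K * K : ℝ≥0∞))
    (fun s => measurable_gain (measurable_mem_locPts s) K 0)
    (fun s => Eventually.of_forall fun x => gain_le _ _ _ _) ?_ (Eventually.of_forall fun x => ?_)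
  · simp only [lintegral_const, measure_univ, mul_one]; finiteness
  · have : ∀ᶠ s : ℕ in atTop, ∀ y ∈ Finset.Icc (0 : ℤ) K, (y ∈ locPts s x ↔ y ∈ scPts x) :=
      (Finset.eventually_all _).2 fun y _ => eventually_mem_locPts_iff x y
    refine tendsto_const_nhds.congr' ?_
    filter_upwards [this] with s hs
    exact (gain_congr fun y h1 h2 => hs y (Finset.mem_Icc.2 ⟨h1, by omega⟩)).symm

end Mean

end OrderedGraph

namespace OrderedGraph

open scoped NNReal
open Set Filter Topology

/-! ### Tail bound for slow passages. -/

section Tail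

variable (ρ : Measure (ℝ≥0 × Bool)) [IsProbabilityMeasure ρ]

theorem law_forall_range {g : ℕ → Edge} (hg : Function.Injective g) (n : ℕ)
    {T : Set (ℝ≥0 × Bool)} (hT : MeasurableSet T) :
    law ρ {x | ∀ t < n, x (g t) ∈ T} = ρ T ^ n := by
  classical
  have : {x : Config | ∀ t < n, x (g t) ∈ T} =
      Set.pi ((Finset.range n).image g) fun _ => T := by
    ext x
    simp
  rw [this, Measure.infinitePi_pi _ fun _ _ => hT, Finset.prod_const,
    Finset.card_image_of_injective _ hg, Finset.card_range]

/-- The edge from `n - 1 - t` to `n`. -/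
def edgeInto (n : ℤ) (t : ℕ) : Edge := ⟨(n - 1 - t, n), by simp only; omega⟩

/-- The edge from `n` to `n + 1 + t`. -/
def edgeFrom (n : ℤ) (t : ℕ) : Edge := ⟨(n, n + 1 + t), by simp only; omega⟩

theorem edgeInto_injective (n : ℤ) : Function.Injective (edgeInto n) := by
  intro t t' h
  simp only [edgeInto, Subtype.mk.injEq, Prod.mk.injEq, and_true] at h
  omega

theorem edgeFrom_injective (n : ℤ) : Function.Injective (edgeFrom n) := by
  intro t t' h
  simp only [edgeFrom, Subtype.mk.injEq, Prod.mk.injEq, true_and] at h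
  omega

/-- The pairs carrying no edge. -/
def absent : Set (ℝ≥0 × Bool) := {a | a.2 = false}

theorem measurableSet_absent : MeasurableSet absent :=
  measurable_snd (measurableSet_singleton false)

theorem mem_absent_of_not_ed {x : Config} {e : Edge} (h : ¬ ed x e.1.1 e.1.2) : x e ∈ absent := by
  by_contra hne
  refine h ⟨e.2, ?_⟩
  simpa [absent] using hne

/-- Let `n` be the least distance at which the connection to the right fails; then `n > s`. All
smaller distances are reachable, so none of the `n` edges from `[0, n)` into `n` can be present. The
left side is symmetric. This gives a geometric bound in `s`. -/
theorem locPts_diff_scPts_subset (s : ℕ) :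
    {x | 0 ∈ locPts s x ∧ 0 ∉ scPts x} ⊆
      (⋃ k : ℕ, {x | ∀ t < s + 1 + k, x (edgeInto (s + 1 + k : ℕ) t) ∈ absent}) ∪
        ⋃ k : ℕ, {x | ∀ t < s + 1 + k, x (edgeFrom (-(s + 1 + k : ℕ)) t) ∈ absent} := by
  classical
  rintro x ⟨⟨h1, h2⟩, hx⟩
  by_cases hR : ∃ n : ℕ, ¬ Fast 0 x 0 n
  · left
    have hn := Nat.find_spec hR
    have hmin : ∀ m < Nat.find hR, Fast 0 x 0 (m : ℕ) := fun m hm =>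
      not_not.1 (Nat.find_min hR hm)
    set n := Nat.find hR
    have hsn : s < n := by
      by_contra hle
      rcases Nat.eq_zero_or_pos n with h0 | h0
      · rw [h0] at hn; exact hn (fast_self 0 x 0)
      · exact hn (h1 n (by omega) (by omega))
    refine mem_iUnion.2 ⟨n - (s + 1), fun t ht => mem_absent_of_not_ed fun hed => hn ?_⟩
    rw [show s + 1 + (n - (s + 1)) = n by omega] at ht hed
    have h3 := hmin (n - 1 - t) (by omega)
    rw [show ((n - 1 - t : ℕ) : ℤ) = (n : ℤ) - 1 - t by omega] at h3
    exact fast_trans h3 (fast_zero_of_ed hed)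
  · push Not at hR
    right
    have hL : ∃ n : ℕ, ¬ Fast 0 x (-n) 0 := by
      by_contra hL
      push Not at hL
      refine hx ⟨fun y hy => ?_, fun _ _ _ _ h => h, fun y hy => ?_⟩
      · have := hL (-y).toNat; rwa [show -((-y).toNat : ℤ) = y by omega] at this
      · have := hR y.toNat; rwa [show (y.toNat : ℤ) = y by omega] at this
    have hn := Nat.find_spec hL
    have hmin : ∀ m < Nat.find hL, Fast 0 x (-(m : ℕ)) 0 := fun m hm =>
      not_not.1 (Nat.find_min hL hm)
    set n := Nat.find hL
    have hsn : s < n := by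
      by_contra hle
      rcases Nat.eq_zero_or_pos n with h0 | h0
      · rw [h0] at hn; exact hn (by simpa using fast_self 0 x 0)
      · exact hn (h2 (-n) (by omega) (by omega))
    refine mem_iUnion.2 ⟨n - (s + 1), fun t ht => mem_absent_of_not_ed fun hed => hn ?_⟩
    rw [show s + 1 + (n - (s + 1)) = n by omega] at ht hed
    have h3 := hmin (n - 1 - t) (by omega)
    rw [show -((n - 1 - t : ℕ) : ℤ) = -(n : ℤ) + 1 + t by omega] at h3
    exact fast_trans (fast_zero_of_ed hed) h3

theorem measure_locPts_diff_le (s : ℕ) :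
    law ρ {x | 0 ∈ locPts s x ∧ 0 ∉ scPts x} ≤
      2 * (ρ absent ^ s * (1 - ρ absent)⁻¹) := by
  refine (measure_mono (locPts_diff_scPts_subset s)).trans ((measure_union_le _ _).trans ?_)
  rw [two_mul, ← ENNReal.tsum_geometric, ← ENNReal.tsum_mul_left]
  have hle : ∀ k : ℕ, ρ absent ^ (s + 1 + k) ≤ ρ absent ^ s * ρ absent ^ k := fun k => by
    rw [← pow_add]
    exact pow_le_pow_right_of_le_one' prob_le_one (by omega)
  refine add_le_add ?_ ?_
  · refine (measure_iUnion_le _).trans (ENNReal.tsum_le_tsum fun k => ?_)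
    rw [law_forall_range ρ (edgeInto_injective _) _ measurableSet_absent]
    exact hle k
  · refine (measure_iUnion_le _).trans (ENNReal.tsum_le_tsum fun k => ?_)
    rw [law_forall_range ρ (edgeFrom_injective _) _ measurableSet_absent]
    exact hle k

theorem measureReal_exists_locPts_diff_le (h0 : ρ absent < 1) : ∃ C : ℝ, 0 ≤ C ∧ ∀ s n : ℕ,
    (law ρ).real {x | ∃ z ∈ Finset.range n, (z : ℤ) ∈ locPts s x ∧ (z : ℤ) ∉ scPts x} ≤
      n * (C * (ρ absent).toReal ^ s) := by
  refine ⟨2 * (1 - ρ absent)⁻¹.toReal, by positivity, fun s n => ?_⟩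
  have hm : MeasurableSet {x | (0 : ℤ) ∈ locPts s x ∧ (0 : ℤ) ∉ scPts x} :=
    measurableSet_setOfPred.2 ((measurable_mem_locPts s 0).and
      (regenKernel_sc.measurable_mem_pts 0).not)
  have hU : {x | ∃ z ∈ Finset.range n, (z : ℤ) ∈ locPts s x ∧ (z : ℤ) ∉ scPts x} =
      ⋃ z ∈ Finset.range n, shift z ⁻¹' {x | (0 : ℤ) ∈ locPts s x ∧ (0 : ℤ) ∉ scPts x} := by
    ext x
    simp only [mem_ofPred_eq, mem_iUnion, mem_preimage, locPts_shift, regenKernel_sc.pts_shift,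
      zero_add, exists_prop]
  rw [hU]
  refine (measureReal_biUnion_finset_le _ _).trans ?_
  refine (Finset.sum_le_card_nsmul _ _ (2 * (1 - ρ absent)⁻¹.toReal * (ρ absent).toReal ^ s)
    fun z _ => ?_).trans (by simp)
  rw [measureReal_def, (measurePreserving_shift ρ z).measure_preimage hm.nullMeasurableSet]
  have hne : (1 - ρ absent)⁻¹ ≠ ∞ := ENNReal.inv_ne_top.2 (tsub_pos_of_lt h0).ne'
  refine (ENNReal.toReal_mono ?_ (measure_locPts_diff_le ρ s)).trans (le_of_eq ?_)
  · have := h0.ne_top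
    finiteness
  · simp only [ENNReal.toReal_mul, ENNReal.toReal_pow, ENNReal.toReal_ofNat]
    ring

/-- The local gain as a real random variable. -/
noncomputable def locGain (K s : ℕ) (z : ℤ) (x : Config) : ℝ :=
  (gain K (locPts s x) x z).toReal

theorem measurable_locGain (K s : ℕ) (z : ℤ) : Measurable (locGain K s z) :=
  (measurable_gain (measurable_mem_locPts s) K z).ennreal_toReal

theorem integral_locGain (K s : ℕ) (z : ℤ) :
    ∫ x, locGain K s z x ∂law ρ = (∫⁻ x, gain K (locPts s x) x 0 ∂law ρ).toReal := by
  unfold locGain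
  rw [integral_toReal (measurable_gain (measurable_mem_locPts s) K z).aemeasurable
    (Eventually.of_forall fun x => (gain_ne_top _ _ _ _).lt_top),
    ← (measurePreserving_shift ρ z).lintegral_comp
      (measurable_gain (measurable_mem_locPts s) K 0)]
  congr 1
  refine lintegral_congr fun x => ?_
  rw [gain_shift (S := locPts s) (locPts_shift s), zero_add]

/-- The local gain at `z` depends on edges inside `[z - s, z + K + s]`. Along a residue class modulo
`2 * s + K` these windows share at most endpoints, hence no edges. The gains are thus independent
with values in `[0, K * K]`, and Hoeffding's inequality applies. -/
theorem measureReal_sum_locGain_le (K s : ℕ) (r : ℤ) (m : ℕ) {ε : ℝ} (hε : 0 ≤ ε) :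
    (law ρ).real {x | ∑ j ∈ Finset.range m, locGain K s (r + j * (2 * s + K : ℕ)) x ≤
      ((∫⁻ x, gain K (locPts s x) x 0 ∂law ρ).toReal - ε) * m} ≤
      Real.exp (-(2 * ε ^ 2 / (K * K) ^ 2 * m)) := by
  set μs := (∫⁻ x, gain K (locPts s x) x 0 ∂law ρ).toReal with hμs
  let X : ℕ → Config → ℝ := fun j x => μs - locGain K s (r + j * (2 * s + K : ℕ)) x
  have hX : ∀ j, Measurable (X j) := fun j => (measurable_locGain _ _ _).const_sub _
  have hind : iIndepFun X (law ρ) := by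
    refine iIndepFun_of_dependsOn ρ hX
      (A := fun j : ℕ => within (r + j * (2 * s + K : ℕ) - s) (r + j * (2 * s + K : ℕ) + K + s))
      (fun j x y hxy => ?_) ?_
    · have := dependsOn_gain_locPts K s (r + j * (2 * s + K : ℕ)) hxy
      simp only at this
      simp only [X, locGain, this]
    · have key : ∀ i j : ℕ, i < j → Disjoint
          (within (r + i * (2 * s + K : ℕ) - s) (r + i * (2 * s + K : ℕ) + K + s))
          (within (r + j * (2 * s + K : ℕ) - s) (r + j * (2 * s + K : ℕ) + K + s)) := by
        intro i j hij
        refine Set.disjoint_left.2 fun e h1 h2 => ?_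
        have h3 := e.2
        have h4 := h1.2
        have h5 := h2.1
        have h6 : ((i : ℤ) + 1) * (2 * s + K : ℕ) ≤ j * (2 * s + K : ℕ) :=
          mul_le_mul_of_nonneg_right (by omega) (by omega)
        rw [add_mul, one_mul] at h6
        push_cast at h4 h5 h6
        omega
      intro i j hij
      rcases lt_or_gt_of_ne hij with h | h
      · exact key i j h
      · exact (key j i h).symm
  have hsub : ∀ j < m, HasSubgaussianMGF (X j) ((‖(0 : ℝ) - (-(K * K : ℝ))‖₊ / 2) ^ 2) (law ρ) := by
    intro j _
    have := hasSubgaussianMGF_of_mem_Icc (μ := law ρ) (a := -(K * K : ℝ)) (b := 0)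
      (X := fun x => -locGain K s (r + j * (2 * s + K : ℕ)) x)
      (measurable_locGain _ _ _).neg.aemeasurable
      (Eventually.of_forall fun x => ⟨neg_le_neg (toReal_gain_le _ _ _ _),
        neg_nonpos.2 ENNReal.toReal_nonneg⟩)
    rw [integral_neg, integral_locGain] at this
    convert this using 2
    simp only [X, hμs]; ring
  have hH := HasSubgaussianMGF.measure_sum_range_ge_le_of_iIndepFun hind hsub
    (ε := ε * m) (by positivity)
  refine le_trans (measureReal_mono fun x hx => ?_) (hH.trans (le_of_eq ?_))
  · simp only [mem_ofPred_eq, X, Finset.sum_sub_distrib, Finset.sum_const, Finset.card_range,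
      nsmul_eq_mul] at hx ⊢
    linarith
  · congr 1
    have : (((‖(0 : ℝ) - (-(K * K : ℝ))‖₊ / 2) ^ 2 : ℝ≥0) : ℝ) = (K * K) ^ 2 / 4 := by
      push_cast
      rw [zero_sub, neg_neg, Real.norm_of_nonneg (by positivity)]
      ring
    rw [this]
    -- For `m = 0` or `K = 0` both exponents are `0`, by the convention for division by zero where
    -- needed.
    rcases Nat.eq_zero_or_pos m with rfl | hm
    · simp
    rcases Nat.eq_zero_or_pos K with rfl | hK
    · simp
    field_simp
    ring

theorem sum_range_mul (F : ℕ → ℝ) (D m : ℕ) :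
    ∑ i ∈ Finset.range (D * m), F i =
      ∑ r ∈ Finset.range D, ∑ j ∈ Finset.range m, F (r + j * D) := by
  induction m with
  | zero => simp
  | succ m ih =>
    rw [Nat.mul_succ, Finset.sum_range_add, ih]
    simp_rw [Finset.sum_range_succ]
    rw [Finset.sum_add_distrib]
    congr 1
    refine Finset.sum_congr rfl fun r _ => ?_
    rw [add_comm, mul_comm]

theorem sum_Ico_int (F : ℤ → ℝ) (n : ℕ) :
    ∑ z ∈ Finset.Ico (0 : ℤ) n, F z = ∑ i ∈ Finset.range n, F i := by
  induction n with
  | zero => simp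
  | succ n ih =>
    rw [Finset.sum_range_succ, ← ih, ← Finset.sum_sdiff (Finset.Ico_subset_Ico_right
      (show (n : ℤ) ≤ (n + 1 : ℕ) by omega)), add_comm]
    congr 1
    refine Finset.sum_eq_single _ (fun w hw hne => ?_) (fun hm => ?_)
    · simp only [Finset.mem_sdiff, Finset.mem_Ico] at hw; omega
    · simp at hm

/-- The event that a gain over some residue class is too small. -/
def lowGain (K s m : ℕ) (a : ℝ) : Set Config :=
  {x | ∃ r ∈ Finset.range (2 * s + K),
    ∑ j ∈ Finset.range m, locGain K s (r + j * (2 * s + K : ℕ)) x ≤ a * m}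

/-- Off the first event local and true gains agree on `[0, l)`. Off the second every residue class
earns more than `a` per term. Only the fewer than `2 * s + K` positions beyond the last full period
are discarded. -/
theorem fast_of_notMem {K s l : ℕ} {c a : ℝ} (hc : 0 < c) (ha : 0 ≤ a) (hl : 0 < l)
    (hsK : 0 < 2 * s + K) {x : Config}
    (h1 : x ∉ {x | ∃ z ∈ Finset.range (l + K), (z : ℤ) ∈ locPts s x ∧ (z : ℤ) ∉ scPts x})
    (h2 : x ∉ lowGain K s (l / (2 * s + K)) a)
    (h3 : c * l + K * K ≤ a * ((l : ℝ) - (2 * s + K : ℕ))) : Fast c x 0 l := by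
  have hgain : ∀ i ∈ Finset.range l, (gain K (scPts x) x i).toReal = locGain K s i x := by
    intro i hi
    rw [locGain, gain_congr fun y hy1 hy2 => ?_]
    obtain ⟨y, rfl⟩ : ∃ y' : ℕ, y = y' := ⟨y.toNat, by omega⟩
    have := Finset.mem_range.1 hi
    refine ⟨fun h => scPts_subset_locPts s x h, fun h => ?_⟩
    by_contra hcon
    exact h1 ⟨y, Finset.mem_range.2 (by omega), h, hcon⟩
  refine fast_of_sum_gain (K := K) (by positivity) ?_
  rw [sum_Ico_int (fun z => (gain K (scPts x) x z).toReal), Finset.sum_congr rfl hgain]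
  refine h3.trans ?_
  set D := 2 * s + K with hD
  set m := l / D with hm
  have hsub : ∑ i ∈ Finset.range (D * m), locGain K s i x ≤
      ∑ i ∈ Finset.range l, locGain K s i x :=
    Finset.sum_le_sum_of_subset_of_nonneg (Finset.range_mono (Nat.mul_div_le l D))
      fun i _ _ => ENNReal.toReal_nonneg
  refine le_trans ?_ hsub
  rw [sum_range_mul (fun i => locGain K s i x) D m]
  have hr : ∀ r ∈ Finset.range D, a * m ≤
      ∑ j ∈ Finset.range m, locGain K s ((r + j * D : ℕ) : ℤ) x := by
    intro r hr
    have : ¬ (∑ j ∈ Finset.range m, locGain K s (r + j * (2 * s + K : ℕ)) x ≤ a * m) := fun h =>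
      h2 ⟨r, hr, h⟩
    rw [not_le] at this
    refine this.le.trans (le_of_eq (Finset.sum_congr rfl fun j _ => ?_))
    push_cast [hD]
    rfl
  refine le_trans ?_ (Finset.card_nsmul_le_sum _ _ _ hr)
  rw [Finset.card_range, nsmul_eq_mul]
  have h4 : (l : ℝ) - D ≤ D * m := by
    have := Nat.lt_mul_div_succ l hsK
    have h5 : (l : ℝ) < D * (m + 1) := by exact_mod_cast this
    linarith
  nlinarith

theorem measureReal_lowGain_le (K s m : ℕ) {ε a : ℝ} (hε : 0 ≤ ε)
    (ha : a + ε ≤ (∫⁻ x, gain K (locPts s x) x 0 ∂law ρ).toReal) :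
    (law ρ).real (lowGain K s m a) ≤
      (2 * s + K : ℕ) * Real.exp (-(2 * ε ^ 2 / (K * K) ^ 2 * m)) := by
  have : lowGain K s m a ⊆ ⋃ r ∈ Finset.range (2 * s + K),
      {x | ∑ j ∈ Finset.range m, locGain K s (((r : ℕ) : ℤ) + j * (2 * s + K : ℕ)) x ≤
      ((∫⁻ x, gain K (locPts s x) x 0 ∂law ρ).toReal - ε) * m} := by
    rintro x ⟨r, hr, h⟩
    refine mem_iUnion₂.2 ⟨r, hr, h.trans ?_⟩
    gcongr
    linarith
  refine (measureReal_mono this (measure_ne_top _ _)).trans ((measureReal_biUnion_finset_le _ _).trans ?_)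
  refine (Finset.sum_le_card_nsmul _ _ _ fun (r : ℕ) _ =>
    measureReal_sum_locGain_le ρ K s (r : ℤ) m hε).trans ?_
  rw [Finset.card_range, nsmul_eq_mul]

/-- With `s` about `√l` and `K ≤ s`, each residue class has at least `s / 3 - 1` terms, so both the
localisation error and the Hoeffding error are geometric in `s`. -/
theorem tail_numeric {K s l : ℕ} {κ C₀ r : ℝ} (hsK : K ≤ s) (hs1 : 1 ≤ s)
    (hslR : (s : ℝ) * s ≤ l) (hlsR : (l : ℝ) ≤ s * s + s + s) (hκ : 0 ≤ κ) (hC₀ : 0 ≤ C₀)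
    (hr0 : 0 ≤ r) :
    ((l + K : ℕ) : ℝ) * (C₀ * r ^ s) +
        ((2 * s + K : ℕ) : ℝ) * Real.exp (-(κ * (l / (2 * s + K) : ℕ))) ≤
      ((4 + K) * C₀ + 3 * Real.exp κ) * (s : ℝ) ^ 2 * max r (Real.exp (-(κ / 3))) ^ s := by
  have hs1R : (1 : ℝ) ≤ s := by exact_mod_cast hs1
  have hsKR : (K : ℝ) ≤ s := by exact_mod_cast hsK
  have hss : (s : ℝ) ≤ s ^ 2 := by nlinarith
  have hK0 : (0 : ℝ) ≤ K := Nat.cast_nonneg K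
  set q := max r (Real.exp (-(κ / 3)))
  have hm : (s : ℝ) / 3 - 1 ≤ (l / (2 * s + K) : ℕ) := by
    have h1 := Nat.lt_mul_div_succ l (show 0 < 2 * s + K by omega)
    set m := l / (2 * s + K)
    have h2 : (l : ℝ) < (2 * s + K) * (m + 1) := by exact_mod_cast h1
    have h3 : ((2 : ℝ) * s + K) * (m + 1) ≤ (3 * s) * (m + 1) :=
      mul_le_mul_of_nonneg_right (by linarith) (by positivity)
    have h4 : (s : ℝ) * s < s * (3 * (m + 1)) := by linarith
    have h5 := lt_of_mul_lt_mul_left h4 (by linarith)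
    linarith
  set m := l / (2 * s + K)
  have hexp : Real.exp (-(κ * m)) ≤ Real.exp κ * q ^ s := by
    have h1 : Real.exp (-(κ * m)) ≤ Real.exp κ * Real.exp (-(κ / 3)) ^ s := by
      rw [← Real.exp_nat_mul, ← Real.exp_add, Real.exp_le_exp]
      have := mul_le_mul_of_nonneg_left hm hκ
      linarith
    refine h1.trans ?_
    gcongr
    exact le_max_right _ _
  have hrs : r ^ s ≤ q ^ s := pow_le_pow_left₀ hr0 (le_max_left _ _) s
  have e1 : ((l + K : ℕ) : ℝ) * (C₀ * r ^ s) ≤ (4 + K) * C₀ * s ^ 2 * q ^ s := by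
    have h1 : ((l + K : ℕ) : ℝ) ≤ (4 + K) * s ^ 2 := by
      push_cast
      have : (K : ℝ) * 1 ≤ K * s ^ 2 := mul_le_mul_of_nonneg_left (by linarith) hK0
      linarith
    calc ((l + K : ℕ) : ℝ) * (C₀ * r ^ s) ≤ ((4 + K) * s ^ 2) * (C₀ * q ^ s) := by gcongr
      _ = _ := by ring
  have e2 : ((2 * s + K : ℕ) : ℝ) * Real.exp (-(κ * m)) ≤
      3 * Real.exp κ * s ^ 2 * q ^ s := by
    have h1 : ((2 * s + K : ℕ) : ℝ) ≤ 3 * s ^ 2 := by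
      push_cast
      linarith
    calc ((2 * s + K : ℕ) : ℝ) * Real.exp (-(κ * m)) ≤
        (3 * s ^ 2) * (Real.exp κ * q ^ s) := by gcongr
      _ = _ := by ring
  calc _ ≤ (4 + K) * C₀ * s ^ 2 * q ^ s + 3 * Real.exp κ * s ^ 2 * q ^ s := add_le_add e1 e2
    _ = _ := by ring

theorem exists_measureReal_not_fast_le {c : ℝ} (hc : 0 < c) (h0 : ρ absent < 1)
    (hgain : ENNReal.ofReal c < ∑' k : ℕ, ∫⁻ x, {x | IsNext (scPts x) 0 (k + 1 : ℕ)}.indicator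
      (fun x => minW x 0 (k + 1 : ℕ)) x ∂law ρ) :
    ∃ (C q : ℝ) (s₀ : ℕ), 0 ≤ C ∧ 0 ≤ q ∧ q < 1 ∧ 1 ≤ s₀ ∧ ∀ l : ℕ, s₀ ≤ l.sqrt →
      (law ρ).real {x | ¬ Fast c x 0 l} ≤ C * (l.sqrt : ℝ) ^ 2 * q ^ l.sqrt := by
  obtain ⟨K, hK⟩ := exists_lt_lintegral_gain ρ hgain
  have hKpos : 0 < K := by
    rcases Nat.eq_zero_or_pos K with rfl | hK'
    · simp [gain] at hK
    · exact hK'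
  obtain ⟨b, hb1, hb2⟩ := exists_between hK
  have hbtop : b ≠ ∞ := hb2.ne_top
  have hcb : c < b.toReal := (ENNReal.ofReal_lt_iff_lt_toReal hc.le hbtop).1 hb1
  -- The margin between `c` and the mean gain is halved: one half absorbs the boundary loss, since
  -- `a = c + ε`, and the other the fluctuations, since `a + ε` is `b`.
  set ε := (b.toReal - c) / 2 with hε
  have hεpos : 0 < ε := by rw [hε]; linarith
  set a := c + ε with ha
  obtain ⟨s₁, hs₁⟩ := eventually_atTop.1 ((tendsto_lintegral_gain ρ K).eventually_const_lt hb2)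
  obtain ⟨C₀, hC₀, hbad⟩ := measureReal_exists_locPts_diff_le ρ h0
  set r := (ρ absent).toReal with hr
  have hr0 : 0 ≤ r := ENNReal.toReal_nonneg
  have hr1 : r < 1 := by
    rw [hr, ← ENNReal.toReal_one]
    exact (ENNReal.toReal_lt_toReal h0.ne_top ENNReal.one_ne_top).2 h0
  set κ := 2 * ε ^ 2 / (K * K : ℝ) ^ 2 with hκ
  have hκpos : 0 < κ := by positivity
  set q := max r (Real.exp (-(κ / 3))) with hq
  have hq0 : 0 ≤ q := le_max_of_le_left hr0
  have hq1 : q < 1 := max_lt hr1 (Real.exp_lt_one_iff.2 (by linarith))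
  -- From here on the boundary loss `a * (2 * s + K) + K * K` is at most `ε * s * s`, hence at most
  -- `ε * l`.
  obtain ⟨s₂, hs₂⟩ := exists_nat_ge ((a * (2 + K) + K * K) / ε)
  refine ⟨(4 + K) * C₀ + 3 * Real.exp κ, q, max (max s₁ s₂) (max 1 K), by positivity, hq0, hq1,
    le_max_of_le_right (le_max_left _ _), fun l hl => ?_⟩
  set s := l.sqrt with hs
  have hsK : K ≤ s := (le_max_right 1 K).trans ((le_max_right _ _).trans hl)
  have hs1 : 1 ≤ s := (le_max_left 1 K).trans ((le_max_right _ _).trans hl)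
  have hss₁ : s₁ ≤ s := (le_max_left s₁ s₂).trans ((le_max_left _ _).trans hl)
  have hss₂ : s₂ ≤ s := (le_max_right s₁ s₂).trans ((le_max_left _ _).trans hl)
  have hsl : s * s ≤ l := Nat.sqrt_le l
  have hls : l ≤ s * s + s + s := Nat.sqrt_le_add l
  have hslR : (s : ℝ) * s ≤ l := by exact_mod_cast hsl
  have hlsR : (l : ℝ) ≤ s * s + s + s := by exact_mod_cast hls
  have hs1R : (1 : ℝ) ≤ s := by exact_mod_cast hs1
  have hsKR : (K : ℝ) ≤ s := by exact_mod_cast hsK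
  have hmean : a + ε ≤ (∫⁻ x, gain K (locPts s x) x 0 ∂law ρ).toReal := by
    have h1 := hs₁ s hss₁
    have h2 : (∫⁻ x, gain K (locPts s x) x 0 ∂law ρ) ≠ ∞ := by
      refine ne_top_of_le_ne_top (b := (K * K : ℝ≥0∞)) (by finiteness) ?_
      refine (lintegral_mono fun x => gain_le K _ x 0).trans ?_
      simp
    have h3 := ENNReal.toReal_mono h2 h1.le
    have h4 : a + ε = b.toReal := by rw [ha, hε]; ring
    rw [h4]
    exact h3
  have hineq : c * l + K * K ≤ a * ((l : ℝ) - (2 * s + K : ℕ)) := by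
    have h1 : a * (2 + K) + K * K ≤ ε * s := by
      rw [div_le_iff₀ hεpos] at hs₂
      have : (s₂ : ℝ) ≤ s := by exact_mod_cast hss₂
      nlinarith
    have ha0 : 0 ≤ a := by rw [ha]; linarith
    have h2 : a * (2 * s + K) + K * K ≤ (a * (2 + K) + K * K) * s := by
      nlinarith [mul_nonneg ha0 (Nat.cast_nonneg (α := ℝ) K),
        mul_nonneg (mul_nonneg ha0 (Nat.cast_nonneg (α := ℝ) K)) (sub_nonneg.2 hs1R),
        mul_nonneg (mul_nonneg (Nat.cast_nonneg (α := ℝ) K) (Nat.cast_nonneg (α := ℝ) K))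
          (sub_nonneg.2 hs1R)]
    have h3 : (a * (2 + K) + K * K) * s ≤ ε * s * s :=
      mul_le_mul_of_nonneg_right h1 (by linarith)
    have h4 : ε * s * s ≤ ε * l := by nlinarith
    push_cast
    rw [mul_sub, ha, add_mul]
    rw [ha] at h2 h3
    linarith
  have hsub : {x | ¬ Fast c x 0 l} ⊆
      {x | ∃ z ∈ Finset.range (l + K), (z : ℤ) ∈ locPts s x ∧ (z : ℤ) ∉ scPts x} ∪
        lowGain K s (l / (2 * s + K)) a := by
    intro x hx
    by_contra hcon
    rw [mem_union, not_or] at hcon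
    exact hx (fast_of_notMem hc (by rw [ha]; linarith) (by nlinarith) (by omega) hcon.1 hcon.2 hineq)
  refine (measureReal_mono hsub).trans ((measureReal_union_le _ _).trans ?_)
  refine (add_le_add (hbad s (l + K)) (measureReal_lowGain_le ρ K s _ hεpos.le hmean)).trans ?_
  exact tail_numeric hsK hs1 hslR hlsR hκpos.le hC₀ hr0

/-- The probabilities that the last passage weight is below `c l` have finite second moment. -/
theorem tsum_sq_measure_not_fast_ne_top {c : ℝ} (hc : 0 < c) (h0 : ρ absent < 1)
    (hgain : ENNReal.ofReal c < ∑' k : ℕ, ∫⁻ x, {x | IsNext (scPts x) 0 (k + 1 : ℕ)}.indicator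
      (fun x => minW x 0 (k + 1 : ℕ)) x ∂law ρ) :
    ∑' l : ℕ, (l : ℝ≥0∞) ^ 2 * law ρ {x | ¬ Fast c x 0 l} ≠ ∞ := by
  obtain ⟨C, q, s₀, hC, hq0, hq1, hs₀, hbound⟩ := exists_measureReal_not_fast_le ρ hc h0 hgain
  have hsum : Summable fun l : ℕ => (l : ℝ) ^ 2 * (law ρ).real {x | ¬ Fast c x 0 l} := by
    -- The exponent collects `s ^ 4` from `l ^ 2`, `s ^ 2` from the tail bound, and `s ^ 4` from the
    -- factor `(l + 1) ^ 2` needed for comparison with a summable series.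
    obtain ⟨B, hB⟩ := (tendsto_pow_const_mul_const_pow_of_abs_lt_one 10
      (abs_lt.2 ⟨by linarith, hq1⟩)).bddAbove_range
    have hB' : ∀ s : ℕ, (s : ℝ) ^ 10 * q ^ s ≤ B := fun s => hB ⟨s, rfl⟩
    have hs : Summable fun l : ℕ => (144 * C * B) * (1 / ((l : ℝ) + 1) ^ 2) := by
      refine Summable.mul_left _ ?_
      have := (summable_nat_add_iff 1).2 (Real.summable_one_div_nat_pow.2 one_lt_two)
      simpa using this
    refine Summable.of_norm_bounded_eventually_nat hs ?_
    filter_upwards [eventually_ge_atTop (s₀ * s₀)] with l hl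
    have hsl : s₀ ≤ l.sqrt := Nat.le_sqrt.2 hl
    have h1 := hbound l hsl
    set s := l.sqrt
    have hlsR : (l : ℝ) ≤ s * s + s + s := by exact_mod_cast Nat.sqrt_le_add l
    have hs1R : (1 : ℝ) ≤ s := by exact_mod_cast hs₀.trans hsl
    rw [Real.norm_of_nonneg (by positivity), mul_one_div, le_div_iff₀ (by positivity)]
    have h2 : (l : ℝ) ≤ 3 * s ^ 2 := by nlinarith
    have h3 : ((l : ℝ) + 1) ^ 2 ≤ 16 * s ^ 4 := by
      have : (l : ℝ) + 1 ≤ 4 * s ^ 2 := by nlinarith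
      calc ((l : ℝ) + 1) ^ 2 ≤ (4 * s ^ 2) ^ 2 := by gcongr
        _ = _ := by ring
    calc (l : ℝ) ^ 2 * (law ρ).real {x | ¬ Fast c x 0 l} * ((l : ℝ) + 1) ^ 2
        ≤ (3 * s ^ 2) ^ 2 * (C * (s : ℝ) ^ 2 * q ^ s) * (16 * s ^ 4) := by gcongr
      _ = 144 * C * ((s : ℝ) ^ 10 * q ^ s) := by ring
      _ ≤ 144 * C * B := by gcongr; exact hB' s
  have := hsum.tsum_ofReal_ne_top
  convert this using 3 with l
  rw [ENNReal.ofReal_mul (by positivity), ENNReal.ofReal_pow (by positivity),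
    ENNReal.ofReal_natCast, ofReal_measureReal]

end Tail

end OrderedGraph

namespace OrderedGraph

open scoped NNReal
open Set Filter Topology

/-! ### Heavy edges -/

/-- The marks that make an edge of length `k` heavy. -/
def heavySet (c : ℝ) (k : ℕ) : Set (ℝ≥0 × Bool) := {a | a.2 = true ∧ c * k ≤ a.1}

theorem measurableSet_heavySet (c : ℝ) (k : ℕ) : MeasurableSet (heavySet c k) :=
  (measurable_snd (measurableSet_singleton true)).inter
    (measurableSet_le measurable_const measurable_fst.coe_nnreal_real)

theorem heavySet_antitone {c : ℝ} (hc : 0 ≤ c) {k l : ℕ} (h : k ≤ l) :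
    heavySet c l ⊆ heavySet c k := fun a ha => ⟨ha.1, le_trans (by gcongr) ha.2⟩

theorem heavy_iff {c : ℝ} {x : Config} {i j : ℤ} (h : i < j) :
    Heavy c x i j ↔ x ⟨(i, j), h⟩ ∈ heavySet c (j - i).toNat := by
  have h1 : (((j - i).toNat : ℕ) : ℝ) = (j : ℝ) - i := by
    rw [← Int.cast_natCast, Int.toNat_of_nonneg (by omega)]; push_cast; ring
  simp [Heavy, ed, wt, heavySet, h, h1]

/-- Some heavy edge of length more than `ℓ` has an endpoint less than `n` and one more than `0`. -/
def hitSet (c : ℝ) (n ℓ : ℕ) : Set Config :=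
  {x | ∃ i j : ℤ, i < n ∧ 0 < j ∧ ℓ < j - i ∧ Heavy c x i j}

/-- Two distinct such edges exist. -/
def hitTwice (c : ℝ) (n ℓ : ℕ) : Set Config :=
  {x | ∃ i j i' j' : ℤ, (i, j) ≠ (i', j') ∧ (i < n ∧ 0 < j ∧ ℓ < j - i ∧ Heavy c x i j) ∧
    (i' < n ∧ 0 < j' ∧ ℓ < j' - i' ∧ Heavy c x i' j')}

section

variable (ρ : Measure (ℝ≥0 × Bool)) [IsProbabilityMeasure ρ]

theorem law_mem_eq (e : Edge) {T : Set (ℝ≥0 × Bool)} (hT : MeasurableSet T) :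
    law ρ {x | x e ∈ T} = ρ T := by
  have := law_forall_range ρ (g := fun t : ℕ => (⟨(e.1.1, e.1.2 + t), by
    have := e.2; simp only; omega⟩ : Edge)) (fun t t' h => by simpa using h) 1 hT
  simpa using this

theorem law_heavy_le (c : ℝ) (i : ℤ) (k : ℕ) :
    law ρ {x | Heavy c x i (i + k)} ≤ ρ (heavySet c k) := by
  by_cases h : i < i + k
  · have : {x | Heavy c x i (i + k)} = {x | x ⟨(i, i + k), h⟩ ∈ heavySet c k} := by
      ext x
      have := heavy_iff (c := c) (x := x) h
      simpa using this
    rw [this, law_mem_eq ρ _ (measurableSet_heavySet c k)]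
  · have : {x : Config | Heavy c x i (i + k)} = ∅ := by
      ext x
      simp only [mem_ofPred_eq, mem_empty_iff_false, iff_false]
      exact fun hx => h hx.1.1
    rw [this, measure_empty]
    exact zero_le

theorem law_heavy_inter_le (c : ℝ) {i i' : ℤ} {k k' : ℕ} (hne : (i, i + (k : ℤ)) ≠ (i', i' + k')) :
    law ρ ({x | Heavy c x i (i + k)} ∩ {x | Heavy c x i' (i' + k')}) ≤
      ρ (heavySet c k) * ρ (heavySet c k') := by
  rw [measure_inter_of_dependsOn ρ (measurableSet_setOfPred.2 (measurable_heavy _ _ _))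
    (measurableSet_setOfPred.2 (measurable_heavy _ _ _)) (dependsOn_heavy c _ _)
    (dependsOn_heavy c _ _)]
  · exact mul_le_mul' (law_heavy_le ρ c i k) (law_heavy_le ρ c i' k')
  · exact Set.disjoint_left.2 fun e h1 h2 => hne (h1.symm.trans h2)

/-- The expected number of heavy edges of length more than `ℓ` hitting `(0, n)`. -/
noncomputable def hitMean (c : ℝ) (n ℓ : ℕ) : ℝ≥0∞ :=
  ∑' k : ℕ, if ℓ < k then ((n : ℝ≥0∞) + k) * ρ (heavySet c k) else 0

omit [IsProbabilityMeasure ρ] in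
theorem tsum_hit_eq (c : ℝ) (n ℓ : ℕ) :
    ∑' a : ℕ × ℕ, (if ℓ < a.1 ∧ a.2 < n + a.1 then ρ (heavySet c a.1) else 0) =
      hitMean ρ c n ℓ := by
  rw [ENNReal.tsum_prod']
  refine tsum_congr fun k => ?_
  split_ifs with hk
  · rw [tsum_eq_sum (s := Finset.range (n + k)) (fun t ht => if_neg fun h =>
      ht (Finset.mem_range.2 h.2)), Finset.sum_congr rfl (fun t ht =>
      if_pos ⟨hk, Finset.mem_range.1 ht⟩)]
    simp
  · simp [hk]

/-- The index records the length of the pair and the distance of its left end from `n - 1`. Fewer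
than `n + k` positions are possible for length `k`, which explains the weight in `hitMean`. -/
theorem exists_hit_index {n ℓ : ℕ} {i j : ℤ} (hi : i < n) (hj : 0 < j) (hl : ℓ < j - i) :
    ∃ a : ℕ × ℕ, (ℓ < a.1 ∧ a.2 < n + a.1) ∧ i = n - 1 - a.2 ∧ j = n - 1 - a.2 + a.1 :=
  ⟨((j - i).toNat, (n - 1 - i).toNat), ⟨by omega, by simp only; omega⟩, by simp only; omega,
    by simp only; omega⟩

theorem law_hitSet_le (c : ℝ) (n ℓ : ℕ) : law ρ (hitSet c n ℓ) ≤ hitMean ρ c n ℓ := by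
  have hsub : hitSet c n ℓ ⊆ ⋃ a : ℕ × ℕ, {x | (ℓ < a.1 ∧ a.2 < n + a.1) ∧
      Heavy c x (n - 1 - a.2) (n - 1 - a.2 + a.1)} := by
    rintro x ⟨i, j, hi, hj, hl, hx⟩
    obtain ⟨a, ha, rfl, rfl⟩ := exists_hit_index hi hj hl
    exact mem_iUnion.2 ⟨a, ha, hx⟩
  refine (measure_mono hsub).trans ((measure_iUnion_le _).trans ?_)
  rw [← tsum_hit_eq]
  refine ENNReal.tsum_le_tsum fun a => ?_
  split_ifs with ha
  · simp only [ha, true_and]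
    exact law_heavy_le ρ c _ _
  · simp [ha]

/-- Different pairs carry independent marks, so the union bound over ordered pairs of edges is
dominated by the square of the mean number. -/
theorem law_hitTwice_le (c : ℝ) (n ℓ : ℕ) : law ρ (hitTwice c n ℓ) ≤ hitMean ρ c n ℓ ^ 2 := by
  let H : ℕ × ℕ → Set Config := fun a => {x | Heavy c x (n - 1 - a.2) (n - 1 - a.2 + a.1)}
  have hsub : hitTwice c n ℓ ⊆ ⋃ (a : ℕ × ℕ) (b : ℕ × ℕ), {x | ((ℓ < a.1 ∧ a.2 < n + a.1) ∧
      (ℓ < b.1 ∧ b.2 < n + b.1) ∧ a ≠ b) ∧ x ∈ H a ∩ H b} := by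
    rintro x ⟨i, j, i', j', hne, ⟨hi, hj, hl, hx⟩, hi', hj', hl', hx'⟩
    obtain ⟨a, ha, rfl, rfl⟩ := exists_hit_index hi hj hl
    obtain ⟨b, hb, rfl, rfl⟩ := exists_hit_index hi' hj' hl'
    exact mem_iUnion₂.2 ⟨a, b, ⟨ha, hb, fun h => hne (by rw [h])⟩, hx, hx'⟩
  refine (measure_mono hsub).trans ((measure_iUnion_le _).trans ?_)
  rw [← tsum_hit_eq, sq, ← ENNReal.tsum_mul_right]
  refine ENNReal.tsum_le_tsum fun a => (measure_iUnion_le _).trans ?_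
  rw [← ENNReal.tsum_mul_left]
  refine ENNReal.tsum_le_tsum fun b => ?_
  by_cases ha : (ℓ < a.1 ∧ a.2 < n + a.1)
  · by_cases hb : (ℓ < b.1 ∧ b.2 < n + b.1)
    · by_cases hab : a = b
      · simp [hab]
      · rw [if_pos ha, if_pos hb]
        refine (measure_mono fun x hx => hx.2).trans (law_heavy_inter_le ρ c fun h => hab ?_)
        simp only [Prod.mk.injEq] at h
        exact Prod.ext (by omega) (by omega)
    · simp [hb]
  · simp [ha]

/-- The second moment of the lengths of heavy edges. -/
noncomputable def heavyMoment (c : ℝ) : ℝ≥0∞ := ∑' k : ℕ, (k : ℝ≥0∞) ^ 2 * ρ (heavySet c k)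

-- Termwise Markov bound: for `k > ℓ` one has `ℓ ^ 2 * (n + k) ≤ (n + ℓ) * k ^ 2`.
omit [IsProbabilityMeasure ρ] in
theorem sq_mul_hitMean_le (c : ℝ) (n ℓ : ℕ) :
    (ℓ : ℝ≥0∞) ^ 2 * hitMean ρ c n ℓ ≤ (n + ℓ) * heavyMoment ρ c := by
  rw [hitMean, heavyMoment, ← ENNReal.tsum_mul_left, ← ENNReal.tsum_mul_left]
  refine ENNReal.tsum_le_tsum fun k => ?_
  split_ifs with hk
  · rw [← mul_assoc, ← mul_assoc]
    refine mul_le_mul_left ?_ _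
    have : ℓ ^ 2 * (n + k) ≤ (n + ℓ) * k ^ 2 := by
      have h1 : ℓ ^ 2 * n ≤ n * k ^ 2 := by rw [mul_comm]; gcongr
      have h2 : ℓ ^ 2 * k ≤ ℓ * k ^ 2 := by
        calc ℓ ^ 2 * k = ℓ * (ℓ * k) := by ring
          _ ≤ ℓ * (k * k) := by gcongr
          _ = _ := by ring
      linarith
    exact_mod_cast this
  · simp

/-- The probability that no heavy edge crosses the origin is positive. -/
theorem law_cross_pos {c : ℝ} (hc : 0 < c) (h1 : ρ (heavySet c 1) < 1)
    (hH : heavyMoment ρ c ≠ ∞) :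
    0 < law ρ {x | ∀ i j, i < 0 → 0 < j → ¬ Heavy c x i j} := by
  classical
  -- Long heavy edges over the origin have mean number below one for some `ℓ`, so they are all
  -- absent with positive probability. Independently, the finitely many shorter pairs are non-heavy
  -- with positive probability.
  obtain ⟨ℓ, hℓ0, hℓ⟩ : ∃ ℓ : ℕ, 0 < ℓ ∧ hitMean ρ c 0 ℓ < 1 := by
    obtain ⟨ℓ, hℓ⟩ := ENNReal.exists_nat_gt hH
    refine ⟨ℓ + 1, by omega, ?_⟩
    have h2 := sq_mul_hitMean_le ρ c 0 (ℓ + 1)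
    have h3 : ((ℓ + 1 : ℕ) : ℝ≥0∞) ≠ 0 := by simp
    have h4 : ((ℓ + 1 : ℕ) : ℝ≥0∞) ≠ ∞ := by simp
    rw [Nat.cast_zero, zero_add, sq, mul_assoc] at h2
    have h5 := (ENNReal.mul_le_mul_iff_right h3 h4).1 h2
    by_contra hge
    rw [not_lt] at hge
    have : ((ℓ + 1 : ℕ) : ℝ≥0∞) ≤ heavyMoment ρ c :=
      le_trans (by simpa using mul_le_mul_right hge ((ℓ + 1 : ℕ) : ℝ≥0∞)) h5
    have h6 : (ℓ : ℝ≥0∞) ≤ (ℓ + 1 : ℕ) := by exact_mod_cast Nat.le_succ ℓ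
    exact absurd (hℓ.trans_le h6) (not_lt.2 this)
  set A : Set Config := {x | ∀ i j : ℤ, i < 0 → 0 < j → j - i ≤ ℓ → ¬ Heavy c x i j} with hA
  set B : Set Config := {x | ∀ i j : ℤ, i < 0 → 0 < j → ℓ < j - i → ¬ Heavy c x i j} with hB
  have mA : MeasurableSet A := measurableSet_setOfPred.2 (by fun_prop)
  have mB : MeasurableSet B := measurableSet_setOfPred.2 (by fun_prop)
  have dA : DependsOn (· ∈ A) {e : Edge | e.1.2 - e.1.1 ≤ ℓ} :=
    dependsOn_forall fun i => dependsOn_forall fun j => dependsOn_imp fun _ => dependsOn_imp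
      fun _ => dependsOn_imp fun h => dependsOn_not ((dependsOn_heavy c i j).mono
        fun e (he : e.1 = (i, j)) => by simp only [mem_ofPred_eq, he]; exact h)
  have dB : DependsOn (· ∈ B) {e : Edge | ℓ < e.1.2 - e.1.1} :=
    dependsOn_forall fun i => dependsOn_forall fun j => dependsOn_imp fun _ => dependsOn_imp
      fun _ => dependsOn_imp fun h => dependsOn_not ((dependsOn_heavy c i j).mono
        fun e (he : e.1 = (i, j)) => by simp only [mem_ofPred_eq, he]; exact h)
  have hAB : {x : Config | ∀ i j, i < 0 → 0 < j → ¬ Heavy c x i j} = A ∩ B := by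
    ext x
    refine ⟨fun h => ⟨fun i j hi hj _ => h i j hi hj, fun i j hi hj _ => h i j hi hj⟩,
      fun h i j hi hj => ?_⟩
    rcases le_or_gt (j - i) ℓ with hl | hl
    · exact h.1 i j hi hj hl
    · exact h.2 i j hi hj hl
  rw [hAB, measure_inter_of_dependsOn ρ mA mB dA dB
    (Set.disjoint_left.2 fun e (h1 : e.1.2 - e.1.1 ≤ (ℓ : ℤ)) (h2 : (ℓ : ℤ) < e.1.2 - e.1.1) => by omega)]
  refine ENNReal.mul_pos (ne_of_gt ?_) (ne_of_gt ?_)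
  -- Pairs over the origin of length at most `ℓ` have both ends in this box, and a heavy edge of any
  -- positive length carries a mark that is heavy for length one.
  · let F : Finset Edge := ((Finset.Icc (-(ℓ : ℤ)) ℓ) ×ˢ (Finset.Icc (-(ℓ : ℤ)) ℓ)).subtype
      (fun e : ℤ × ℤ => e.1 < e.2)
    have hsub : Set.pi F (fun _ => (heavySet c 1)ᶜ) ⊆ A := by
      intro x hx i j hi hj hl hH
      have hij : i < j := hi.trans hj
      refine hx ⟨(i, j), hij⟩ ?_ (heavySet_antitone hc.le ?_ ((heavy_iff hij).1 hH))
      · refine Finset.mem_coe.2 (Finset.mem_subtype.2 (Finset.mem_product.2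
          ⟨Finset.mem_Icc.2 ⟨?_, ?_⟩, Finset.mem_Icc.2 ⟨?_, ?_⟩⟩)) <;> simp only <;> omega
      · omega
    refine lt_of_lt_of_le ?_ (measure_mono hsub)
    rw [Measure.infinitePi_pi _ fun _ _ => (measurableSet_heavySet c 1).compl, Finset.prod_const]
    refine ENNReal.pow_pos ?_ _
    rw [prob_compl_eq_one_sub (measurableSet_heavySet c 1)]
    exact tsub_pos_of_lt h1
  · have hsub : Bᶜ ⊆ hitSet c 0 ℓ := by
      intro x hx
      simp only [hB, mem_compl_iff, mem_ofPred_eq] at hx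
      push Not at hx
      obtain ⟨i, j, hi, hj, hl, hx⟩ := hx
      exact ⟨i, j, by simpa using hi, hj, hl, hx⟩
    have h2 : law ρ Bᶜ < 1 := (measure_mono hsub).trans_lt ((law_hitSet_le ρ c 0 ℓ).trans_lt hℓ)
    rw [prob_compl_eq_one_sub mB] at h2
    by_contra h0
    rw [not_lt, nonpos_iff_eq_zero] at h0
    simp [h0] at h2

/-! ### Positive probability of renewal at a given point -/

/-- The second moment of the lengths of slow passages. -/
noncomputable def slowMoment (c : ℝ) : ℝ≥0∞ :=
  ∑' l : ℕ, (l : ℝ≥0∞) ^ 2 * law ρ {x | ¬ Fast c x 0 l}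

theorem law_not_fast (c : ℝ) (z : ℤ) (l : ℕ) :
    law ρ {x | ¬ Fast c x z (z + l)} = law ρ {x | ¬ Fast c x 0 l} := by
  rw [← (measurePreserving_shift ρ z).measure_preimage
    (measurableSet_setOfPred.2 (measurable_fast c 0 l).not).nullMeasurableSet]
  congr 1
  ext x
  simp [fast_shift, add_comm]

omit [IsProbabilityMeasure ρ] in
theorem sq_mul_law_exists_le {E : ℕ → Set Config} {c : ℝ}
    (hE : ∀ l, law ρ (E l) = law ρ {x | ¬ Fast c x 0 l}) (ℓ : ℕ) :
    (ℓ : ℝ≥0∞) ^ 2 * law ρ {x | ∃ l, ℓ ≤ l ∧ x ∈ E l} ≤ slowMoment ρ c := by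
  have hsub : {x | ∃ l, ℓ ≤ l ∧ x ∈ E l} ⊆ ⋃ l : ℕ, {x | ℓ ≤ l ∧ x ∈ E l} := by
    rintro x ⟨l, hl⟩
    exact mem_iUnion.2 ⟨l, hl⟩
  refine (mul_le_mul_right ((measure_mono hsub).trans (measure_iUnion_le _)) _).trans ?_
  rw [← ENNReal.tsum_mul_left]
  refine ENNReal.tsum_le_tsum fun l => ?_
  by_cases hl : ℓ ≤ l
  · simp only [hl, true_and, ofPred_mem_eq, hE]
    gcongr
  · simp [hl]

theorem sq_mul_law_slow_right_le (c : ℝ) (z : ℤ) (ℓ : ℕ) :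
    (ℓ : ℝ≥0∞) ^ 2 * law ρ {x | ∃ l : ℕ, ℓ ≤ l ∧ ¬ Fast c x z (z + l)} ≤ slowMoment ρ c :=
  sq_mul_law_exists_le ρ (E := fun l => {x | ¬ Fast c x z (z + l)}) (law_not_fast ρ c z) ℓ

theorem sq_mul_law_slow_left_le (c : ℝ) (z : ℤ) (ℓ : ℕ) :
    (ℓ : ℝ≥0∞) ^ 2 * law ρ {x | ∃ l : ℕ, ℓ ≤ l ∧ ¬ Fast c x (z - l) z} ≤ slowMoment ρ c :=
  sq_mul_law_exists_le ρ (E := fun l => {x | ¬ Fast c x (z - l) z}) (fun l => by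
    rw [← law_not_fast ρ c (z - l) l]; simp) ℓ

/-- Every edge of the path `a, a + 1, …, a + M` is present with weight at least `b`. -/
def stepsFast (b : ℝ) (a : ℤ) (M : ℕ) : Set Config :=
  {x | ∀ i < M, x ⟨(a + (i : ℕ), a + (i : ℕ) + 1), by simp only; omega⟩ ∈
    {m : ℝ≥0 × Bool | m.2 = true ∧ b ≤ m.1}}

theorem measurableSet_fastMark (b : ℝ) :
    MeasurableSet {m : ℝ≥0 × Bool | m.2 = true ∧ b ≤ m.1} :=
  (measurable_snd (measurableSet_singleton true)).inter
    (measurableSet_le measurable_const measurable_fst.coe_nnreal_real)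

theorem law_stepsFast (b : ℝ) (a : ℤ) (M : ℕ) :
    law ρ (stepsFast b a M) = ρ {m | m.2 = true ∧ b ≤ m.1} ^ M :=
  law_forall_range ρ (g := fun i : ℕ => (⟨(a + i, a + i + 1), by simp only; omega⟩ : Edge))
    (fun i j h => by simp at h; exact h) M (measurableSet_fastMark b)

theorem measurableSet_stepsFast (b : ℝ) (a : ℤ) (M : ℕ) : MeasurableSet (stepsFast b a M) := by
  have : stepsFast b a M = ⋂ i : ℕ, ⋂ _ : i < M, {x | x ⟨(a + (i : ℕ), a + (i : ℕ) + 1), by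
      simp only; omega⟩ ∈ {m : ℝ≥0 × Bool | m.2 = true ∧ b ≤ m.1}} := by
    ext x; simp [stepsFast]
  rw [this]
  exact MeasurableSet.iInter fun i => MeasurableSet.iInter fun _ =>
    (measurable_pi_apply _) (measurableSet_fastMark b)

theorem dependsOn_stepsFast (b : ℝ) (a : ℤ) (M : ℕ) :
    DependsOn (· ∈ stepsFast b a M) (within a (a + M)) :=
  dependsOn_forall fun i => dependsOn_imp fun hi => fun x y h => by
    rw [h _ ⟨by simp, by simp only; omega⟩]

theorem fast_of_stepsFast {b : ℝ} {a : ℤ} {M : ℕ} {x : Config} (h : x ∈ stepsFast b a M)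
    {i j : ℕ} (hij : i ≤ j) (hj : j ≤ M) : Fast b x (a + i) (a + j) := by
  induction j, hij using Nat.le_induction with
  | base => exact fast_self _ _ _
  | succ j hij ih =>
    refine fast_trans (ih (by omega)) ?_
    have h1 := h j (by omega)
    have hed : ed x (a + j) (a + j + 1) := ⟨by omega, h1.1⟩
    have h2 := wt_le_lp hed
    have h3 : b ≤ wt x (a + j) (a + j + 1) := by simpa [wt] using h1.2
    have : Fast b x (a + j) (a + j + 1) := by
      refine le_trans (EReal.coe_le_coe_iff.2 ?_) h2
      push_cast
      linarith
    simpa [add_assoc] using this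

theorem fast_mono {b c : ℝ} (h : c ≤ b) {x : Config} {i j : ℤ} (hij : i ≤ j) (hf : Fast b x i j) :
    Fast c x i j := by
  refine le_trans (EReal.coe_le_coe_iff.2 ?_) hf
  have : (0 : ℝ) ≤ j - i := by rw [sub_nonneg]; exact_mod_cast hij
  exact mul_le_mul_of_nonneg_right h this

theorem exists_nat_law_lt {c : ℝ} (hT : slowMoment ρ c ≠ ∞) {δ : ℝ≥0∞} (hδ : 0 < δ) :
    ∃ ℓ : ℕ, ∀ A : Set Config, (ℓ : ℝ≥0∞) ^ 2 * law ρ A ≤ slowMoment ρ c → law ρ A < δ := by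
  obtain ⟨ℓ, hℓ⟩ := ENNReal.exists_nat_gt (ENNReal.div_ne_top hT hδ.ne')
  refine ⟨ℓ + 1, fun A hA => ?_⟩
  by_contra hge
  rw [not_lt] at hge
  by_cases hδt : δ = ∞
  · rw [hδt, top_le_iff] at hge
    exact measure_ne_top _ _ hge
  have h1 : ((ℓ + 1 : ℕ) : ℝ≥0∞) ≤ ((ℓ + 1 : ℕ) : ℝ≥0∞) ^ 2 := by
    exact_mod_cast Nat.le_self_pow two_ne_zero _
  have h2 : (ℓ : ℝ≥0∞) * δ ≤ slowMoment ρ c := by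
    refine le_trans ?_ hA
    refine mul_le_mul' (le_trans ?_ h1) hge
    exact_mod_cast Nat.le_succ ℓ
  rw [ENNReal.div_lt_iff (Or.inl hδ.ne') (Or.inl hδt)] at hℓ
  exact absurd hℓ (not_lt.2 h2)

/-- The first `M` unit steps are made to have weight at least `b > c`, building a surplus that pays
for the next `ℓ` integers, where only connectivity is required. Beyond distance `ℓ` from `M`,
slowness is less likely than the density of strongly connected points, so connectivity and speed
hold together with positive probability. The two requirements use disjoint edges. -/
theorem law_right_pos {c b : ℝ} (hc : 0 < c) (hcb : c < b)
    (hb : 0 < ρ {m : ℝ≥0 × Bool | m.2 = true ∧ b ≤ m.1}) (hT : slowMoment ρ c ≠ ∞)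
    (hγ : 0 < law ρ {x | 0 ∈ scPts x}) : 0 < law ρ {x | ∀ y, 0 < y → Fast c x 0 y} := by
  obtain ⟨ℓ, hℓ⟩ := exists_nat_law_lt ρ hT hγ
  -- The surplus `(b - c) * M` covers `c * ℓ`.
  obtain ⟨M, hM⟩ := exists_nat_ge (c * ℓ / (b - c))
  rw [div_le_iff₀ (by linarith)] at hM
  set F : Set Config := {x | (∀ y : ℤ, M < y → Fast 0 x M y) ∧ ∀ l : ℕ, ℓ ≤ l → Fast c x M (M + l)}
  have mF : MeasurableSet F := measurableSet_setOfPred.2 (by fun_prop)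
  have dF : DependsOn (· ∈ F) (rightOf (M : ℤ)) := dependsOn_and
    (dependsOn_forall fun y => dependsOn_imp fun _ => (dependsOn_fast 0 M y).mono fun e he => he.1)
    (dependsOn_forall fun l => dependsOn_imp fun _ => (dependsOn_fast c M _).mono fun e he => he.1)
  have hF : 0 < law ρ F := by
    have h1 := hℓ _ (sq_mul_law_slow_right_le ρ c M ℓ)
    rw [← regenKernel_sc.measure_mem_pts ρ M] at h1
    have h2 := tsub_pos_of_lt h1
    refine h2.trans_le (le_measure_sdiff.trans (measure_mono fun x hx => ?_))
    refine ⟨hx.1.2.2, fun l hl => ?_⟩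
    by_contra hcon
    exact hx.2 ⟨l, hl, hcon⟩
  have hsub : stepsFast b 0 M ∩ F ⊆ {x | ∀ y, 0 < y → Fast c x 0 y} := by
    rintro x ⟨hs, hF1, hF2⟩ y hy
    have h0M : Fast b x 0 M := by simpa using fast_of_stepsFast hs (Nat.zero_le M) le_rfl
    rcases le_or_gt y M with hyM | hyM
    · have := fast_of_stepsFast hs (Nat.zero_le y.toNat) (by omega : y.toNat ≤ M)
      rw [show (0 : ℤ) + (y.toNat : ℕ) = y by omega] at this
      simpa using fast_mono hcb.le (by omega) this
    · obtain ⟨l, rfl⟩ : ∃ l : ℕ, y = M + l := ⟨(y - M).toNat, by omega⟩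
      rcases le_or_gt ℓ l with hl | hl
      · exact fast_trans (fast_mono hcb.le (by omega) h0M) (hF2 l hl)
      · refine le_trans ?_ (lastPassage_add_le 0 (M : ℤ) (M + l))
        refine le_trans ?_ (add_le_add h0M (fast_zero_lp.1 (hF1 _ hyM)))
        rw [add_zero, EReal.coe_le_coe_iff]
        push_cast
        have : (l : ℝ) ≤ ℓ := by exact_mod_cast hl.le
        nlinarith
  refine lt_of_lt_of_le ?_ (measure_mono hsub)
  rw [measure_inter_of_dependsOn ρ (measurableSet_stepsFast b 0 M) mF
    ((dependsOn_stepsFast b 0 M).mono fun e he => show e.1.2 ≤ (M : ℤ) by simpa using he.2) dF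
    (disjoint_left_right _), law_stepsFast]
  exact ENNReal.mul_pos (ENNReal.pow_pos hb M).ne' hF.ne'

theorem law_left_pos {c b : ℝ} (hc : 0 < c) (hcb : c < b)
    (hb : 0 < ρ {m : ℝ≥0 × Bool | m.2 = true ∧ b ≤ m.1}) (hT : slowMoment ρ c ≠ ∞)
    (hγ : 0 < law ρ {x | 0 ∈ scPts x}) : 0 < law ρ {x | ∀ y, y < 0 → Fast c x y 0} := by
  obtain ⟨ℓ, hℓ⟩ := exists_nat_law_lt ρ hT hγ
  obtain ⟨M, hM⟩ := exists_nat_ge (c * ℓ / (b - c))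
  rw [div_le_iff₀ (by linarith)] at hM
  set F : Set Config := {x | (∀ y : ℤ, y < -M → Fast 0 x y (-M)) ∧
    ∀ l : ℕ, ℓ ≤ l → Fast c x (-M - l) (-M)}
  have mF : MeasurableSet F := measurableSet_setOfPred.2 (by fun_prop)
  have dF : DependsOn (· ∈ F) (leftOf (-M : ℤ)) := dependsOn_and
    (dependsOn_forall fun y => dependsOn_imp fun _ => (dependsOn_fast 0 y _).mono fun e he => he.2)
    (dependsOn_forall fun l => dependsOn_imp fun _ => (dependsOn_fast c _ _).mono fun e he => he.2)
  have hF : 0 < law ρ F := by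
    have h1 := hℓ _ (sq_mul_law_slow_left_le ρ c (-M) ℓ)
    rw [← regenKernel_sc.measure_mem_pts ρ (-M)] at h1
    have h2 := tsub_pos_of_lt h1
    refine h2.trans_le (le_measure_sdiff.trans (measure_mono fun x hx => ?_))
    refine ⟨hx.1.1, fun l hl => ?_⟩
    by_contra hcon
    exact hx.2 ⟨l, hl, hcon⟩
  have hsub : F ∩ stepsFast b (-M) M ⊆ {x | ∀ y, y < 0 → Fast c x y 0} := by
    rintro x ⟨⟨hF1, hF2⟩, hs⟩ y hy
    have h0M : Fast b x (-M) 0 := by simpa using fast_of_stepsFast hs (Nat.zero_le M) le_rfl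
    rcases le_or_gt (-(M : ℤ)) y with hyM | hyM
    · have := fast_of_stepsFast hs (by omega : (y + M).toNat ≤ M) le_rfl
      rw [show -(M : ℤ) + ((y + M).toNat : ℕ) = y by omega, neg_add_cancel] at this
      exact fast_mono hcb.le (by omega) this
    · obtain ⟨l, rfl⟩ : ∃ l : ℕ, y = -M - l := ⟨(-M - y).toNat, by omega⟩
      rcases le_or_gt ℓ l with hl | hl
      · exact fast_trans (hF2 l hl) (fast_mono hcb.le (by omega) h0M)
      · refine le_trans ?_ (lastPassage_add_le _ (-M : ℤ) 0)
        refine le_trans ?_ (add_le_add (fast_zero_lp.1 (hF1 _ hyM)) h0M)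
        rw [zero_add, EReal.coe_le_coe_iff]
        push_cast
        have : (l : ℝ) ≤ ℓ := by exact_mod_cast hl.le
        nlinarith
  refine lt_of_lt_of_le ?_ (measure_mono hsub)
  rw [measure_inter_of_dependsOn ρ mF (measurableSet_stepsFast b (-M) M) dF
    ((dependsOn_stepsFast b (-M) M).mono fun e he => he.1)
    (disjoint_left_right _), law_stepsFast]
  exact ENNReal.mul_pos hF.ne' (ENNReal.pow_pos hb M).ne'

/-- Renewal at a given point has positive probability. -/
theorem law_zero_mem_rnPts_pos {c b : ℝ} (hc : 0 < c) (hcb : c < b)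
    (hb : 0 < ρ {m : ℝ≥0 × Bool | m.2 = true ∧ b ≤ m.1}) (hT : slowMoment ρ c ≠ ∞)
    (hγ : 0 < law ρ {x | 0 ∈ scPts x}) (h1 : ρ (heavySet c 1) < 1)
    (hH : heavyMoment ρ c ≠ ∞) : 0 < law ρ {x | 0 ∈ rnPts c x} := by
  have k := regenKernel_rn c
  have hL := law_left_pos ρ hc hcb hb hT hγ
  have hC := law_cross_pos ρ hc h1 hH
  have hR := law_right_pos ρ hc hcb hb hT hγ
  -- The left, crossing and right conditions depend on disjoint sets of edges, so the probability is
  -- a product.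
  have e : {x | 0 ∈ rnPts c x} = {x | ∀ y, y < 0 → Fast c x y 0} ∩
      ({x | ∀ i j, i < 0 → 0 < j → ¬ Heavy c x i j} ∩ {x | ∀ y, 0 < y → Fast c x 0 y}) := rfl
  have mL := measurableSet_setOfPred.2 (k.measurable_left 0)
  have mC := measurableSet_setOfPred.2 (k.measurable_cross 0)
  have mR := measurableSet_setOfPred.2 (k.measurable_right 0)
  rw [e, measure_inter_of_dependsOn ρ mL (mC.inter mR) (k.dependsOn_left 0)
    (dependsOn_and ((k.dependsOn_cross 0).mono (disjoint_left_crossing 0).subset_compl_left)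
      ((k.dependsOn_right 0).mono (disjoint_left_right 0).subset_compl_left)) disjoint_compl_right,
    measure_inter_of_dependsOn ρ mC mR (k.dependsOn_cross 0) (k.dependsOn_right 0)
      (disjoint_crossing_right 0)]
  exact ENNReal.mul_pos hL.ne' (ENNReal.mul_pos hC.ne' hR.ne').ne'

end

end OrderedGraph

namespace OrderedGraph

open scoped NNReal
open Set Filter Topology

/-! ### Local renewal points -/

/-- The points that satisfy the conditions of a renewal point for pairs within distance `ℓ`. -/
def locRn (c : ℝ) (ℓ : ℕ) (z : ℤ) (x : Config) : Prop :=
  (∀ y, z < y → y ≤ z + ℓ → Fast c x z y) ∧ (∀ y, z - ℓ ≤ y → y < z → Fast c x y z) ∧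
    ∀ i j, z - ℓ ≤ i → i < z → z < j → j ≤ z + ℓ → ¬ Heavy c x i j

theorem measurable_locRn (c : ℝ) (ℓ : ℕ) (z : ℤ) : Measurable (locRn c ℓ z) := by
  unfold locRn; fun_prop

theorem dependsOn_locRn (c : ℝ) (ℓ : ℕ) (z : ℤ) :
    DependsOn (locRn c ℓ z) (within (z - ℓ) (z + ℓ)) := by
  refine dependsOn_and ?_ (dependsOn_and ?_ ?_)
  · exact dependsOn_forall fun y => dependsOn_imp fun h1 => dependsOn_imp fun h2 =>
      (dependsOn_fast c z y).mono fun e he => ⟨by have := he.1; omega, he.2.trans h2⟩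
  · exact dependsOn_forall fun y => dependsOn_imp fun h1 => dependsOn_imp fun h2 =>
      (dependsOn_fast c y z).mono fun e he => ⟨h1.trans he.1, by have := he.2; omega⟩
  · exact dependsOn_forall fun i => dependsOn_forall fun j => dependsOn_imp fun h1 =>
      dependsOn_imp fun _ => dependsOn_imp fun _ => dependsOn_imp fun h2 => dependsOn_not
        ((dependsOn_heavy c i j).mono fun e (he : e.1 = (i, j)) => by
          simp only [within, mem_ofPred_eq, he]; exact ⟨h1, h2⟩)

theorem locRn_of_mem_rnPts {c : ℝ} (ℓ : ℕ) {z : ℤ} {x : Config} (h : z ∈ rnPts c x) :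
    locRn c ℓ z x :=
  ⟨fun y h1 _ => h.2.2 y h1, fun y _ h1 => h.1 y h1, fun i j _ h1 h2 _ => h.2.1 i j h1 h2⟩

/-- A long passage from or to `z` is slow. -/
def slowAt (c : ℝ) (ℓ : ℕ) (z : ℤ) : Set Config :=
  {x | ∃ l : ℕ, ℓ ≤ l ∧ ¬ Fast c x z (z + l)} ∪ {x | ∃ l : ℕ, ℓ ≤ l ∧ ¬ Fast c x (z - l) z}

/-- With long passages fast, the only remaining obstruction is a heavy edge over `z` that leaves the
window of radius `ℓ`, and such an edge is longer than `ℓ`. -/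
theorem exists_heavy_of_locRn {c : ℝ} {ℓ : ℕ} {z : ℤ} {x : Config} (h : locRn c ℓ z x)
    (hs : x ∉ slowAt c ℓ z) (hz : z ∉ rnPts c x) :
    ∃ i j, i < z ∧ z < j ∧ ℓ < j - i ∧ Heavy c x i j := by
  by_contra hcon
  push Not at hcon
  simp only [slowAt, mem_union, mem_ofPred_eq, not_or, not_exists, not_and, not_not] at hs
  refine hz ⟨fun y hy => ?_, fun i j hi hj hH => ?_, fun y hy => ?_⟩
  · rcases le_or_gt (z - ℓ) y with hl | hl
    · exact h.2.1 y hl hy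
    · have := hs.2 (z - y).toNat (by omega)
      rwa [show z - ((z - y).toNat : ℤ) = y by omega] at this
  · by_cases hw : z - ℓ ≤ i ∧ j ≤ z + ℓ
    · exact h.2.2 i j hw.1 hi hj hw.2 hH
    · exact hcon i j hi hj (by omega) hH
  · rcases le_or_gt y (z + ℓ) with hl | hl
    · exact h.1 y hy hl
    · have := hs.1 (y - z).toNat (by omega)
      rwa [show z + ((y - z).toNat : ℤ) = y by omega] at this

/-- The centre of the `i`-th block of radius `ℓ` to the right of `a`. -/
def centre (a : ℤ) (ℓ i : ℕ) : ℤ := a + (2 * i + 1) * ℓ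

/-- No centre of the first `N` blocks is a local renewal point. -/
def noLocal (c : ℝ) (a : ℤ) (ℓ N : ℕ) : Set Config := {x | ∀ i < N, ¬ locRn c ℓ (centre a ℓ i) x}

/-- There is no renewal point in `[0, n]`. -/
def noRenewal (c : ℝ) (n : ℕ) : Set Config := {x | ∀ z : ℤ, 0 ≤ z → z ≤ n → z ∉ rnPts c x}

theorem measurableSet_noRenewal (c : ℝ) (n : ℕ) : MeasurableSet (noRenewal c n) :=
  measurableSet_setOfPred.2 (by have := (regenKernel_rn c).measurable_mem_pts; fun_prop)

/-- The blocks fill `[0, 2Nℓ]` and `[4Nℓ, 6Nℓ]`. One group would not suffice, since a single heavy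
edge longer than `ℓ` could spoil its local renewal point and that is too likely. With two groups,
either two different edges do the damage or one edge spans the gap. -/
theorem noRenewal_subset {c : ℝ} {N ℓ : ℕ} (hℓ : 0 < ℓ) :
    noRenewal c (6 * (N * ℓ)) ⊆
      (⋃ i ∈ Finset.range N, slowAt c ℓ (centre 0 ℓ i) ∪ slowAt c ℓ (centre (4 * (N * ℓ)) ℓ i)) ∪
        ((noLocal c 0 ℓ N ∪ noLocal c (4 * (N * ℓ)) ℓ N) ∪
          (hitSet c (6 * (N * ℓ)) (2 * (N * ℓ)) ∪ hitTwice c (6 * (N * ℓ)) ℓ)) := by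
  intro x hx
  by_contra hcon
  simp only [mem_union, not_or, mem_iUnion, not_exists] at hcon
  obtain ⟨hslow, ⟨hA, hB⟩, hhit, htwice⟩ := hcon
  simp only [noLocal, mem_ofPred_eq, not_forall, not_not] at hA hB
  obtain ⟨i, hi, hAi⟩ := hA
  obtain ⟨j, hj, hBj⟩ := hB
  have hsA := (hslow i (Finset.mem_range.2 hi)).1
  have hsB := (hslow j (Finset.mem_range.2 hj)).2
  have bound : ∀ i < N, 0 < (2 * (i : ℤ) + 1) * ℓ ∧ (2 * (i : ℤ) + 1) * ℓ < 2 * (N * ℓ) := by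
    intro i hi
    have h1 : (0 : ℤ) < ℓ := by exact_mod_cast hℓ
    have h2 : (2 * (i : ℤ) + 1) * ℓ < (2 * N) * ℓ := mul_lt_mul_of_pos_right (by omega) h1
    exact ⟨by positivity, by linarith⟩
  have bA := bound i hi
  have bB := bound j hj
  have hcA : centre 0 ℓ i = (2 * (i : ℤ) + 1) * ℓ := by simp [centre]
  have hcB : centre (4 * (N * ℓ)) ℓ j = 4 * (N * ℓ) + (2 * (j : ℤ) + 1) * ℓ := rfl
  have hcast : ((6 * (N * ℓ) : ℕ) : ℤ) = 6 * (N * ℓ) := by push_cast; ring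
  have hcast2 : ((2 * (N * ℓ) : ℕ) : ℤ) = 2 * (N * ℓ) := by push_cast; ring
  obtain ⟨i₁, j₁, h1, h2, h3, h4⟩ := exists_heavy_of_locRn hAi hsA
    (hx _ (by rw [hcA]; linarith) (by rw [hcA, hcast]; linarith))
  obtain ⟨i₂, j₂, h5, h6, h7, h8⟩ := exists_heavy_of_locRn hBj hsB
    (hx _ (by rw [hcB]; linarith) (by rw [hcB, hcast]; linarith))
  rw [hcA] at h1 h2
  rw [hcB] at h5 h6
  -- A common edge starts before `2Nℓ` and ends after `4Nℓ`, so it is longer than `2Nℓ`.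
  by_cases heq : (i₁, j₁) = (i₂, j₂)
  · obtain ⟨rfl, rfl⟩ := Prod.mk.inj heq
    exact hhit ⟨i₁, j₁, by rw [hcast]; linarith, by linarith, by rw [hcast2]; linarith, h4⟩
  · exact htwice ⟨i₁, j₁, i₂, j₂, heq, ⟨by rw [hcast]; linarith, by linarith, h3, h4⟩,
      ⟨by rw [hcast]; linarith, by linarith, h7, h8⟩⟩

section

variable (ρ : Measure (ℝ≥0 × Bool)) [IsProbabilityMeasure ρ]

/-- Windows of neighbouring blocks share only an endpoint, so local renewals at the centres are
independent, and each is at least as likely as a true renewal. -/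
theorem law_noLocal_le (c : ℝ) (a : ℤ) (ℓ N : ℕ) :
    law ρ (noLocal c a ℓ N) ≤ (1 - law ρ {x | 0 ∈ rnPts c x}) ^ N := by
  have hind := iIndepFun_of_dependsOn ρ (f := fun i : ℕ => locRn c ℓ (centre a ℓ i))
    (fun i => measurable_locRn _ _ _) (fun i => dependsOn_locRn c ℓ (centre a ℓ i)) (by
      have key : ∀ i j : ℕ, i < j → Disjoint (within (centre a ℓ i - ℓ) (centre a ℓ i + ℓ))
          (within (centre a ℓ j - ℓ) (centre a ℓ j + ℓ)) := by
        intro i j hij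
        refine Set.disjoint_left.2 fun e h1 h2 => ?_
        have h3 := e.2
        have h4 := h1.2
        have h5 := h2.1
        have h6 : (2 * (i : ℤ) + 2) * ℓ ≤ (2 * j) * ℓ :=
          mul_le_mul_of_nonneg_right (by omega) (by omega)
        simp only [centre] at h4 h5
        linarith
      intro i j hij
      rcases lt_or_gt_of_ne hij with h | h
      · exact key i j h
      · exact (key j i h).symm)
  have h1 := hind.measure_inter_preimage_eq_mul (Finset.range N) (sets := fun _ => {False})
    (fun _ _ => measurableSet_singleton _)
  have h2 : noLocal c a ℓ N = ⋂ i ∈ Finset.range N, locRn c ℓ (centre a ℓ i) ⁻¹' {False} := by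
    ext x
    simp [noLocal]
  rw [h2, h1]
  refine (Finset.prod_le_pow_card _ _ (1 - law ρ {x | 0 ∈ rnPts c x}) fun i _ => ?_).trans
    (by rw [Finset.card_range])
  have hm := measurableSet_setOfPred.2 ((regenKernel_rn c).measurable_mem_pts (centre a ℓ i))
  rw [← (regenKernel_rn c).measure_mem_pts ρ (centre a ℓ i), ← prob_compl_eq_one_sub hm]
  refine measure_mono fun x hx hmem => ?_
  have : locRn c ℓ (centre a ℓ i) x = False := hx
  rw [← this]
  exact locRn_of_mem_rnPts ℓ hmem

theorem le_ofReal_div_sq {X : ℝ≥0∞} {b : ℝ} {ℓ : ℕ} (hℓ : 0 < ℓ)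
    (h : (ℓ : ℝ≥0∞) ^ 2 * X ≤ ENNReal.ofReal b) : X ≤ ENNReal.ofReal (b / (ℓ : ℝ) ^ 2) := by
  have h0 : (ℓ : ℝ≥0∞) ^ 2 ≠ 0 := by simp; omega
  have h1 : (ℓ : ℝ≥0∞) ^ 2 ≠ ∞ := by finiteness
  rw [ENNReal.ofReal_div_of_pos (by positivity), ENNReal.ofReal_pow (by positivity),
    ENNReal.ofReal_natCast, ENNReal.le_div_iff_mul_le (Or.inl h0) (Or.inl h1), mul_comm]
  exact h

theorem law_slowAt_le {c : ℝ} (hT : slowMoment ρ c ≠ ∞) {ℓ : ℕ} (hℓ : 0 < ℓ) (z : ℤ) :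
    law ρ (slowAt c ℓ z) ≤ ENNReal.ofReal (2 * ((slowMoment ρ c).toReal / (ℓ : ℝ) ^ 2)) := by
  refine (measure_union_le _ _).trans ?_
  have hT' := ENNReal.ofReal_toReal hT
  rw [two_mul, ENNReal.ofReal_add (by positivity) (by positivity)]
  refine add_le_add (le_ofReal_div_sq hℓ ?_) (le_ofReal_div_sq hℓ ?_) <;> rw [hT']
  · exact sq_mul_law_slow_right_le ρ c z ℓ
  · exact sq_mul_law_slow_left_le ρ c z ℓ

/-- The radius is `N ^ 4`. The errors will be weighted by increments of order `N ^ 4`: the squared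
probability of two heavy edges, of order `N ^ (-6)`, is then summable, whereas the bound `N ^ (-3)`
for one edge would not be. The single spanning edge is kept as `hitMean`, to be summed exactly
later. -/
theorem law_noRenewal_le {c : ℝ} (hT : slowMoment ρ c ≠ ∞) (hH : heavyMoment ρ c ≠ ∞) {N : ℕ}
    (hN : 0 < N) :
    law ρ (noRenewal c (6 * N ^ 5)) ≤
      ENNReal.ofReal (4 * (slowMoment ρ c).toReal / (N : ℝ) ^ 7 +
        2 * (1 - (law ρ).real {x | 0 ∈ rnPts c x}) ^ N +
        49 * (heavyMoment ρ c).toReal ^ 2 / (N : ℝ) ^ 6) + hitMean ρ c (6 * N ^ 5) (2 * N ^ 5) := by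
  set t := (slowMoment ρ c).toReal with ht
  set η := (heavyMoment ρ c).toReal with hη
  set q := (law ρ).real {x | 0 ∈ rnPts c x} with hq
  have ht0 : 0 ≤ t := ENNReal.toReal_nonneg
  have hη0 : 0 ≤ η := ENNReal.toReal_nonneg
  have hq1 : 0 ≤ 1 - q := sub_nonneg.2 measureReal_le_one
  have hN' : (0 : ℝ) < N := by exact_mod_cast hN
  have hN1 : (1 : ℝ) ≤ N := by exact_mod_cast hN
  have hℓ : 0 < N ^ 4 := by positivity
  have e5 : N * N ^ 4 = N ^ 5 := by ring
  have hsub := noRenewal_subset (c := c) (N := N) hℓ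
  rw [e5] at hsub
  refine (measure_mono hsub).trans ?_
  have hA : law ρ (⋃ i ∈ Finset.range N, slowAt c (N ^ 4) (centre 0 (N ^ 4) i) ∪
      slowAt c (N ^ 4) (centre (4 * (N * (N ^ 4 : ℕ))) (N ^ 4) i)) ≤
      ENNReal.ofReal (4 * t / (N : ℝ) ^ 7) := by
    refine (measure_biUnion_finset_le _ _).trans ?_
    refine (Finset.sum_le_card_nsmul _ _ (ENNReal.ofReal (2 * (t / ((N ^ 4 : ℕ) : ℝ) ^ 2)) +
      ENNReal.ofReal (2 * (t / ((N ^ 4 : ℕ) : ℝ) ^ 2))) fun i _ => (measure_union_le _ _).trans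
        (add_le_add (law_slowAt_le ρ hT hℓ _) (law_slowAt_le ρ hT hℓ _))).trans (le_of_eq ?_)
    rw [Finset.card_range, nsmul_eq_mul, ← ENNReal.ofReal_add (by positivity) (by positivity),
      ← ENNReal.ofReal_natCast, ← ENNReal.ofReal_mul (by positivity)]
    congr 1
    push_cast
    field_simp
    ring
  have hB : ∀ a, law ρ (noLocal c a (N ^ 4) N) ≤ ENNReal.ofReal ((1 - q) ^ N) := by
    intro a
    refine (law_noLocal_le ρ c a (N ^ 4) N).trans (le_of_eq ?_)
    rw [ENNReal.ofReal_pow hq1, ENNReal.ofReal_sub _ measureReal_nonneg, ENNReal.ofReal_one,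
      ofReal_measureReal]
  have hC : law ρ (hitTwice c (6 * N ^ 5) (N ^ 4)) ≤ ENNReal.ofReal (49 * η ^ 2 / (N : ℝ) ^ 6) := by
    refine (law_hitTwice_le ρ c _ _).trans ?_
    have h1 : hitMean ρ c (6 * N ^ 5) (N ^ 4) ≤ ENNReal.ofReal (7 * η / (N : ℝ) ^ 3) := by
      have h2 := sq_mul_hitMean_le ρ c (6 * N ^ 5) (N ^ 4)
      have e6 : (((6 * N ^ 5 : ℕ) : ℝ≥0∞) + ((N ^ 4 : ℕ) : ℝ≥0∞)) * heavyMoment ρ c =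
          ENNReal.ofReal ((6 * (N : ℝ) ^ 5 + N ^ 4) * η) := by
        rw [ENNReal.ofReal_mul (by positivity), ENNReal.ofReal_toReal hH, ← Nat.cast_add,
          ← ENNReal.ofReal_natCast]
        push_cast
        rfl
      rw [e6] at h2
      refine (le_ofReal_div_sq hℓ h2).trans (ENNReal.ofReal_le_ofReal ?_)
      have h3 : (6 * (N : ℝ) ^ 5 + N ^ 4) ≤ 7 * N ^ 5 := by
        have : (N : ℝ) ^ 4 ≤ N ^ 5 := pow_le_pow_right₀ hN1 (by norm_num)
        linarith
      push_cast
      calc (6 * (N : ℝ) ^ 5 + N ^ 4) * η / ((N : ℝ) ^ 4) ^ 2 ≤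
          (7 * N ^ 5) * η / ((N : ℝ) ^ 4) ^ 2 := by gcongr
        _ = 7 * η / (N : ℝ) ^ 3 := by field_simp
    calc _ ≤ ENNReal.ofReal (7 * η / (N : ℝ) ^ 3) ^ 2 := by gcongr
      _ = _ := by
        rw [← ENNReal.ofReal_pow (by positivity)]
        congr 1
        field_simp
        ring
  rw [ENNReal.ofReal_add (by positivity) (by positivity),
    ENNReal.ofReal_add (by positivity) (by positivity), two_mul ((1 - q) ^ N),
    ENNReal.ofReal_add (by positivity) (by positivity)]
  refine (measure_union_le _ _).trans ?_
  rw [add_assoc, add_assoc]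
  refine add_le_add hA ((measure_union_le _ _).trans (add_le_add ((measure_union_le _ _).trans
    (add_le_add (hB _) (hB _))) ((measure_union_le _ _).trans ?_)))
  rw [add_comm]
  exact add_le_add hC (law_hitSet_le ρ c _ _)

/-! ### The first moment of the first renewal point -/

/-- The increments of `6 N ^ 5`. -/
def incr (N : ℕ) : ℕ := 6 * (5 * N ^ 4 + 10 * N ^ 3 + 10 * N ^ 2 + 5 * N + 1)

theorem sum_incr (M : ℕ) : ∑ N ∈ Finset.range M, incr N = 6 * M ^ 5 := by
  induction M with
  | zero => simp
  | succ M ih => rw [Finset.sum_range_succ, ih, incr]; ring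

theorem incr_le {N : ℕ} (hN : 0 < N) : incr N ≤ 186 * N ^ 4 := by
  have h3 : N ^ 3 ≤ N ^ 4 := Nat.pow_le_pow_right hN (by norm_num)
  have h2 : N ^ 2 ≤ N ^ 4 := Nat.pow_le_pow_right hN (by norm_num)
  have h1 : N ≤ N ^ 4 := Nat.le_self_pow (by norm_num) N
  have h0 : 1 ≤ N ^ 4 := Nat.one_le_pow _ _ hN
  rw [incr]
  omega

/-- If `6 * M ^ 5` is the first of these levels to reach the renewal point, all lower levels
contribute and their increments telescope to `6 * M ^ 5`. Without a renewal point the sum is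
infinite, because every increment is at least one. -/
theorem pointZero_le_tsum (c : ℝ) (x : Config) :
    ((pointZero (rnPts c x) : ℕ∞) : ℝ≥0∞) ≤
      ∑' N : ℕ, (noRenewal c (6 * N ^ 5)).indicator (fun _ => (incr N : ℝ≥0∞)) x := by
  classical
  rcases pointZero_cases (rnPts c x) with ⟨-, h2⟩ | ⟨n, h1, h2⟩
  · have : ∑' N : ℕ, (noRenewal c (6 * N ^ 5)).indicator (fun _ => (incr N : ℝ≥0∞)) x = ∞ := by
      rw [eq_top_iff, ← ENNReal.tsum_const_eq_top_of_ne_zero (α := ℕ) (one_ne_zero)]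
      refine ENNReal.tsum_le_tsum fun N => ?_
      rw [indicator_of_mem]
      · have : 1 ≤ incr N := by rw [incr]; omega
        exact_mod_cast this
      · intro z hz _ hmem
        lift z to ℕ using hz
        exact h2 z hmem
    rw [this]
    exact le_top
  · rw [h1]
    have hex : ∃ M : ℕ, n ≤ 6 * M ^ 5 := ⟨n, by
      have : n ≤ n ^ 5 := Nat.le_self_pow (by norm_num) n
      omega⟩
    have hM := Nat.find_spec hex
    have hmin : ∀ N < Nat.find hex, ¬ n ≤ 6 * N ^ 5 := fun N hN => Nat.find_min hex hN
    refine le_trans ?_ (ENNReal.sum_le_tsum (Finset.range (Nat.find hex)))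
    have hno : ∀ N ∈ Finset.range (Nat.find hex), x ∈ noRenewal c (6 * N ^ 5) := by
      intro N hN z hz hzN hmem
      have := hmin N (Finset.mem_range.1 hN)
      refine h2.2 z hz ?_ hmem
      push_cast at hzN
      zify at this
      omega
    rw [Finset.sum_congr rfl fun N hN => indicator_of_mem (hno N hN) _]
    have : n ≤ ∑ N ∈ Finset.range (Nat.find hex), incr N := by rw [sum_incr]; exact hM
    simpa using (by exact_mod_cast this :
      (n : ℝ≥0∞) ≤ ((∑ N ∈ Finset.range (Nat.find hex), incr N : ℕ) : ℝ≥0∞))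

-- After exchanging the sums, an edge length `k` is met only for `2 * N ^ 5 < k`. There the factor
-- `6 * N ^ 5 + k` is at most `4 * k`, and the increments add up to at most `192 * k`; hence the
-- second moment of `k` and the constant `768`.
omit [IsProbabilityMeasure ρ] in
theorem tsum_incr_mul_hitMean_le (c : ℝ) :
    ∑' N : ℕ, (incr N : ℝ≥0∞) * hitMean ρ c (6 * N ^ 5) (2 * N ^ 5) ≤ 768 * heavyMoment ρ c := by
  classical
  simp_rw [hitMean, heavyMoment, ← ENNReal.tsum_mul_left]
  rw [ENNReal.tsum_comm]
  refine ENNReal.tsum_le_tsum fun k => ?_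
  have h1 : ∀ N : ℕ, (incr N : ℝ≥0∞) * (if 2 * N ^ 5 < k then
      (((6 * N ^ 5 : ℕ) : ℝ≥0∞) + k) * ρ (heavySet c k) else 0) ≤
      (if 2 * N ^ 5 < k then (incr N : ℝ≥0∞) else 0) * (4 * k * ρ (heavySet c k)) := by
    intro N
    split_ifs with hN
    · refine mul_le_mul_right (mul_le_mul_left ?_ _) _
      have : 6 * N ^ 5 + k ≤ 4 * k := by omega
      exact_mod_cast this
    · simp
  refine (ENNReal.tsum_le_tsum h1).trans ?_
  rw [ENNReal.tsum_mul_right]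
  have hex : ∃ M : ℕ, k ≤ 2 * M ^ 5 := ⟨k, by
    have : k ≤ k ^ 5 := Nat.le_self_pow (by norm_num) k
    omega⟩
  have h2 : ∑' N : ℕ, (if 2 * N ^ 5 < k then (incr N : ℝ≥0∞) else 0) ≤ 192 * k := by
    set M := Nat.find hex with hMdef
    have hM : k ≤ 2 * M ^ 5 := Nat.find_spec hex
    have hmin : ∀ N < M, ¬ k ≤ 2 * N ^ 5 := fun N hN => Nat.find_min hex hN
    rw [tsum_eq_sum (s := Finset.range M) fun N hN => if_neg fun h => by
      have : M ≤ N := by simpa using hN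
      have h5 : M ^ 5 ≤ N ^ 5 := Nat.pow_le_pow_left this 5
      omega]
    -- By minimality `2 * (M - 1) ^ 5 < k`, and `M ≤ 2 * (M - 1)` once `M ≥ 2`; smaller `M` are
    -- checked directly.
    have h3 : 6 * M ^ 5 ≤ 192 * k := by
      rcases Nat.lt_or_ge M 2 with h | h
      · interval_cases hM' : M
        · simp
        · have := hmin 0 (by omega)
          omega
      · have h4 := hmin (M - 1) (by omega)
        have h5 : M ^ 5 ≤ (2 * (M - 1)) ^ 5 := Nat.pow_le_pow_left (by omega) 5
        rw [mul_pow] at h5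
        omega
    calc ∑ N ∈ Finset.range M, (if 2 * N ^ 5 < k then (incr N : ℝ≥0∞) else 0) ≤
        ∑ N ∈ Finset.range M, (incr N : ℝ≥0∞) := Finset.sum_le_sum fun N _ => by
          split_ifs
          · exact le_rfl
          · exact zero_le
      _ = ((∑ N ∈ Finset.range M, incr N : ℕ) : ℝ≥0∞) := by push_cast; rfl
      _ ≤ 192 * k := by rw [sum_incr]; exact_mod_cast h3
  refine (mul_le_mul_left h2 _).trans (le_of_eq ?_)
  ring

/-- The bound of `pointZero_le_tsum` has finite mean. -/
theorem lintegral_tsum_noRenewal_ne_top {c : ℝ} (hT : slowMoment ρ c ≠ ∞)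
    (hH : heavyMoment ρ c ≠ ∞) (hpos : 0 < law ρ {x | 0 ∈ rnPts c x}) :
    ∫⁻ x, ∑' N : ℕ, (noRenewal c (6 * N ^ 5)).indicator (fun _ => (incr N : ℝ≥0∞)) x ∂law ρ ≠
      ∞ := by
  rw [lintegral_tsum fun N => (measurable_const.indicator (measurableSet_noRenewal c _)).aemeasurable]
  simp_rw [lintegral_indicator_const (measurableSet_noRenewal c _)]
  -- The term `N = 0` is split off because the bounds divide by powers of `N`.
  rw [tsum_eq_zero_add' ENNReal.summable]
  refine ENNReal.add_ne_top.2 ⟨by finiteness, ?_⟩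
  set t := (slowMoment ρ c).toReal
  set η := (heavyMoment ρ c).toReal
  set q := (law ρ).real {x | 0 ∈ rnPts c x} with hq
  have ht0 : 0 ≤ t := ENNReal.toReal_nonneg
  have hq0 : 0 < q := ENNReal.toReal_pos hpos.ne' (measure_ne_top _ _)
  have hq1 : 0 ≤ 1 - q := sub_nonneg.2 measureReal_le_one
  let u : ℕ → ℝ := fun N => (744 * t + 9114 * η ^ 2) * (1 / ((N : ℝ) + 1) ^ 2) +
    372 * (((N + 1 : ℕ) : ℝ) ^ 4 * (1 - q) ^ (N + 1))
  have hu : Summable u := by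
    refine Summable.add (Summable.mul_left _ ?_) (Summable.mul_left _ ?_)
    · have := (summable_nat_add_iff 1).2 (Real.summable_one_div_nat_pow.2 one_lt_two)
      simpa using this
    · have := summable_pow_mul_geometric_of_norm_lt_one (R := ℝ) 4 (r := 1 - q)
        (by rw [Real.norm_of_nonneg hq1]; linarith)
      exact (summable_nat_add_iff 1).2 this
  have key : ∀ N : ℕ, (incr (N + 1) : ℝ≥0∞) * law ρ (noRenewal c (6 * (N + 1) ^ 5)) ≤
      ENNReal.ofReal (u N) +
        (incr (N + 1) : ℝ≥0∞) * hitMean ρ c (6 * (N + 1) ^ 5) (2 * (N + 1) ^ 5) := by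
    intro N
    refine (mul_le_mul_right (law_noRenewal_le ρ hT hH (Nat.succ_pos N)) _).trans ?_
    rw [mul_add]
    refine add_le_add ?_ le_rfl
    rw [← ENNReal.ofReal_natCast, ← ENNReal.ofReal_mul (by positivity)]
    refine ENNReal.ofReal_le_ofReal ?_
    have h1 : (incr (N + 1) : ℝ) ≤ 186 * ((N + 1 : ℕ) : ℝ) ^ 4 := by
      exact_mod_cast incr_le (Nat.succ_pos N)
    have hN1 : (1 : ℝ) ≤ ((N + 1 : ℕ) : ℝ) := by exact_mod_cast Nat.succ_pos N
    have hu' : u N = (744 * t + 9114 * η ^ 2) * (1 / ((N + 1 : ℕ) : ℝ) ^ 2) +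
      372 * (((N + 1 : ℕ) : ℝ) ^ 4 * (1 - q) ^ (N + 1)) := by simp [u]
    rw [hu', Nat.succ_eq_add_one]
    set n := ((N + 1 : ℕ) : ℝ)
    have hn0 : 0 < n := by linarith
    have h2 : n ^ 4 * (4 * t / n ^ 7) ≤ 4 * t * (1 / n ^ 2) := by
      rw [mul_one_div, ← mul_div_assoc, div_le_div_iff₀ (by positivity) (by positivity)]
      have : n ^ 6 ≤ n ^ 7 := pow_le_pow_right₀ hN1 (by norm_num)
      calc n ^ 4 * (4 * t) * n ^ 2 = 4 * t * n ^ 6 := by ring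
        _ ≤ 4 * t * n ^ 7 := by gcongr
    have h3 : n ^ 4 * (49 * η ^ 2 / n ^ 6) = 49 * η ^ 2 * (1 / n ^ 2) := by
      field_simp
    calc (incr (N + 1) : ℝ) * (4 * t / n ^ 7 + 2 * (1 - q) ^ (N + 1) + 49 * η ^ 2 / n ^ 6) ≤
        (186 * n ^ 4) * (4 * t / n ^ 7 + 2 * (1 - q) ^ (N + 1) + 49 * η ^ 2 / n ^ 6) := by
          gcongr
      _ = 186 * (n ^ 4 * (4 * t / n ^ 7)) + 372 * (n ^ 4 * (1 - q) ^ (N + 1)) +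
          186 * (n ^ 4 * (49 * η ^ 2 / n ^ 6)) := by ring
      _ ≤ 186 * (4 * t * (1 / n ^ 2)) + 372 * (n ^ 4 * (1 - q) ^ (N + 1)) +
          186 * (49 * η ^ 2 * (1 / n ^ 2)) := by rw [h3]; gcongr
      _ = _ := by ring
  refine ne_top_of_le_ne_top ?_ (ENNReal.tsum_le_tsum key)
  rw [ENNReal.tsum_add]
  refine ENNReal.add_ne_top.2 ⟨hu.tsum_ofReal_ne_top, ?_⟩
  refine ne_top_of_le_ne_top (b := 768 * heavyMoment ρ c) (by finiteness) ?_
  refine le_trans ?_ (tsum_incr_mul_hitMean_le ρ c)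
  rw [tsum_eq_zero_add' (f := fun N : ℕ => (incr N : ℝ≥0∞) * hitMean ρ c (6 * N ^ 5) (2 * N ^ 5))
    ENNReal.summable]
  exact le_add_self

end

end OrderedGraph

namespace OrderedGraph

open scoped NNReal
open Set Filter Topology

/-! ### Integrals over the first two non-negative points. -/

namespace RegenKernel

variable {J B : Config → ℤ → ℤ → Prop} (h : RegenKernel J B)
include h

/-- A function of the first two non-negative points, as a sum over their possible values. -/
theorem measurable_tsum_first_next {Φ : ℕ → Config → ℝ≥0∞} (hΦ : ∀ k, Measurable (Φ k)) :
    Measurable fun x => ∑' (n : ℕ) (k : ℕ),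
      {x | IsFirst (pts J B x) n ∧ IsNext (pts J B x) n (n + k + 1 : ℕ)}.indicator
        (fun x => Φ k (shift n x)) x := by
  refine Measurable.tsum fun n => Measurable.tsum fun k => ?_
  exact ((hΦ k).comp (measurable_shift _)).indicator (measurableSet_setOfPred.2
    ((h.measurable_isFirst _).and (h.measurable_isNext _ _)))

variable (ρ : Measure (ℝ≥0 × Bool)) [IsProbabilityMeasure ρ]

theorem lintegral_tsum_first_next_le {Φ : ℕ → Config → ℝ≥0∞} (hΦ : ∀ k, Measurable (Φ k))
    (hΦd : ∀ k, DependsOn (Φ k) (rightOf 0)) :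
    law ρ {x | 0 ∈ pts J B x} * ∫⁻ x, ∑' (n : ℕ) (k : ℕ),
      {x | IsFirst (pts J B x) n ∧ IsNext (pts J B x) n (n + k + 1 : ℕ)}.indicator
        (fun x => Φ k (shift n x)) x ∂law ρ ≤
      ∑' k : ℕ, ∫⁻ x, {x | IsNext (pts J B x) 0 (k + 1 : ℕ)}.indicator (Φ k) x ∂law ρ := by
  refine le_trans (le_of_eq ?_) (h.tsum_first_next_le ρ hΦ hΦd)
  have hm : ∀ n k : ℕ, Measurable ({x | IsFirst (pts J B x) n ∧
      IsNext (pts J B x) n (n + k + 1 : ℕ)}.indicator (fun x => Φ k (shift n x))) := fun n k =>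
    ((hΦ k).comp (measurable_shift _)).indicator (measurableSet_setOfPred.2
      ((h.measurable_isFirst _).and (h.measurable_isNext _ _)))
  rw [lintegral_tsum fun n => (Measurable.tsum fun k => hm n k).aemeasurable]
  congr 2
  funext n
  rw [lintegral_tsum fun k => (hm n k).aemeasurable]

/-- For each configuration at most one `n` is first, so the sum is the integral of `2 * n + 1` at
that `n`, and of `0` if there is none. -/
theorem tsum_mul_measure_isFirst_le {F : Config → ℝ≥0∞} (hF : Measurable F)
    (hle : ∀ x, ((pointZero (pts J B x) : ℕ∞) : ℝ≥0∞) ≤ F x) :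
    ∑' n : ℕ, (2 * (n : ℝ≥0∞) + 1) * law ρ {x | IsFirst (pts J B x) n} ≤
      2 * ∫⁻ x, F x ∂law ρ + 1 := by
  have hm : ∀ n : ℕ, MeasurableSet {x | IsFirst (pts J B x) n} := fun n =>
    measurableSet_setOfPred.2 (h.measurable_isFirst _)
  have e : 2 * ∫⁻ x, F x ∂law ρ + 1 = ∫⁻ x, (2 * F x + 1) ∂law ρ := by
    rw [lintegral_add_right _ measurable_const, lintegral_const_mul _ hF]
    simp
  rw [e]
  simp_rw [← lintegral_indicator_const (hm _)]
  rw [← lintegral_tsum fun n => (measurable_const.indicator (hm n)).aemeasurable]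
  refine lintegral_mono fun x => ?_
  rcases pointZero_cases (pts J B x) with ⟨-, h2⟩ | ⟨n, h1, h2⟩
  · rw [ENNReal.tsum_eq_zero.2 fun n => indicator_of_notMem (fun hn => h2 n hn.1) _]
    exact zero_le
  · rw [tsum_eq_single n fun m hm => indicator_of_notMem (fun hmF => hm ?_) _,
      indicator_of_mem (show x ∈ {x | IsFirst (pts J B x) (n : ℤ)} from h2)]
    · have := hle x
      rw [h1] at this
      gcongr
      simpa using this
    · have := (pointZero_eq_of_isFirst hmF).symm.trans h1
      exact_mod_cast this

end RegenKernel

section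

variable (ρ : Measure (ℝ≥0 × Bool)) [IsProbabilityMeasure ρ]

/-- The squared length of the interval between the first two non-negative renewal points. -/
noncomputable def sqGap (c : ℝ) (x : Config) : ℝ≥0∞ :=
  ∑' (n : ℕ) (k : ℕ), {x | IsFirst (rnPts c x) n ∧
    IsNext (rnPts c x) n (n + k + 1 : ℕ)}.indicator (fun _ => ((k : ℝ≥0∞) + 1) ^ 2) x

theorem measurable_sqGap (c : ℝ) : Measurable (sqGap c) :=
  (regenKernel_rn c).measurable_tsum_first_next (Φ := fun k _ => ((k : ℝ≥0∞) + 1) ^ 2)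
    fun _ => measurable_const

theorem measurable_tsum_noRenewal (c : ℝ) : Measurable fun x =>
    ∑' N : ℕ, (noRenewal c (6 * N ^ 5)).indicator (fun _ => (incr N : ℝ≥0∞)) x :=
  Measurable.tsum fun _ => measurable_const.indicator (measurableSet_noRenewal c _)

theorem lintegral_sqGap_ne_top {c : ℝ} (hT : slowMoment ρ c ≠ ∞)
    (hH : heavyMoment ρ c ≠ ∞) (hpos : 0 < law ρ {x | 0 ∈ rnPts c x}) :
    ∫⁻ x, sqGap c x ∂law ρ ≠ ∞ := by
  have k := regenKernel_rn c
  have h1 := k.lintegral_tsum_first_next_le ρ (Φ := fun k _ => ((k : ℝ≥0∞) + 1) ^ 2)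
    (fun _ => measurable_const) (fun _ _ _ _ => rfl)
  have h2 : ∀ j : ℕ, ∫⁻ x, {x | IsNext (rnPts c x) 0 (j + 1 : ℕ)}.indicator
      (fun _ => ((j : ℝ≥0∞) + 1) ^ 2) x ∂law ρ =
      ((j : ℝ≥0∞) + 1) ^ 2 * law ρ {x | IsNext (rnPts c x) 0 (j + 1 : ℕ)} := fun j =>
    lintegral_indicator_const (measurableSet_setOfPred.2 (k.measurable_isNext _ _)) _
  simp_rw [h2] at h1
  have h3 := (h1.trans (k.tsum_sq_measure_isNext_le ρ)).trans
    (k.tsum_mul_measure_isFirst_le ρ (measurable_tsum_noRenewal c) (pointZero_le_tsum c))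
  have h4 := lintegral_tsum_noRenewal_ne_top ρ hT hH hpos
  intro htop
  have h5 : (∫⁻ x, ∑' (n : ℕ) (k : ℕ), {x | IsFirst (rnPts c x) n ∧
    IsNext (rnPts c x) n (n + k + 1 : ℕ)}.indicator (fun _ => ((k : ℝ≥0∞) + 1) ^ 2) x ∂law ρ) = ∞ :=
      htop
  rw [h5, ENNReal.mul_top hpos.ne', top_le_iff] at h3
  exact absurd h3 (by finiteness)

/-- The first point is finite because it is dominated by an integrable function, and the next exists
because there is almost surely no last point. In `sqGap` only the term of the actual values of `n`
and `k` survives. -/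
theorem ae_pointZero_rnPts {c : ℝ} (hT : slowMoment ρ c ≠ ∞)
    (hH : heavyMoment ρ c ≠ ∞) (hpos : 0 < law ρ {x | 0 ∈ rnPts c x}) :
    ∀ᵐ x ∂law ρ, ∃ n k : ℕ, pointZero (rnPts c x) = n ∧
      pointOne (rnPts c x) = (n + k + 1 : ℕ) ∧ sqGap c x = ((k : ℝ≥0∞) + 1) ^ 2 := by
  filter_upwards [ae_lt_top (measurable_tsum_noRenewal c)
    (lintegral_tsum_noRenewal_ne_top ρ hT hH hpos), (regenKernel_rn c).ae_not_last ρ] with x h1 h2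
  have h3 := (pointZero_le_tsum c x).trans_lt h1
  rcases pointZero_cases (rnPts c x) with ⟨h4, -⟩ | ⟨n, h4, h5⟩
  · rw [h4] at h3; simp at h3
  · rcases pointOne_cases h5 with ⟨-, h7⟩ | ⟨k, h6, h7⟩
    · obtain ⟨m, hm, hmem⟩ := h2 n h5.1
      exact absurd hmem (h7 m hm)
    · refine ⟨n, k, h4, h6, ?_⟩
      have hmem : x ∈ {x | IsFirst (rnPts c x) n ∧ IsNext (rnPts c x) n (n + k + 1 : ℕ)} :=
        ⟨h5, h7⟩
      rw [sqGap, tsum_eq_single n, tsum_eq_single k, indicator_of_mem hmem]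
      · intro k' hk'
        refine indicator_of_notMem (fun hmem => hk' ?_) _
        have := (pointOne_eq_of_isNext h5 (by omega) hmem.2).symm.trans h6
        have h8 : n + k' + 1 = n + k + 1 := by exact_mod_cast this
        omega
      · intro n' hn'
        refine ENNReal.tsum_eq_zero.2 fun k' => indicator_of_notMem (fun hmem => hn' ?_) _
        have := (pointZero_eq_of_isFirst hmem.1).symm.trans h4
        exact_mod_cast this

/-- The minimal weight between the first two non-negative strongly connected points. -/
noncomputable def firstMin (x : Config) : ℝ≥0∞ :=
  ∑' (n : ℕ) (k : ℕ), {x | IsFirst (scPts x) n ∧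
    IsNext (scPts x) n (n + k + 1 : ℕ)}.indicator (fun x => minW (shift n x) 0 (k + 1 : ℕ)) x

theorem measurable_firstMin : Measurable firstMin :=
  regenKernel_sc.measurable_tsum_first_next (Φ := fun k x => minW x 0 (k + 1 : ℕ))
    fun _ => measurable_minW _ _

theorem lintegral_firstMin_le :
    law ρ {x | 0 ∈ scPts x} * ∫⁻ x, firstMin x ∂law ρ ≤
      ∑' k : ℕ, ∫⁻ x, {x | IsNext (scPts x) 0 (k + 1 : ℕ)}.indicator
        (fun x => minW x 0 (k + 1 : ℕ)) x ∂law ρ :=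
  regenKernel_sc.lintegral_tsum_first_next_le ρ (Φ := fun k x => minW x 0 (k + 1 : ℕ))
    (fun _ => measurable_minW _ _) (fun _ => (dependsOn_minW _ _).mono fun _ he => he.1)

theorem minW_le_firstMin {x : Config} {n k : ℕ} (h1 : IsFirst (scPts x) n)
    (h2 : IsNext (scPts x) n (n + k + 1 : ℕ)) : minW x n (n + k + 1 : ℕ) ≤ firstMin x := by
  have h3 : {x | IsFirst (scPts x) n ∧ IsNext (scPts x) n (n + k + 1 : ℕ)}.indicator
      (fun x => minW (shift n x) 0 (k + 1 : ℕ)) x = minW x n (n + k + 1 : ℕ) := by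
    have hmem : x ∈ {x | IsFirst (scPts x) n ∧ IsNext (scPts x) n (n + k + 1 : ℕ)} := ⟨h1, h2⟩
    rw [indicator_of_mem hmem, minW_shift, zero_add]
    congr 1
    push_cast
    ring
  rw [← h3]
  exact (ENNReal.le_tsum k).trans (ENNReal.le_tsum (f := fun n : ℕ => ∑' k : ℕ,
    {x | IsFirst (scPts x) n ∧ IsNext (scPts x) n (n + k + 1 : ℕ)}.indicator
      (fun x => minW (shift n x) 0 (k + 1 : ℕ)) x) n)

end

/-! ### Transfer to an arbitrary probability space -/

section Transfer

variable {Ω : Type*} {v : ℤ → ℤ → Ω → ℝ} {α : ℤ → ℤ → Ω → Bool}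

/-- The configuration of a realisation. -/
def config (v : ℤ → ℤ → Ω → ℝ) (α : ℤ → ℤ → Ω → Bool) (ω : Ω) : Config :=
  fun e => ((v e.1.1 e.1.2 ω).toNNReal, α e.1.1 e.1.2 ω)

theorem ed_config {ω : Ω} {i j : ℤ} (h : i < j) : ed (config v α ω) i j ↔ edgeRel α ω i j := by
  simp [ed, config, edgeRel, h]

theorem wt_config {ω : Ω} {i j : ℤ} (h : i < j) :
    wt (config v α ω) i j = (v i j ω).toNNReal := by
  simp [wt, config, h]

theorem nonempty_incPath_mono {E E' : ℤ → ℤ → Prop} (h : ∀ i j, i < j → E i j → E' i j) {i j : ℤ}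
    (π : IncPath E i j) : Nonempty (IncPath E' i j) := by
  induction π with
  | nil i => exact ⟨.nil i⟩
  | cons hij he _ ih =>
    obtain ⟨σ⟩ := ih
    exact ⟨.cons hij (h _ _ hij he) σ⟩

theorem stronglyConnectedPoints_eq (v : ℤ → ℤ → Ω → ℝ) (α : ℤ → ℤ → Ω → Bool) (ω : Ω) :
    stronglyConnectedPoints (edgeRel α ω) = scPts (config v α ω) := by
  have key : ∀ i j, Nonempty (IncPath (edgeRel α ω) i j) ↔ Fast 0 (config v α ω) i j := by
    intro i j
    rw [fast_zero_iff]
    exact ⟨fun ⟨π⟩ => nonempty_incPath_mono (fun i j h => (ed_config h).2) π,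
      fun ⟨π⟩ => nonempty_incPath_mono (fun i j h => (ed_config h).1) π⟩
  ext z
  simp only [stronglyConnectedPoints, key, scPts, pts, mem_ofPred_eq]
  tauto

/-- Configurations store truncated weights, which agree with the true ones only where the latter are
non-negative. -/
theorem renewalPoints_eq (c : ℝ) {ω : Ω} (hω : ∀ i j, i < j → 0 ≤ v i j ω) :
    renewalPoints c (edgeRel α ω) (weightAt v ω) = rnPts c (config v α ω) := by
  have key : ∀ i j, lastPassage (edgeRel α ω) (weightAt v ω) i j = lp (config v α ω) i j :=
    fun i j => lastPassage_congr fun a b _ hab _ => ⟨(ed_config hab).symm, by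
      rw [wt_config hab, Real.coe_toNNReal _ (hω a b hab)]; rfl⟩
  ext z
  simp only [renewalPoints, EventPP, EventMP, EventMM, key, rnPts, pts, mem_ofPred_eq, Fast]
  constructor
  · rintro ⟨h1, h2, h3⟩
    refine ⟨fun y hy => ?_, fun i j hi hj hH => ?_, fun y hy => ?_⟩
    · have := h3 (z - y).toNat (by omega)
      rw [show z - ((z - y).toNat : ℤ) = y by omega, ← Int.cast_natCast (R := ℝ),
        Int.toNat_of_nonneg (by omega)] at this
      simpa using this
    · have hij := hi.trans hj
      have := h2 (z - i).toNat (j - z).toNat (by omega) (by omega)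
      rw [show z - ((z - i).toNat : ℤ) = i by omega, show z + ((j - z).toNat : ℤ) = j by omega,
        ← Int.cast_natCast (R := ℝ), ← Int.cast_natCast (R := ℝ),
        Int.toNat_of_nonneg (by omega), Int.toNat_of_nonneg (by omega)] at this
      have h4 := this ((ed_config hij).1 hH.1)
      have h5 := hH.2
      rw [wt_config hij, Real.coe_toNNReal _ (hω i j hij)] at h5
      push_cast at h4
      simp only [weightAt] at h4
      linarith
    · have := h1 (y - z).toNat (by omega)
      rw [show z + ((y - z).toNat : ℤ) = y by omega, ← Int.cast_natCast (R := ℝ),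
        Int.toNat_of_nonneg (by omega)] at this
      simpa using this
  · rintro ⟨h1, h2, h3⟩
    refine ⟨fun l hl => ?_, fun j l hj hl hE => ?_, fun l hl => ?_⟩
    · simpa using h3 (z + l) (by omega)
    · have hij : z - (j : ℤ) < z + l := by omega
      by_contra hcon
      rw [not_lt] at hcon
      refine h2 (z - j) (z + l) (by omega) (by omega) ⟨(ed_config hij).2 hE, ?_⟩
      rw [wt_config hij, Real.coe_toNNReal _ (hω _ _ hij)]
      refine le_trans (le_of_eq ?_) hcon
      push_cast
      ring
    · simpa using h1 (z - l) (by omega)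

theorem ofReal_typicalMin_le {ω : Ω} (hω : ∀ i j, i < j → 0 ≤ v i j ω)
    (hlast : ∀ n : ℤ, n ∈ scPts (config v α ω) → ∃ m, n < m ∧ m ∈ scPts (config v α ω)) :
    ENNReal.ofReal (typicalMin v α ω) ≤ firstMin (config v α ω) := by
  rw [typicalMin, stronglyConnectedPoints_eq v α ω]
  set x := config v α ω with hx
  rcases pointZero_cases (scPts x) with ⟨h1, -⟩ | ⟨n, h1, h2⟩
  -- Without a non-negative strongly connected point the minimum is over the empty set and takes the
  -- default value `0`.
  · rw [h1, minWeight]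
    have : {y : ℝ | ∃ i j : ℕ, (⊤ : ℕ∞) ≤ i ∧ i < j ∧ (j : ℕ∞) ≤ pointOne (scPts x) ∧
        y = weightAt v ω i j} = ∅ := by
      ext y; simp
    rw [this]
    simp
  · rcases pointOne_cases h2 with ⟨-, h4⟩ | ⟨k, h3, h4⟩
    · obtain ⟨m, hm, hmem⟩ := hlast n h2.1
      exact absurd hmem (h4 m hm)
    · refine le_trans ?_ (minW_le_firstMin h2 h4)
      refine le_iInf fun i => le_iInf fun j => le_iInf fun hij => ?_
      rw [hx, wt_config hij.2.1, h1, h3]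
      refine ENNReal.ofReal_le_ofReal (csInf_le ⟨0, ?_⟩ ?_)
      · rintro y ⟨a, b, -, hab, -, rfl⟩
        exact hω a b (by omega)
      · obtain ⟨i, rfl⟩ : ∃ i' : ℕ, i = i' := ⟨i.toNat, by omega⟩
        obtain ⟨j, rfl⟩ : ∃ j' : ℕ, j = j' := ⟨j.toNat, by omega⟩
        exact ⟨i, j, by exact_mod_cast hij.1, by omega, by exact_mod_cast hij.2.2, rfl⟩

theorem typicalMin_nonneg {ω : Ω} (hω : ∀ i j, i < j → 0 ≤ v i j ω) : 0 ≤ typicalMin v α ω := by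
  refine Real.sInf_nonneg ?_
  rintro y ⟨a, b, -, hab, -, rfl⟩
  exact hω a b (by omega)

theorem typicalMin_le {ω : Ω} (hω : ∀ i j, i < j → 0 ≤ v i j ω) {c : ℝ} (hc : 0 ≤ c)
    (hle : ∀ i j, i < j → v i j ω ≤ c) : typicalMin v α ω ≤ c := by
  rw [typicalMin, minWeight]
  set A := {y : ℝ | ∃ i j : ℕ, pointZero (stronglyConnectedPoints (edgeRel α ω)) ≤ i ∧ i < j ∧
    (j : ℕ∞) ≤ pointOne (stronglyConnectedPoints (edgeRel α ω)) ∧ y = weightAt v ω i j} with hA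
  rcases A.eq_empty_or_nonempty with h | ⟨y, hy⟩
  · rw [h, Real.sInf_empty]; exact hc
  · refine (csInf_le ⟨0, ?_⟩ hy).trans ?_
    · rintro y ⟨a, b, -, hab, -, rfl⟩
      exact hω a b (by omega)
    · obtain ⟨a, b, -, hab, -, rfl⟩ := hy
      exact hle a b (by omega)

variable [MeasurableSpace Ω] {P : Measure Ω} {p : ℝ} {ν : Measure ℝ}

theorem measurable_config (h : IsWeightedRandomGraph P p ν v α) : Measurable (config v α) :=
  measurable_pi_iff.2 fun e =>
    (h.measurable_weight _ _ e.2).real_toNNReal.prodMk (h.measurable_edge _ _ e.2)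

/-- The law of the mark of an edge. -/
noncomputable def markLaw (P : Measure Ω) (v : ℤ → ℤ → Ω → ℝ) (α : ℤ → ℤ → Ω → Bool) :
    Measure (ℝ≥0 × Bool) :=
  P.map fun ω => ((v 0 1 ω).toNNReal, α 0 1 ω)

theorem isProbabilityMeasure_markLaw [IsProbabilityMeasure P]
    (h : IsWeightedRandomGraph P p ν v α) : IsProbabilityMeasure (markLaw P v α) :=
  Measure.isProbabilityMeasure_map ((h.measurable_weight 0 1 one_pos).real_toNNReal.prodMk
    (h.measurable_edge 0 1 one_pos)).aemeasurable

theorem map_edge_eq [IsProbabilityMeasure P] (h : IsWeightedRandomGraph P p ν v α) {i j : ℤ}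
    (hij : i < j) : P.map (α i j) = P.map (α 0 1) := by
  have key : ∀ i j, i < j → P.map (α i j) {true} = ENNReal.ofReal p ∧
      P.map (α i j) {false} = 1 - ENNReal.ofReal p := by
    intro i j hij
    have hm := h.measurable_edge i j hij
    have h1 : P.map (α i j) {true} = ENNReal.ofReal p := by
      rw [Measure.map_apply hm (measurableSet_singleton _)]
      exact h.prob_edge i j hij
    have : IsProbabilityMeasure (P.map (α i j)) :=
      Measure.isProbabilityMeasure_map hm.aemeasurable
    refine ⟨h1, ?_⟩
    rw [← h1, ← prob_compl_eq_one_sub (measurableSet_singleton _)]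
    congr 1
    ext b
    simp
  refine Measure.ext_of_singleton fun b => ?_
  cases b
  · rw [(key i j hij).2, (key 0 1 one_pos).2]
  · rw [(key i j hij).1, (key 0 1 one_pos).1]

theorem map_mark_eq [IsProbabilityMeasure P] (h : IsWeightedRandomGraph P p ν v α) {i j : ℤ}
    (hij : i < j) : P.map (fun ω => ((v i j ω).toNNReal, α i j ω)) = markLaw P v α := by
  have key : ∀ i j, i < j → P.map (fun ω => ((v i j ω).toNNReal, α i j ω)) =
      (ν.map Real.toNNReal).prod (P.map (α i j)) := by
    intro i j hij
    have hv := h.measurable_weight i j hij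
    have hi := (h.indep_weight_edge i j hij).comp measurable_real_toNNReal measurable_id
    have := (indepFun_iff_map_prod_eq_prod_map_map (hv.real_toNNReal.aemeasurable)
      (h.measurable_edge i j hij).aemeasurable).1 hi
    refine this.trans ?_
    congr 1
    rw [← h.law_weight i j hij, Measure.map_map measurable_real_toNNReal hv]
    rfl
  rw [markLaw, key i j hij, key 0 1 one_pos, map_edge_eq h hij]

theorem map_config_eq [IsProbabilityMeasure P] (h : IsWeightedRandomGraph P p ν v α) :
    P.map (config v α) = law (markLaw P v α) := by
  have hm : ∀ e : Edge, Measurable fun ω => ((v e.1.1 e.1.2 ω).toNNReal, α e.1.1 e.1.2 ω) :=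
    fun e => (h.measurable_weight _ _ e.2).real_toNNReal.prodMk (h.measurable_edge _ _ e.2)
  have hind : iIndepFun (fun (e : Edge) ω => ((v e.1.1 e.1.2 ω).toNNReal, α e.1.1 e.1.2 ω)) P :=
    h.indep_pairs.comp (fun _ (a : ℝ × Bool) => (a.1.toNNReal, a.2)) fun _ => by fun_prop
  have := hind.map_fun_eq_infinitePi_map hm
  refine this.trans ?_
  rw [law]
  congr 1
  funext e
  exact map_mark_eq h e.2

theorem ae_nonneg (h : IsWeightedRandomGraph P p ν v α) (hν : ∀ᵐ x ∂ν, 0 ≤ x) :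
    ∀ᵐ ω ∂P, ∀ i j, i < j → 0 ≤ v i j ω := by
  refine ae_all_iff.2 fun i => ae_all_iff.2 fun j => ?_
  by_cases hij : i < j
  · have := ae_of_ae_map (h.measurable_weight i j hij).aemeasurable
      (by rw [h.law_weight i j hij]; exact hν)
    filter_upwards [this] with ω hω _ using hω
  · exact Eventually.of_forall fun ω hlt => absurd hlt hij

theorem law_zero_mem_scPts [IsProbabilityMeasure P] (h : IsWeightedRandomGraph P p ν v α) :
    law (markLaw P v α) {x | 0 ∈ scPts x} = ENNReal.ofReal (stronglyConnectedDensity P α) := by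
  rw [← map_config_eq h, Measure.map_apply (measurable_config h)
    (measurableSet_setOfPred.2 (regenKernel_sc.measurable_mem_pts 0)), stronglyConnectedDensity,
    ofReal_measureReal]
  congr 1
  ext ω
  simp [stronglyConnectedPoints_eq v α ω]

theorem le_essInf_id [IsProbabilityMeasure ν] {a : ℝ} (h : ∀ᵐ x ∂ν, a ≤ x) :
    a ≤ essInf (fun x : ℝ => x) ν := by
  refine Filter.le_liminf_of_le ?_ h
  -- The real-valued lower limit is meaningful only with a coboundedness condition, which holds
  -- since no real number exceeds every natural number.
  obtain ⟨n, hn⟩ : ∃ n : ℕ, ∃ᶠ x in ae ν, x ≤ (n : ℝ) := by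
    by_contra hcon
    push Not at hcon
    have h1 : ∀ᵐ x ∂ν, ∀ n : ℕ, (n : ℝ) < x := ae_all_iff.2 hcon
    obtain ⟨x, hx⟩ := h1.exists
    obtain ⟨n, hn⟩ := exists_nat_ge x
    exact absurd (hx n) (not_lt.2 hn)
  exact IsCoboundedUnder.of_frequently_le hn

theorem isProbabilityMeasure_weight [IsProbabilityMeasure P]
    (h : IsWeightedRandomGraph P p ν v α) : IsProbabilityMeasure ν := by
  rw [← h.law_weight 0 1 one_pos]
  exact Measure.isProbabilityMeasure_map (h.measurable_weight 0 1 one_pos).aemeasurable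

/-- Summing `k ^ 2` over all `k ≤ v / c` gives at most `(v / c) ^ 3`, which is integrable. -/
theorem heavyMoment_ne_top [IsProbabilityMeasure P] (h : IsWeightedRandomGraph P p ν v α)
    (hν : ∀ᵐ x ∂ν, 0 ≤ x) (hmoment : Integrable (fun x : ℝ => x ^ 3) ν) {c : ℝ} (hc : 0 < c) :
    heavyMoment (markLaw P v α) c ≠ ∞ := by
  have h1 : ∀ k : ℕ, (k : ℝ≥0∞) ^ 2 * markLaw P v α (heavySet c k) ≤
      (k : ℝ≥0∞) ^ 2 * ν {x | c * k ≤ x} := by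
    intro k
    rcases Nat.eq_zero_or_pos k with rfl | hk
    · simp
    refine mul_le_mul_right ?_ _
    rw [markLaw, Measure.map_apply ((h.measurable_weight 0 1 one_pos).real_toNNReal.prodMk
      (h.measurable_edge 0 1 one_pos)) (measurableSet_heavySet c k), ← h.law_weight 0 1 one_pos,
      Measure.map_apply (s := {x : ℝ | c * k ≤ x}) (h.measurable_weight 0 1 one_pos)
        measurableSet_Ici]
    refine measure_mono fun ω hω => ?_
    have h2 : c * k ≤ (v 0 1 ω).toNNReal := hω.2
    rw [Real.coe_toNNReal'] at h2
    rcases le_max_iff.1 h2 with h3 | h3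
    · exact h3
    · have : 0 < c * k := by positivity
      exact absurd h3 (not_le.2 this)
  refine ne_top_of_le_ne_top ?_ (ENNReal.tsum_le_tsum h1)
  have hm : ∀ k : ℕ, MeasurableSet {x : ℝ | c * k ≤ x} := fun k => measurableSet_Ici
  simp_rw [← lintegral_indicator_const (hm _)]
  rw [← lintegral_tsum fun k => (measurable_const.indicator (hm k)).aemeasurable]
  have hint : ∫⁻ x, ENNReal.ofReal (x ^ 3 / c ^ 3) ∂ν ≠ ∞ :=
    (hmoment.div_const _).lintegral_lt_top.ne
  refine ne_top_of_le_ne_top hint (lintegral_mono_ae ?_)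
  filter_upwards [hν] with x hx
  set m := ⌊x / c⌋₊
  have hmem : ∀ k : ℕ, x ∈ {x : ℝ | c * k ≤ x} ↔ k ≤ m := fun k => by
    rw [Nat.le_floor_iff (by positivity), le_div_iff₀ hc, mul_comm]
    rfl
  rw [tsum_eq_sum (s := Finset.range (m + 1)) fun k hk => indicator_of_notMem (fun hmm => hk
    (Finset.mem_range.2 (Nat.lt_succ_of_le ((hmem k).1 hmm)))) _]
  have hsum : ∑ k ∈ Finset.range (m + 1), k ^ 2 ≤ m ^ 3 := by
    rw [Finset.sum_range_succ']
    calc ∑ k ∈ Finset.range m, (k + 1) ^ 2 + 0 ^ 2 ≤ ∑ k ∈ Finset.range m, m ^ 2 := by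
          simp only [ne_eq, OfNat.ofNat_ne_zero, not_false_eq_true, zero_pow, add_zero]
          exact Finset.sum_le_sum fun k hk => Nat.pow_le_pow_left (Finset.mem_range.1 hk) 2
      _ = m ^ 3 := by rw [Finset.sum_const, Finset.card_range, smul_eq_mul]; ring
  calc ∑ k ∈ Finset.range (m + 1), {x : ℝ | c * k ≤ x}.indicator (fun _ => (k : ℝ≥0∞) ^ 2) x
      ≤ ∑ k ∈ Finset.range (m + 1), (k : ℝ≥0∞) ^ 2 :=
        Finset.sum_le_sum fun k _ => indicator_le_self' (fun _ _ => zero_le) x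
    _ = ((∑ k ∈ Finset.range (m + 1), k ^ 2 : ℕ) : ℝ≥0∞) := by push_cast; rfl
    _ ≤ ((m ^ 3 : ℕ) : ℝ≥0∞) := by exact_mod_cast hsum
    _ = ENNReal.ofReal ((m : ℝ) ^ 3) := by
        rw [← ENNReal.ofReal_natCast]; push_cast; rfl
    _ ≤ ENNReal.ofReal (x ^ 3 / c ^ 3) := by
        refine ENNReal.ofReal_le_ofReal ?_
        rw [← div_pow]
        exact pow_le_pow_left₀ (Nat.cast_nonneg _) (Nat.floor_le (by positivity)) 3

theorem markLaw_absent_lt_one [IsProbabilityMeasure P] (h : IsWeightedRandomGraph P p ν v α)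
    (hp : 0 < p) : markLaw P v α absent < 1 := by
  have := isProbabilityMeasure_markLaw h
  have h1 : markLaw P v α absentᶜ = ENNReal.ofReal p := by
    rw [markLaw, Measure.map_apply ((h.measurable_weight 0 1 one_pos).real_toNNReal.prodMk
      (h.measurable_edge 0 1 one_pos)) measurableSet_absent.compl, ← h.prob_edge 0 1 one_pos]
    congr 1
    ext ω
    simp [absent]
  have h2 := prob_compl_eq_one_sub measurableSet_absent (μ := markLaw P v α)
  rw [h1] at h2
  by_contra hge
  rw [not_lt] at hge
  rw [tsub_eq_zero_of_le hge, ENNReal.ofReal_eq_zero] at h2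
  linarith

/-- Otherwise almost surely every edge is present and every weight is at least `c`. Then the density
is one and the essential infimum at least `c`, against the lower hypothesis. -/
theorem markLaw_heavySet_lt_one [IsProbabilityMeasure P] (h : IsWeightedRandomGraph P p ν v α)
    {c : ℝ} (hc : 0 < c)
    (hlow : stronglyConnectedDensity P α * essInf (fun x : ℝ => x) ν < c) :
    markLaw P v α (heavySet c 1) < 1 := by
  have hprob := isProbabilityMeasure_markLaw h
  have hprob' := isProbabilityMeasure_weight h
  refine lt_of_le_of_ne prob_le_one fun h1 => ?_
  have hmm := (h.measurable_weight 0 1 one_pos).real_toNNReal.prodMk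
      (h.measurable_edge 0 1 one_pos)
  have h2 : ∀ᵐ a ∂markLaw P v α, a ∈ heavySet c 1 :=
    (mem_ae_iff_prob_eq_one (measurableSet_heavySet c 1)).2 h1
  have h3 := ae_of_ae_map hmm.aemeasurable h2
  have hv : ∀ᵐ x ∂ν, c ≤ x := by
    rw [← h.law_weight 0 1 one_pos, ae_map_iff (h.measurable_weight 0 1 one_pos).aemeasurable
      measurableSet_Ici]
    filter_upwards [h3] with ω hω
    have h4 : c * (1 : ℕ) ≤ (v 0 1 ω).toNNReal := hω.2
    rw [Real.coe_toNNReal', Nat.cast_one, mul_one] at h4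
    rcases le_max_iff.1 h4 with h5 | h5
    · exact h5
    · exact absurd h5 (not_le.2 hc)
  have hα : ∀ᵐ ω ∂P, ∀ i j, i < j → α i j ω = true := by
    refine ae_all_iff.2 fun i => ae_all_iff.2 fun j => ?_
    by_cases hij : i < j
    · have h5 : ∀ᵐ b ∂P.map (α 0 1), b = true := by
        rw [ae_map_iff (p := fun b => b = true) (h.measurable_edge 0 1 one_pos).aemeasurable
          (measurableSet_singleton true)]
        filter_upwards [h3] with ω hω using hω.1
      rw [← map_edge_eq h hij] at h5
      filter_upwards [ae_of_ae_map (h.measurable_edge i j hij).aemeasurable h5] with ω hω _ using hω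
    · exact Eventually.of_forall fun ω hlt => absurd hlt hij
  have hγ : stronglyConnectedDensity P α = 1 := by
    rw [stronglyConnectedDensity, measureReal_def]
    have : ∀ᵐ ω ∂P, (0 : ℤ) ∈ stronglyConnectedPoints (edgeRel α ω) := by
      filter_upwards [hα] with ω hω
      exact ⟨fun y hy => ⟨.cons hy (hω 0 y hy) (.nil y)⟩,
        fun y hy => ⟨.cons hy (hω y 0 hy) (.nil 0)⟩⟩
    rw [(measure_congr (Filter.eventuallyEq_univ.2 this)).trans measure_univ, ENNReal.toReal_one]
  rw [hγ, one_mul] at hlow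
  exact absurd (le_essInf_id hv) (not_le.2 hlow)

/-- If the weights were almost surely at most `c`, so would be the typical minimum, and the density
is at most one, against the upper hypothesis. -/
theorem exists_markLaw_fast_pos [IsProbabilityMeasure P] (h : IsWeightedRandomGraph P p ν v α)
    (hp : 0 < p) (hν : ∀ᵐ x ∂ν, 0 ≤ x) {c : ℝ} (hc : 0 < c)
    (hup : c < stronglyConnectedDensity P α * ∫ ω, typicalMin v α ω ∂P) :
    ∃ b, c < b ∧ 0 < markLaw P v α {m | m.2 = true ∧ b ≤ m.1} := by
  obtain ⟨b, hcb, hb⟩ : ∃ b, c < b ∧ 0 < ν {x | b ≤ x} := by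
    by_contra hcon
    push Not at hcon
    have h1 : ∀ᵐ x ∂ν, x ≤ c := by
      have h2 : ∀ᵐ x ∂ν, ∀ n : ℕ, ¬ (c + 1 / ((n : ℝ) + 1) ≤ x) := ae_all_iff.2 fun n =>
        measure_eq_zero_iff_ae_notMem.1 (nonpos_iff_eq_zero.1 (hcon _ (by
          have : 0 < 1 / ((n : ℝ) + 1) := by positivity
          linarith)))
      filter_upwards [h2] with x hx
      by_contra hlt
      rw [not_le] at hlt
      obtain ⟨n, hn⟩ := exists_nat_one_div_lt (sub_pos.2 hlt)
      exact hx n (by linarith)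
    have h2 : ∀ᵐ ω ∂P, ∀ i j, i < j → v i j ω ≤ c := by
      refine ae_all_iff.2 fun i => ae_all_iff.2 fun j => ?_
      by_cases hij : i < j
      · have := ae_of_ae_map (h.measurable_weight i j hij).aemeasurable
          (by rw [h.law_weight i j hij]; exact h1)
        filter_upwards [this] with ω hω _ using hω
      · exact Eventually.of_forall fun ω hlt => absurd hlt hij
    have h3 : ∫ ω, typicalMin v α ω ∂P ≤ c := by
      refine (integral_mono_of_nonneg ?_ (integrable_const c) ?_).trans (by simp)
      · filter_upwards [ae_nonneg h hν] with ω hω using typicalMin_nonneg hω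
      · filter_upwards [ae_nonneg h hν, h2] with ω hω hω' using typicalMin_le hω hc.le hω'
    have h4 : stronglyConnectedDensity P α ≤ 1 := measureReal_le_one
    have h5 : 0 ≤ stronglyConnectedDensity P α := measureReal_nonneg
    nlinarith
  refine ⟨b, hcb, ?_⟩
  have hb0 : 0 < b := hc.trans hcb
  have hv := h.measurable_weight 0 1 one_pos
  have hα := h.measurable_edge 0 1 one_pos
  have h1 : P (v 0 1 ⁻¹' Set.Ici b ∩ α 0 1 ⁻¹' {true}) = ν (Set.Ici b) * ENNReal.ofReal p := by
    rw [(h.indep_weight_edge 0 1 one_pos).measure_inter_preimage_eq_mul _ _ measurableSet_Ici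
      (measurableSet_singleton _), ← h.law_weight 0 1 one_pos, Measure.map_apply hv measurableSet_Ici,
      ← h.prob_edge 0 1 one_pos]
    rfl
  rw [markLaw, Measure.map_apply (hv.real_toNNReal.prodMk hα) (measurableSet_fastMark b)]
  refine lt_of_lt_of_le ?_ (measure_mono (s := v 0 1 ⁻¹' Set.Ici b ∩ α 0 1 ⁻¹' {true}) ?_)
  · rw [h1]
    exact ENNReal.mul_pos hb.ne' (ENNReal.ofReal_pos.2 hp).ne'
  · rintro ω ⟨h2, h3⟩
    refine ⟨h3, ?_⟩
    exact (show b ≤ v 0 1 ω from h2).trans (Real.le_coe_toNNReal _)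

/-- Translates the upper hypothesis, stated for the interval following the first strongly connected
point, into one on the typical interval from `0`, where it is a mean gain per unit length. -/
theorem ofReal_lt_tsum_minW [IsProbabilityMeasure P] (h : IsWeightedRandomGraph P p ν v α)
    (hν : ∀ᵐ x ∂ν, 0 ≤ x) {c : ℝ} (hc : 0 < c)
    (hup : c < stronglyConnectedDensity P α * ∫ ω, typicalMin v α ω ∂P) :
    ENNReal.ofReal c < ∑' k : ℕ, ∫⁻ x, {x | IsNext (scPts x) 0 (k + 1 : ℕ)}.indicator
      (fun x => minW x 0 (k + 1 : ℕ)) x ∂law (markLaw P v α) := by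
  have hprob := isProbabilityMeasure_markLaw h
  refine lt_of_lt_of_le ?_ (lintegral_firstMin_le (markLaw P v α))
  have h0 : 0 ≤ stronglyConnectedDensity P α := measureReal_nonneg
  refine ((ENNReal.ofReal_lt_ofReal_iff (hc.trans hup)).2 hup).trans_le ?_
  rw [ENNReal.ofReal_mul h0, law_zero_mem_scPts h]
  refine mul_le_mul_right ?_ _
  have hn : 0 ≤ᵐ[P] typicalMin v α := by
    filter_upwards [ae_nonneg h hν] with ω hω using typicalMin_nonneg hω
  have h1 : ENNReal.ofReal (∫ ω, typicalMin v α ω ∂P) ≤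
      ∫⁻ ω, ENNReal.ofReal (typicalMin v α ω) ∂P := by
    -- A non-integrable minimum has integral `0` by convention, and the inequality is then trivial.
    by_cases hi : Integrable (typicalMin v α) P
    · rw [ofReal_integral_eq_lintegral_ofReal hi hn]
    · rw [integral_undef hi]; simp
  refine h1.trans ?_
  rw [← map_config_eq h, lintegral_map measurable_firstMin (measurable_config h)]
  have h2 := regenKernel_sc.ae_not_last (markLaw P v α)
  rw [← map_config_eq h] at h2
  refine lintegral_mono_ae ?_
  filter_upwards [ae_nonneg h hν, ae_of_ae_map (measurable_config h).aemeasurable h2] with ω h3 h4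
  exact ofReal_typicalMin_le h3 h4

end Transfer

end OrderedGraph

open OrderedGraph in
theorem mainTheorem8 {Ω : Type*} [MeasurableSpace Ω] (P : Measure Ω) [IsProbabilityMeasure P]
    (p : ℝ) (hp0 : 0 < p) (hp1 : p ≤ 1)
    (ν : Measure ℝ) (hν : ∀ᵐ x ∂ν, 0 ≤ x)
    (v : ℤ → ℤ → Ω → ℝ) (α : ℤ → ℤ → Ω → Bool)
    (hmodel : IsWeightedRandomGraph P p ν v α)
    (hmoment : Integrable (fun x : ℝ => x ^ 3) ν)
    (c : ℝ)
    (hc_lower : stronglyConnectedDensity P α * essInf (fun x : ℝ => x) ν < c)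
    (hc_upper : c < stronglyConnectedDensity P α * ∫ ω, typicalMin v α ω ∂P) :
    (∫⁻ ω, ((gammaZero c v α ω : ℕ∞) : ℝ≥0∞) ∂P) < ∞ ∧
      (∀ᵐ ω ∂P, gammaZero c v α ω < ⊤ ∧ gammaOne c v α ω < ⊤) ∧
      (∫⁻ ω, ((gammaOne c v α ω - gammaZero c v α ω : ℕ∞) : ℝ≥0∞) ^ 2 ∂P) < ∞ := by
  have hprob := isProbabilityMeasure_markLaw hmodel
  have hprobν := isProbabilityMeasure_weight hmodel
  -- Positivity of `c` comes from the lower hypothesis, since the weights are non-negative.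
  have hc : 0 < c := lt_of_le_of_lt
    (mul_nonneg measureReal_nonneg (le_essInf_id hν)) hc_lower
  have hgain := ofReal_lt_tsum_minW hmodel hν hc hc_upper
  have hT : slowMoment (markLaw P v α) c ≠ ∞ :=
    tsum_sq_measure_not_fast_ne_top _ hc (markLaw_absent_lt_one hmodel hp0) hgain
  have hH := heavyMoment_ne_top hmodel hν hmoment hc
  obtain ⟨b, hcb, hb⟩ := exists_markLaw_fast_pos hmodel hp0 hν hc hc_upper
  -- With density zero the upper hypothesis would read `c < 0`.
  have hγ : 0 < law (markLaw P v α) {x | 0 ∈ scPts x} := by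
    rw [law_zero_mem_scPts hmodel, ENNReal.ofReal_pos]
    refine lt_of_le_of_ne measureReal_nonneg fun h0 => ?_
    rw [← h0, zero_mul] at hc_upper
    exact lt_asymm hc hc_upper
  have hpos := law_zero_mem_rnPts_pos _ hc hcb hb hT hγ
    (markLaw_heavySet_lt_one hmodel hc hc_lower) hH
  have hmeas := measurable_config hmodel
  have hae := ae_pointZero_rnPts _ hT hH hpos
  have hF := lintegral_tsum_noRenewal_ne_top _ hT hH hpos
  have hG := lintegral_sqGap_ne_top _ hT hH hpos
  rw [← map_config_eq hmodel] at hae hF hG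
  rw [lintegral_map (measurable_tsum_noRenewal c) hmeas] at hF
  rw [lintegral_map (measurable_sqGap c) hmeas] at hG
  have hae' := ae_of_ae_map hmeas.aemeasurable hae
  have hnn := ae_nonneg hmodel hν
  refine ⟨lt_of_le_of_lt (lintegral_mono_ae ?_) hF.lt_top, ?_,
    lt_of_le_of_lt (lintegral_mono_ae ?_) hG.lt_top⟩
  · filter_upwards [hnn] with ω hω
    rw [gammaZero, renewalPoints_eq c hω]
    exact pointZero_le_tsum c _
  · filter_upwards [hnn, hae'] with ω hω hω'
    obtain ⟨n, k, h1, h2, -⟩ := hω'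
    rw [gammaZero, gammaOne, renewalPoints_eq c hω, h1, h2]
    exact ⟨ENat.natCast_lt_top _, ENat.natCast_lt_top _⟩
  · filter_upwards [hnn, hae'] with ω hω hω'
    obtain ⟨n, k, h1, h2, h3⟩ := hω'
    rw [gammaZero, gammaOne, renewalPoints_eq c hω, h1, h2, h3, ← ENat.natCast_sub,
      show n + k + 1 - n = k + 1 by omega]
    simp
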